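/- **Syntax.** Fix sets of localities $l$, locality variables $u$, data variables $x$, table variables $\mathit{tbv}$, table identifiers $\mathit{tid}$ and procedure names $A$. *Data types* are $\mathrm{Int},\mathrm{String},\mathrm{Loc},\mathrm{Id}$; a *multiset type* $\tau$ is a data type or $\{d\}$ for a data type $d$; a *schema* $\mathit{sk}$ is a finite product $\tau_1\times\dots\times\tau_n$. *Constants* are integers, strings, localities and table identifiers (of type $\mathrm{Int},\mathrm{String},\mathrm{Loc},\mathrm{Id}$); *values* are constants and finite multisets of constants; a *row* is a finite tuple of values. A value satisfies $\tau$ if it is a constant of type $\tau$, or a multiset of constants of type $d$ and $\tau=\{d\}$; a row satisfies a schema, $r\Vdash\mathit{sk}$, componentwise (same length). Let $\ell ::= l\mid u$. The other categories are: * expressions $e ::= c\mid x\mid u\mid e_1\cdot e_2\mid e_1\ \mathit{aop}\ e_2\mid\{e_1,\dots,e_m\}$ ($c$ a constant, $\cdot$ string concatenation, $\mathit{aop}\in\{+,-,*,/\}$); * predicates $\psi::=\mathit{true}\mid e_1\ \mathit{cop}\ e_2\mid e_1\in e_2\mid\lnot\psi\mid\psi_1\wedge\psi_2$ ($\mathit{cop}\in\{=,<,\le,>,\ge\}$);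 * tuples $t=(e_1,\dots,e_n)$ and templates $T=(W_1,\dots,W_n)$ with $n>0$, where $W::={!x}\mid{!u}$ and the variables of a template are distinct; * concrete tables $(I,R)$, where $I=(I.\mathit{tid},I.\mathit{sk})$ consists of a table identifier or $\bot$ (temporary table) and a schema, and $R$ is a finite multiset of rows; table terms $\mathit{TB}::=\mathit{tid}@\ell\mid\mathit{tbv}\mid(I,R)$; * actions $a::=\mathsf{insert}(\mathit{tid}@\ell,t)\mid\mathsf{delete}(\mathit{tid}@\ell,T,\psi)\mid\mathsf{select}(\widetilde{\mathit{TB}},T,\psi,t,!\mathit{tbv})\mid\mathsf{update}(\mathit{tid}@\ell,T,\psi,t)\mid\mathsf{aggr}(\mathit{tid}@\ell,T,\psi,f,T')\mid\mathsf{create}(\mathit{tid}@\ell,\mathit{sk})\mid\mathsf{drop}(\mathit{tid}@\ell)\mid\mathsf{eval}(P)@\ell$, where $\widetilde{\mathit{TB}}$ is a finite list of table terms and $f:\{\mathit{sk}_1\}\to\mathit{sk}_2$ is an aggregator function that maps finite multisets of rows satisfying $\mathit{sk}_1$ to rows satisfying $\mathit{sk}_2$; * processes $P::=\mathsf{nil}\mid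 a.P\mid A(e_1,\dots,e_m)\mid\mathsf{foreach}(\mathit{TB},T,\psi,\preceq):P\mid P_1;P_2$ with $\preceq$ a partial order on rows; * components $C::=P\mid(I,R)\mid C_1|C_2$, and nets $N::=\mathsf{nil}\mid\mathit{ERR}\mid N_1\|N_2\mid(\nu l)N\mid l::C$. Each procedure name has at most one definition $A(p_1,\dots,p_m)\triangleq P$, with distinct formal parameters of the form $x:\tau$ or $u:\mathrm{Loc}$. In $\mathsf{delete},\mathsf{select},\mathsf{update},\mathsf{aggr}$ the template $T$ binds its variables in $\psi$ (and in $t$); in $\mathsf{foreach}$ it binds them in $\psi$ and $P$; in $\mathsf{select}(\dots).P$ the variable $\mathit{tbv}$, and in $\mathsf{aggr}(\dots,T').P$ the variables of $T'$, are bound in $P$; $(\nu l)$ binds $l$. $\mathrm{bv}(N)$ is the set of all variables bound in $N$; $N$ is *closed* if it has no free variable. **Evaluation.** $\mathcal E[\![e]\!]$, $\mathcal E[\![t]\!]$ are values and rows or $\mathit{err}$, and $\mathcal E[\![\psi]\!]$ is $\mathit{tt}$, $\mathit{ff}$ or $\mathit{err}$. Evaluation is structural and gives $\mathit{err}$ on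 free variables, on operands that are not of the required type (strings for concatenation, integers for arithmetic, two constants of one type for a comparison, a constant and a multiset of constants of its type for $\in$), and on multiset expressions whose elements do not evaluate to constants of one type. Division by zero is $0$; integers are ordered numerically, strings alphabetically, and no order relation holds between localities or between identifiers. The match $r/T$ of a row with a template of the same length is the substitution which maps each $u$ of a field $!u$ to the corresponding component, a locality, and each $x$ of a field $!x$ to the corresponding component, a constant that is not a locality or a multiset of constants of one type; in all other cases $r/T=\mathit{err}$. $T\Vdash\tau_1\times\dots\times\tau_n$ means that $T$ has $n$ fields, where $W_i$ is of the form $!u$ if $\tau_i=\mathrm{Loc}$ and of the form $!x$ otherwise. Put $\mathcal E_r[\![\psi]\!]=\mathcal E[\![\psi(r/T)]\!]$ and $\mathcal E_r[\![t]\!]=\mathcal E[\![t(r/T)]\!]$, which are $\mathit{err}$ if $r/T$ is. **Projection and products.** For $\mathit{sk}=\tau_1\times\dots\times\tau_k$, $T=(W_1,\dots,W_k)$ and $t=(e_1,\dots,e_n)$ with $n\le k$, the projection $\mathit{sk}\!\downarrow^T_t$ is $\tau'_1\times\dots\times\tau'_n$, where $\tau'_j=\tau_i$ if $e_j$ is the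 variable of $W_i$, and $\tau'_j$ is the type of $e_j$ if $e_j$ is a constant or a non-empty multiset of constants of one type; it is undefined in all other cases (in particular if some $e_j$ is the empty multiset, whose type is not unique). For a list $L=[l_i::(I_i,R_i)]_{i\le k}$ of located tables, $\otimes_{\mathrm{sk}}(\widetilde{\mathit{TB}},L)$ and $\otimes_{\mathrm R}(\widetilde{\mathit{TB}},L)$ are the flattened products of the schemas and of the data sets of the concrete tables that the members of $\widetilde{\mathit{TB}}$ denote, where $(I,R)$ denotes itself and $\mathit{tid}@l$ denotes the first table of $L$ located at $l$ whose identifier is $\mathit{tid}$; they are undefined if some member denotes no table. **Structural congruence.** $\equiv$ is the least congruence on nets (for $\|$ and $\nu$) such that $\|$ is commutative and associative with unit $\mathsf{nil}$, $(\nu l_1)(\nu l_2)N\equiv(\nu l_2)(\nu l_1)N$, $N_1\|(\nu l)N_2\equiv(\nu l)(N_1\|N_2)$ if $l$ is not free in $N_1$, $l::(C_1|C_2)\equiv l::C_1\,\|\,l::C_2$, $l::(P|\mathsf{nil})\equiv l::P$, and nets that differ only in the names of bound variables and $\nu$-bound localities are congruent. **Transitions.** $N_{\mathrm{env}}\vdash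 N\to N'$ is defined inductively by the following rules; $\vdash N\to N'$ stands for $\mathsf{nil}\vdash N\to N'$. Here $N_{\mathrm{env}}$ is arbitrary where it is not mentioned, and in rules 1, 2, 4, 5 we assume $I.\mathit{tid}=\mathit{tid}$. Data sets are multisets and comprehensions keep multiplicities. 1. $l_1::\mathsf{insert}(\mathit{tid}@l_2,t).P\,\|\,l_2::(I,R)\to\mathit{ERR}$ if not $\mathcal E[\![t]\!]\Vdash I.\mathit{sk}$ (in particular if $\mathcal E[\![t]\!]=\mathit{err}$), and otherwise $\to l_1::P\,\|\,l_2::(I,R\uplus\{\mathcal E[\![t]\!]\})$. 2. $l_1::\mathsf{delete}(\mathit{tid}@l_2,T,\psi).P\,\|\,l_2::(I,R)\to\mathit{ERR}$ if $T\not\Vdash I.\mathit{sk}$ or $\mathcal E_r[\![\psi]\!]=\mathit{err}$ for some $r\in R$; otherwise $\to l_1::P\,\|\,l_2::(I,\{r\in R\mid\mathcal E_r[\![\psi]\!]\ne\mathit{tt}\})$. 3. Let $N''=l_1::(I_1,R_1)\|\dots\|l_k::(I_k,R_k)$, let $L$ be the list of these located tables, and suppose that for every $\mathit{tid}@l$ in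 $\widetilde{\mathit{TB}}$ there is $j$ with $I_j.\mathit{tid}=\mathit{tid}$ and $l_j=l$, and that $\mathit{sk}=\otimes_{\mathrm{sk}}(\widetilde{\mathit{TB}},L)$ and $R=\otimes_{\mathrm R}(\widetilde{\mathit{TB}},L)$ are defined. Then $l_0::\mathsf{select}(\widetilde{\mathit{TB}},T,\psi,t,!\mathit{tbv}).P\,\|\,N''\to\mathit{ERR}$ if $T\not\Vdash\mathit{sk}$, or $\mathcal E_r[\![\psi]\!]=\mathit{err}$ or $\mathcal E_r[\![t]\!]=\mathit{err}$ for some $r\in R$; otherwise, if $\mathit{sk}\!\downarrow^T_t$ is defined, $\to l_0::P[(I',R')/\mathit{tbv}]\,\|\,N''$ with $I'=(\bot,\mathit{sk}\!\downarrow^T_t)$ and $R'=\{\mathcal E_r[\![t]\!]\mid r\in R,\ \mathcal E_r[\![\psi]\!]=\mathit{tt}\}$. 4. $l_1::\mathsf{update}(\mathit{tid}@l_2,T,\psi,t).P\,\|\,l_2::(I,R)\to\mathit{ERR}$ if $T\not\Vdash I.\mathit{sk}$ or, for some $r\in R$, $\mathcal E_r[\![\psi]\!]=\mathit{err}$, or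 $\mathcal E_r[\![t]\!]=\mathit{err}$, or $\mathcal E_r[\![\psi]\!]=\mathit{tt}$ and $\mathcal E_r[\![t]\!]\not\Vdash I.\mathit{sk}$; otherwise $\to l_1::P\,\|\,l_2::(I,\{r\in R\mid\mathcal E_r[\![\psi]\!]\neq\mathit{tt}\}\uplus\{\mathcal E_r[\![t]\!]\mid r\in R,\mathcal E_r[\![\psi]\!]=\mathit{tt}\})$. 5. $l_1::\mathsf{aggr}(\mathit{tid}@l_2,T,\psi,f,T').P\,\|\,l_2::(I,R)\to\mathit{ERR}$, with $f:\{\mathit{sk}_1\}\to\mathit{sk}_2$, if $T\not\Vdash I.\mathit{sk}$ or, for some $r\in R$, $\mathcal E_r[\![\psi]\!]=\mathit{err}$ or $r\not\Vdash\mathit{sk}_1$ or $T'\not\Vdash\mathit{sk}_2$; otherwise, if $\sigma=f(\{r\in R\mid\mathcal E_r[\![\psi]\!]=\mathit{tt}\})/T'$ is not $\mathit{err}$, $\to l_1::P\sigma\,\|\,l_2::(I,R)$. 6. $l_1::\mathsf{create}(\mathit{tid}@l_2,\mathit{sk}).P\,\|\,l_2::\mathsf{nil}\to l_1::P\,\|\,l_2::((\mathit{tid},\mathit{sk}),\emptyset)$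 if $N_{\mathrm{env}}$ has no table with identifier $\mathit{tid}$ at $l_2$, and $\to l_1::P\,\|\,l_2::\mathsf{nil}$ if it has one. 7. $l_1::\mathsf{drop}(\mathit{tid}@l_2).P\,\|\,l_2::(I,R)\to l_1::P\,\|\,l_2::\mathsf{nil}$ if $I.\mathit{tid}=\mathit{tid}$. 8. $l_1::\mathsf{eval}(Q)@l_2.P\,\|\,l_2::\mathsf{nil}\to l_1::P\,\|\,l_2::Q$ if $Q$ has no free variable. 9. For $F_R=\mathsf{foreach}((I,R),T,\psi,\preceq):P$: $l::F_R\to l::(P\sigma;F_{R\setminus\{r\}})$ if $r$ is $\preceq$-minimal in $R$, $\sigma=r/T\ne\mathit{err}$ and $\mathcal E[\![\psi\sigma]\!]=\mathit{tt}$ (one occurrence of $r$ is removed). If $\mathcal E_r[\![\psi]\!]\ne\mathit{tt}$ for all $r\in R$, then $l::F_R\to\mathit{ERR}$ if $\mathcal E_r[\![\psi]\!]=\mathit{err}$ for some $r\in R$, and $l::F_R\to l::\mathsf{nil}$ otherwise. 10. If $N_{\mathrm{env}}\vdash l::P_1\|N\to l::P_1'\|N'$, then $N_{\mathrm{env}}\vdash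 l::(P_1;P_2)\|N\to l::Q\|N'$, where $Q=P_2$ if $P_1'=\mathsf{nil}$ and $Q=P_1';P_2$ otherwise. 11. $l::A(e_1,\dots,e_m)\to l::P\sigma$ if $A(p_1,\dots,p_m)\triangleq P$, no $\mathcal E[\![e_i]\!]$ is $\mathit{err}$, the value for each parameter $u:\mathrm{Loc}$ is a locality, and $\sigma$ replaces the parameters by the values $\mathcal E[\![e_i]\!]$. 12. If $N_2\vdash N_1\to N_1'$, then $\mathsf{nil}\vdash N_1\|N_2\to N_1'\|N_2$. If $N_{\mathrm{env}}\vdash N\to N'$, then $N_{\mathrm{env}}\vdash(\nu l)N\to(\nu l)N'$. If $N_1\equiv N_2$, $N_{\mathrm{env}}\vdash N_2\to N_3$ and $N_3\equiv N_4$, then $N_{\mathrm{env}}\vdash N_1\to N_4$. **Typing.** An environment $\Gamma$ is a finite sequence of bindings $x:\tau$, $u:\mathrm{Loc}$, $\mathit{tbv}:\mathit{sk}$ with domain $\mathrm{dom}(\Gamma)$, where later bindings override earlier ones; $\nabla$ is a partial function from table identifiers to schemas. * Expressions: constants have their types; $x:\tau$ if $\Gamma(x)=\tau\neq\mathrm{Loc}$;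 $u:\mathrm{Loc}$ if $u\in\mathrm{dom}(\Gamma)$; concatenation takes and gives strings, arithmetic takes and gives integers; $\{e_1,\dots,e_m\}:\{d\}$ if all $e_i:d$. Tuples and rows are typed componentwise. Predicates are well typed if comparisons are between expressions of one data type $d$ and memberships between types $d$ and $\{d\}$. * A template $T$ with $T\Vdash\mathit{sk}$ yields the environment $\Gamma_{T,\mathit{sk}}$ that assigns the components of $\mathit{sk}$ to its variables. * Table terms: $\mathit{tid}@\ell:\nabla(\mathit{tid})$ if $\ell:\mathrm{Loc}$; $\mathit{tbv}:\Gamma(\mathit{tbv})$; $(I,R):I.\mathit{sk}$ if all rows of $R$ have type $I.\mathit{sk}$ and $I.\mathit{tid}=\bot$ or $\nabla(I.\mathit{tid})=I.\mathit{sk}$. * Actions yield an environment for the continuation. In all of them $\ell:\mathrm{Loc}$ is required, and required values of $\nabla$ have to be defined. $\mathsf{insert}$: $t:\nabla(\mathit{tid})$. $\mathsf{delete}$, $\mathsf{update}$: with $\mathit{sk}=\nabla(\mathit{tid})$, $T\Vdash\mathit{sk}$ and $\psi$ is well typed (and $t:\mathit{sk}$) under $\Gamma,\Gamma_{T,\mathit{sk}}$.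 $\mathsf{select}$: the same with $\mathit{sk}$ the flattened product of the types of $\widetilde{\mathit{TB}}$, and $t:\mathit{sk}'$ for some $\mathit{sk}'$; it yields $\mathit{tbv}:\mathit{sk}'$. $\mathsf{aggr}$ with $f:\{\mathit{sk}_1\}\to\mathit{sk}_2$: $\nabla(\mathit{tid})=\mathit{sk}_1$, $T\Vdash\mathit{sk}_1$, $\psi$ is well typed under $\Gamma,\Gamma_{T,\mathit{sk}_1}$ and $T'\Vdash\mathit{sk}_2$; it yields $\Gamma_{T',\mathit{sk}_2}$. $\mathsf{create}$: $\nabla(\mathit{tid})=\mathit{sk}$. $\mathsf{drop}$: no further condition. $\mathsf{eval}(P)@\ell$: $P$ is well typed under $\Gamma$. Actions other than $\mathsf{select}$ and $\mathsf{aggr}$ yield the empty environment. * Processes: $\mathsf{nil}$ is well typed; $a.P$ is if $a$ is, yielding $\Gamma'$, and $P$ is under $\Gamma,\Gamma'$; $P_1;P_2$ is if both are; $\mathsf{foreach}(\mathit{TB},T,\psi,\preceq):P$ is if $\mathit{TB}:\mathit{sk}$, $T\Vdash\mathit{sk}$, and $\psi$ and $P$ are under $\Gamma,\Gamma_{T,\mathit{sk}}$;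 $A(e_1,\dots,e_m)$ with $A(p_1,\dots,p_m)\triangleq P$ is if each $e_i$ has the type of $p_i$ and $P$ is well typed under the environment $p_1,\dots,p_m$. * Nets: $l::C$ is well typed if all processes in $C$ are well typed and all tables $(I,R)$ in $C$ have rows of type $I.\mathit{sk}$ and satisfy $\nabla(I.\mathit{tid})=I.\mathit{sk}$ (with $I.\mathit{tid}\ne\bot$); $\mathsf{nil}$ is; $(\nu l)N$ is if $N$ is; $N_1\|N_2$ is if both are; $\mathit{ERR}$ is not. We write $\Gamma,\nabla\vdash N$ if $N$ is well typed. As procedures may be recursive, the typing rules can be read inductively (derivations are finite) or such that derivations may be infinite through procedure calls: there is a set $H$ of defined procedures such that, when calls to members of $H$ are typed without a premise for the body, the body of every member of $H$ is well typed under the environment of its parameters, and $N$ is well typed. **Theorem (Subject Reduction).** For any procedure definitions, any $\nabla$, any $\Gamma$ and any nets $N,N'$: if $N$ is closed, $\mathrm{bv}(N)\cap\mathrm{dom}(\Gamma)=\emptyset$, $\Gamma,\nabla\vdash N$ and $\vdash N\to N'$, then $\Gamma,\nabla\vdash N'$. This holds under either reading of the typing rules. -/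

import Mathlib

namespace KlaimDB

noncomputable section

open scoped Classical

/-! # Names, types and values -/

/-- The sets of names over which the language is built: localities, locality variables, data
variables, table variables, table identifiers and procedure names. -/
structure Sig where
  Loc : Type
  LVar : Type
  DVar : Type
  TVar : Type
  TId : Type
  PName : Type

/-- The names that can be bound in a net: the three kinds of variables, and localities. -/
inductive Name (S : Sig) where
  | data (x : S.DVar)
  | locv (u : S.LVar)
  | tabv (b : S.TVar)
  | site (l : S.Loc)

/-- The name is a variable (and not a locality). -/
def Name.IsVar {S : Sig} : Name S → Prop
  | .site _ => False
  | _ => True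

/-- Data types `Int`, `String`, `Loc`, `Id`. -/
inductive DTy where
  | int
  | str
  | loc
  | id

/-- Multiset types: a data type, or the type of multisets over a data type. -/
inductive MTy where
  | data (d : DTy)
  | mset (d : DTy)

/-- Product types `τ₁ × ... × τₙ`, which serve as schemas. -/
abbrev Schema := List MTy

/-- Atomic constants: integers, strings, table identifiers and localities. -/
inductive Lit (S : Sig) where
  | num (n : ℤ)
  | str (s : String)
  | tid (i : S.TId)
  | loc (l : S.Loc)

/-- The data type of an atomic constant. -/
def Lit.sort {S : Sig} : Lit S → DTy
  | .num _ => .int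
  | .str _ => .str
  | .tid _ => .id
  | .loc _ => .loc

/-- Values: atomic constants and multisets of them. -/
inductive Val (S : Sig) where
  | lit (c : Lit S)
  | mset (s : Multiset (Lit S))

/-- Well-sortedness of values. -/
def Val.HasSort {S : Sig} : Val S → MTy → Prop
  | .lit c, .data d => c.sort = d
  | .mset s, .mset d => ∀ c ∈ s, c.sort = d
  | _, _ => False

/-- Evaluated tuples, the rows of tables. -/
abbrev Row (S : Sig) := List (Val S)

/-- Well-sortedness of evaluated tuples. -/
def Row.HasSchema {S : Sig} (r : Row S) (sk : Schema) : Prop :=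
  List.Forall₂ Val.HasSort r sk

/-- Aggregator functions `f : {τ₁} → τ₂`; each comes with its signature. The values outside of the
domain (on multisets with rows that are not of type `dom`) are never used. -/
structure Aggr (S : Sig) where
  dom : Schema
  cod : Schema
  fn : Multiset (Row S) → Row S
  maps : ∀ R : Multiset (Row S), (∀ r ∈ R, Row.HasSchema r dom) → Row.HasSchema (fn R) cod

/-! # Syntax -/

/-- Arithmetic operators. -/
inductive Aop where
  | add
  | sub
  | mul
  | div

/-- Comparison operators. -/
inductive Cop where
  | eq
  | lt
  | le
  | gt
  | ge

/-- Expressions. -/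
inductive Expr (S : Sig) where
  | lit (c : Lit S)
  | dvar (x : S.DVar)
  | lvar (u : S.LVar)
  | cat (e₁ e₂ : Expr S)
  | arith (op : Aop) (e₁ e₂ : Expr S)
  | mset (es : List (Expr S))

/-- Predicates. -/
inductive Pred (S : Sig) where
  | tru
  | cmp (op : Cop) (e₁ e₂ : Expr S)
  | mem (e₁ e₂ : Expr S)
  | neg (ψ : Pred S)
  | conj (ψ₁ ψ₂ : Pred S)

/-- Tuples `e₁,...,eₙ` with `n > 0`. -/
structure Tuple (S : Sig) where
  comps : List (Expr S)
  ne : comps ≠ []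

/-- Formal fields `!x` and `!u`. -/
inductive Field (S : Sig) where
  | data (x : S.DVar)
  | loc (u : S.LVar)

/-- The variable bound by a field. -/
def Field.name {S : Sig} : Field S → Name S
  | .data x => .data x
  | .loc u => .locv u

/-- Templates `W₁,...,Wₙ` with `n > 0`; they are linear. -/
structure Template (S : Sig) where
  fields : List (Field S)
  ne : fields ≠ []
  linear : fields.Nodup

/-- The variables bound by a template. -/
def Template.names {S : Sig} (T : Template S) : Set (Name S) :=
  {n | ∃ w ∈ T.fields, w.name = n}

/-- Localities or locality variables. -/
inductive LRef (S : Sig) where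
  | const (l : S.Loc)
  | var (u : S.LVar)

/-- Interfaces; the identifier `none` is the identifier `⊥` of temporary tables. -/
structure Interface (S : Sig) where
  tid : Option S.TId
  sk : Schema

/-- Concrete tables `(I, R)`. -/
structure Table (S : Sig) where
  I : Interface S
  R : Multiset (Row S)

/-- Tables `tid@ℓ`, `tbv` and `(I, R)`. -/
inductive TB (S : Sig) where
  | ref (i : S.TId) (l : LRef S)
  | var (b : S.TVar)
  | conc (tb : Table S)

mutual

/-- Actions. -/
inductive Act (S : Sig) where
  | ins (i : S.TId) (t : Tuple S) (l : LRef S)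
  | del (i : S.TId) (T : Template S) (ψ : Pred S) (l : LRef S)
  | sel (tbs : List (TB S)) (T : Template S) (ψ : Pred S) (t : Tuple S) (b : S.TVar)
  | upd (i : S.TId) (T : Template S) (ψ : Pred S) (t : Tuple S) (l : LRef S)
  | aggr (i : S.TId) (T : Template S) (ψ : Pred S) (f : Aggr S) (T' : Template S) (l : LRef S)
  | create (i : S.TId) (l : LRef S) (sk : Schema)
  | drop (i : S.TId) (l : LRef S)
  | spawn (P : Proc S) (l : LRef S)

/-- Processes. -/
inductive Proc (S : Sig) where
  | nil
  | pref (a : Act S) (P : Proc S)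
  | call (A : S.PName) (es : List (Expr S))
  | foreach (tb : TB S) (T : Template S) (ψ : Pred S) (o : PartialOrder (Row S)) (P : Proc S)
  | seq (P₁ P₂ : Proc S)

end

/-- Components. -/
inductive Comp (S : Sig) where
  | proc (P : Proc S)
  | table (tb : Table S)
  | par (C₁ C₂ : Comp S)

/-- Nets. -/
inductive Net (S : Sig) where
  | nil
  | err
  | par (N₁ N₂ : Net S)
  | res (l : S.Loc) (N : Net S)
  | node (l : S.Loc) (C : Comp S)

/-- Formal parameters `x : τ` and `u : Loc` of procedures. -/
inductive Param (S : Sig) where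
  | data (x : S.DVar) (τ : MTy)
  | loc (u : S.LVar)

/-- The variable of a formal parameter. -/
def Param.name {S : Sig} : Param S → Name S
  | .data x _ => .data x
  | .loc u => .locv u

/-- The type of a formal parameter. -/
def Param.ty {S : Sig} : Param S → MTy
  | .data _ τ => τ
  | .loc _ => .data .loc

/-- A procedure definition: formal parameters, which are distinct, and a body. -/
structure ProcDef (S : Sig) where
  params : List (Param S)
  distinct : (params.map Param.name).Nodup
  body : Proc S

/-- The procedure definitions of a system. -/
abbrev Defns (S : Sig) := S.PName → Option (ProcDef S)

/-! # Free and bound names -/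

def Lit.fn {S : Sig} : Lit S → Set (Name S)
  | .loc l => {.site l}
  | _ => ∅

def Val.fn {S : Sig} : Val S → Set (Name S)
  | .lit c => c.fn
  | .mset s => {n | ∃ c ∈ s, n ∈ c.fn}

def Row.fn {S : Sig} (r : Row S) : Set (Name S) :=
  {n | ∃ v ∈ r, n ∈ Val.fn v}

mutual

def Expr.fn {S : Sig} : Expr S → Set (Name S)
  | .lit c => c.fn
  | .dvar x => {.data x}
  | .lvar u => {.locv u}
  | .cat e₁ e₂ => e₁.fn ∪ e₂.fn
  | .arith _ e₁ e₂ => e₁.fn ∪ e₂.fn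
  | .mset es => Expr.fnList es

def Expr.fnList {S : Sig} : List (Expr S) → Set (Name S)
  | [] => ∅
  | e :: es => e.fn ∪ Expr.fnList es

end

def Pred.fn {S : Sig} : Pred S → Set (Name S)
  | .tru => ∅
  | .cmp _ e₁ e₂ => e₁.fn ∪ e₂.fn
  | .mem e₁ e₂ => e₁.fn ∪ e₂.fn
  | .neg ψ => ψ.fn
  | .conj ψ₁ ψ₂ => ψ₁.fn ∪ ψ₂.fn

def Tuple.fn {S : Sig} (t : Tuple S) : Set (Name S) := Expr.fnList t.comps

def LRef.fn {S : Sig} : LRef S → Set (Name S)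
  | .const l => {.site l}
  | .var u => {.locv u}

def Table.fn {S : Sig} (tb : Table S) : Set (Name S) :=
  {n | ∃ r ∈ tb.R, n ∈ Row.fn r}

def TB.fn {S : Sig} : TB S → Set (Name S)
  | .ref _ l => l.fn
  | .var b => {.tabv b}
  | .conc tb => tb.fn

/-- The variables that an action binds in its continuation. -/
def Act.binds {S : Sig} : Act S → Set (Name S)
  | .sel _ _ _ _ b => {.tabv b}
  | .aggr _ _ _ _ T' _ => T'.names
  | _ => ∅

mutual

/-- The free names (variables and localities) of an action. -/
def Act.fn {S : Sig} : Act S → Set (Name S)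
  | .ins _ t l => t.fn ∪ l.fn
  | .del _ T ψ l => (ψ.fn \ T.names) ∪ l.fn
  | .sel tbs T ψ t _ => {n | ∃ tb ∈ tbs, n ∈ TB.fn tb} ∪ ((ψ.fn ∪ t.fn) \ T.names)
  | .upd _ T ψ t l => ((ψ.fn ∪ t.fn) \ T.names) ∪ l.fn
  | .aggr _ T ψ _ _ l => (ψ.fn \ T.names) ∪ l.fn
  | .create _ l _ => l.fn
  | .drop _ l => l.fn
  | .spawn P l => P.fn ∪ l.fn

/-- The free names of a process. -/
def Proc.fn {S : Sig} : Proc S → Set (Name S)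
  | .nil => ∅
  | .pref a P => a.fn ∪ (P.fn \ a.binds)
  | .call _ es => Expr.fnList es
  | .foreach tb T ψ _ P => tb.fn ∪ ((ψ.fn ∪ P.fn) \ T.names)
  | .seq P₁ P₂ => P₁.fn ∪ P₂.fn

end

mutual

/-- The bound variables of an action. -/
def Act.bv {S : Sig} : Act S → Set (Name S)
  | .ins _ _ _ => ∅
  | .del _ T _ _ => T.names
  | .sel _ T _ _ b => T.names ∪ {.tabv b}
  | .upd _ T _ _ _ => T.names
  | .aggr _ T _ _ T' _ => T.names ∪ T'.names
  | .create _ _ _ => ∅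
  | .drop _ _ => ∅
  | .spawn P _ => P.bv

/-- The bound variables of a process. -/
def Proc.bv {S : Sig} : Proc S → Set (Name S)
  | .nil => ∅
  | .pref a P => a.bv ∪ P.bv
  | .call _ _ => ∅
  | .foreach _ T _ _ P => T.names ∪ P.bv
  | .seq P₁ P₂ => P₁.bv ∪ P₂.bv

end

def Comp.fn {S : Sig} : Comp S → Set (Name S)
  | .proc P => P.fn
  | .table tb => tb.fn
  | .par C₁ C₂ => C₁.fn ∪ C₂.fn

def Comp.bv {S : Sig} : Comp S → Set (Name S)
  | .proc P => P.bv
  | .table _ => ∅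
  | .par C₁ C₂ => C₁.bv ∪ C₂.bv

/-- The free names of a net. -/
def Net.fn {S : Sig} : Net S → Set (Name S)
  | .nil => ∅
  | .err => ∅
  | .par N₁ N₂ => N₁.fn ∪ N₂.fn
  | .res l N => N.fn \ {.site l}
  | .node l C => {.site l} ∪ C.fn

/-- The bound variables of a net. -/
def Net.bv {S : Sig} : Net S → Set (Name S)
  | .nil => ∅
  | .err => ∅
  | .par N₁ N₂ => N₁.bv ∪ N₂.bv
  | .res _ N => N.bv
  | .node _ C => C.bv

/-- A net is closed if it has no free variables. -/
def Net.Closed {S : Sig} (N : Net S) : Prop := ∀ n ∈ N.fn, ¬ n.IsVar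

/-- A process without free variables. -/
def Proc.Closed {S : Sig} (P : Proc S) : Prop := ∀ n ∈ P.fn, ¬ n.IsVar

/-! # Substitution

Only constants (values, localities, concrete tables) are substituted for variables, so no capture
can occur; a substitution does not enter the scope of a binder for the same variable. -/

/-- A value as an expression. -/
def Val.toExpr {S : Sig} : Val S → Expr S
  | .lit c => .lit c
  | .mset s => .mset (s.toList.map Expr.lit)

/-- A single substitution `[v/x]`, `[l/u]` or `[(I,R)/tbv]`. -/
inductive Assign (S : Sig) where
  | data (x : S.DVar) (v : Val S)
  | loc (u : S.LVar) (l : S.Loc)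
  | tab (b : S.TVar) (tb : Table S)

def Assign.name {S : Sig} : Assign S → Name S
  | .data x _ => .data x
  | .loc u _ => .locv u
  | .tab b _ => .tabv b

mutual

def Expr.subst {S : Sig} (s : Assign S) : Expr S → Expr S
  | .lit c => .lit c
  | .dvar x =>
    match s with
    | .data y v => if y = x then v.toExpr else .dvar x
    | _ => .dvar x
  | .lvar u =>
    match s with
    | .loc u' l => if u' = u then .lit (.loc l) else .lvar u
    | _ => .lvar u
  | .cat e₁ e₂ => .cat (e₁.subst s) (e₂.subst s)
  | .arith op e₁ e₂ => .arith op (e₁.subst s) (e₂.subst s)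
  | .mset es => .mset (Expr.substList s es)

def Expr.substList {S : Sig} (s : Assign S) : List (Expr S) → List (Expr S)
  | [] => []
  | e :: es => e.subst s :: Expr.substList s es

end

theorem Expr.substList_ne {S : Sig} (s : Assign S) {es : List (Expr S)} (h : es ≠ []) :
    Expr.substList s es ≠ [] := by
  cases es with
  | nil => exact absurd rfl h
  | cons e es => simp [Expr.substList]

def Pred.subst {S : Sig} (s : Assign S) : Pred S → Pred S
  | .tru => .tru
  | .cmp op e₁ e₂ => .cmp op (e₁.subst s) (e₂.subst s)
  | .mem e₁ e₂ => .mem (e₁.subst s) (e₂.subst s)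
  | .neg ψ => .neg (ψ.subst s)
  | .conj ψ₁ ψ₂ => .conj (ψ₁.subst s) (ψ₂.subst s)

def Tuple.subst {S : Sig} (s : Assign S) (t : Tuple S) : Tuple S :=
  ⟨Expr.substList s t.comps, Expr.substList_ne s t.ne⟩

def LRef.subst {S : Sig} (s : Assign S) : LRef S → LRef S
  | .const l => .const l
  | .var u =>
    match s with
    | .loc u' l => if u' = u then .const l else .var u
    | _ => .var u

def TB.subst {S : Sig} (s : Assign S) : TB S → TB S
  | .ref i l => .ref i (l.subst s)
  | .var b =>
    match s with
    | .tab b' tb => if b' = b then .conc tb else .var b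
    | _ => .var b
  | .conc tb => .conc tb

mutual

def Act.subst {S : Sig} (s : Assign S) : Act S → Act S
  | .ins i t l => .ins i (t.subst s) (l.subst s)
  | .del i T ψ l => .del i T (if s.name ∈ T.names then ψ else ψ.subst s) (l.subst s)
  | .sel tbs T ψ t b =>
    .sel (tbs.map (TB.subst s)) T (if s.name ∈ T.names then ψ else ψ.subst s)
      (if s.name ∈ T.names then t else t.subst s) b
  | .upd i T ψ t l =>
    .upd i T (if s.name ∈ T.names then ψ else ψ.subst s)
      (if s.name ∈ T.names then t else t.subst s) (l.subst s)
  | .aggr i T ψ f T' l =>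
    .aggr i T (if s.name ∈ T.names then ψ else ψ.subst s) f T' (l.subst s)
  | .create i l sk => .create i (l.subst s) sk
  | .drop i l => .drop i (l.subst s)
  | .spawn P l => .spawn (P.subst s) (l.subst s)

def Proc.subst {S : Sig} (s : Assign S) : Proc S → Proc S
  | .nil => .nil
  | .pref a P => .pref (a.subst s) (if s.name ∈ a.binds then P else P.subst s)
  | .call A es => .call A (Expr.substList s es)
  | .foreach tb T ψ o P =>
    .foreach (tb.subst s) T (if s.name ∈ T.names then ψ else ψ.subst s) o
      (if s.name ∈ T.names then P else P.subst s)
  | .seq P₁ P₂ => .seq (P₁.subst s) (P₂.subst s)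

end

/-- Composite substitutions `σ₁...σₘ`, applied from left to right. -/
abbrev Subst (S : Sig) := List (Assign S)

def Pred.substs {S : Sig} (σ : Subst S) (ψ : Pred S) : Pred S :=
  σ.foldl (fun ψ s => ψ.subst s) ψ

def Tuple.substs {S : Sig} (σ : Subst S) (t : Tuple S) : Tuple S :=
  σ.foldl (fun t s => t.subst s) t

def Proc.substs {S : Sig} (σ : Subst S) (P : Proc S) : Proc S :=
  σ.foldl (fun P s => P.subst s) P

/-! # Evaluation

The result `none` is the evaluation error `err`. -/

/-- Arithmetic on integers; division by zero gives zero. -/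
def Aop.eval : Aop → ℤ → ℤ → ℤ
  | .add, m, n => m + n
  | .sub, m, n => m - n
  | .mul, m, n => m * n
  | .div, m, n => m / n

/-- Comparison of two constants of the same type: equality, the numerical ordering of integers, the
alphabetical ordering of strings. No ordering holds between localities or table identifiers. -/
def Cop.eval {S : Sig} : Cop → Lit S → Lit S → Bool
  | .eq, c₁, c₂ => decide (c₁ = c₂)
  | .lt, .num m, .num n => decide (m < n)
  | .le, .num m, .num n => decide (m ≤ n)
  | .gt, .num m, .num n => decide (n < m)
  | .ge, .num m, .num n => decide (n ≤ m)
  | .lt, .str s, .str t => decide (s < t)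
  | .le, .str s, .str t => decide (s ≤ t)
  | .gt, .str s, .str t => decide (t < s)
  | .ge, .str s, .str t => decide (t ≤ s)
  | _, _, _ => false

mutual

def Expr.eval {S : Sig} : Expr S → Option (Val S)
  | .lit c => some (.lit c)
  | .dvar _ => none
  | .lvar _ => none
  | .cat e₁ e₂ =>
    match e₁.eval, e₂.eval with
    | some (.lit (.str s)), some (.lit (.str t)) => some (.lit (.str (s ++ t)))
    | _, _ => none
  | .arith op e₁ e₂ =>
    match e₁.eval, e₂.eval with
    | some (.lit (.num m)), some (.lit (.num n)) => some (.lit (.num (op.eval m n)))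
    | _, _ => none
  | .mset es =>
    match Expr.evalLits es with
    | some cs => if ∃ d : DTy, ∀ c ∈ cs, c.sort = d then some (.mset (cs : Multiset (Lit S))) else none
    | none => none

/-- Evaluation of a list of expressions all of which have to evaluate to atomic constants. -/
def Expr.evalLits {S : Sig} : List (Expr S) → Option (List (Lit S))
  | [] => some []
  | e :: es =>
    match e.eval, Expr.evalLits es with
    | some (.lit c), some cs => some (c :: cs)
    | _, _ => none

end

def Pred.eval {S : Sig} : Pred S → Option Bool
  | .tru => some true
  | .cmp op e₁ e₂ =>
    match e₁.eval, e₂.eval with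
    | some (.lit c₁), some (.lit c₂) => if c₁.sort = c₂.sort then some (op.eval c₁ c₂) else none
    | _, _ => none
  | .mem e₁ e₂ =>
    match e₁.eval, e₂.eval with
    | some (.lit c), some (.mset s) =>
      if ∀ c' ∈ s, c'.sort = c.sort then some (decide (c ∈ s)) else none
    | _, _ => none
  | .neg ψ => ψ.eval.map not
  | .conj ψ₁ ψ₂ =>
    match ψ₁.eval, ψ₂.eval with
    | some b₁, some b₂ => some (b₁ && b₂)
    | _, _ => none

/-- Evaluation of a list of expressions, component by component. -/
def evalAll {S : Sig} : List (Expr S) → Option (Row S)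
  | [] => some []
  | e :: es =>
    match e.eval, evalAll es with
    | some v, some r => some (v :: r)
    | _, _ => none

def Tuple.eval {S : Sig} (t : Tuple S) : Option (Row S) := evalAll t.comps

/-! # Pattern matching and well-sortedness of templates -/

/-- Matching of a value against a field; `none` is `err`. -/
def Field.bind {S : Sig} : Field S → Val S → Option (Assign S)
  | .data _, .lit (.loc _) => none
  | .data x, .lit c => some (.data x (.lit c))
  | .data x, .mset s => if ∃ d : DTy, ∀ c ∈ s, c.sort = d then some (.data x (.mset s)) else none
  | .loc u, .lit (.loc l) => some (.loc u l)
  | .loc _, _ => none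

def bindFields {S : Sig} : List (Field S) → Row S → Option (Subst S)
  | [], [] => some []
  | w :: ws, v :: r =>
    match w.bind v, bindFields ws r with
    | some s, some σ => some (s :: σ)
    | _, _ => none
  | _, _ => none

/-- Pattern matching `r / T`. -/
def Template.bind {S : Sig} (T : Template S) (r : Row S) : Option (Subst S) :=
  bindFields T.fields r

/-- The result of evaluating `ψ(r / T)`; it is `none` if the matching or the evaluation fails. -/
def Pred.evalAt {S : Sig} (ψ : Pred S) (T : Template S) (r : Row S) : Option Bool :=
  (T.bind r).bind fun σ => (ψ.substs σ).eval

/-- The result of evaluating `t(r / T)`; it is `none` if the matching or the evaluation fails. -/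
def Tuple.evalAt {S : Sig} (t : Tuple S) (T : Template S) (r : Row S) : Option (Row S) :=
  (T.bind r).bind fun σ => (t.substs σ).eval

/-- Well-sortedness of fields. -/
def Field.HasSort {S : Sig} : Field S → MTy → Prop
  | .data _, τ => τ ≠ .data .loc
  | .loc _, τ => τ = .data .loc

/-- Well-sortedness of templates. -/
def Template.HasSchema {S : Sig} (T : Template S) (sk : Schema) : Prop :=
  List.Forall₂ Field.HasSort T.fields sk

/-! # Projection of schemas and product of tables -/

/-- The type of a constant expression, where it is unique: the empty multiset has every type
`{τ}`, so that no type is assigned to it. -/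
def Expr.constTy {S : Sig} : Expr S → Option MTy
  | .lit c => some (.data c.sort)
  | .mset (.lit c :: es) =>
    if ∀ e ∈ es, ∃ c' : Lit S, e = .lit c' ∧ c'.sort = c.sort then some (.mset c.sort) else none
  | _ => none

/-- The component type to which a template assigns the given variable. -/
def fieldTy {S : Sig} (n : Name S) : List (Field S) → Schema → Option MTy
  | w :: ws, τ :: sk => if w.name = n then some τ else fieldTy n ws sk
  | _, _ => none

def projComp {S : Sig} (sk : Schema) (T : Template S) : Expr S → Option MTy
  | .dvar x => fieldTy (.data x) T.fields sk
  | .lvar u => fieldTy (.locv u) T.fields sk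
  | e => e.constTy

def projComps {S : Sig} (sk : Schema) (T : Template S) : List (Expr S) → Option Schema
  | [] => some []
  | e :: es =>
    match projComp sk T e, projComps sk T es with
    | some τ, some sk' => some (τ :: sk')
    | _, _ => none

/-- The projection of a schema according to a template and a tuple (`none` if undefined). -/
def projSk {S : Sig} (sk : Schema) (T : Template S) (t : Tuple S) : Option Schema :=
  if sk.length = T.fields.length ∧ t.comps.length ≤ T.fields.length then projComps sk T t.comps
  else none

/-- The concrete table denoted by `tb`, where references are looked up in a list of located tables
(`none` if there is none). -/
def TB.resolve {S : Sig} (ls : List (S.Loc × Table S)) : TB S → Option (Table S)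
  | .ref i (.const l) =>
    (ls.find? fun p => decide (p.1 = l ∧ p.2.I.tid = some i)).map Prod.snd
  | .ref _ (.var _) => none
  | .var _ => none
  | .conc tb => some tb

def resolveAll {S : Sig} (ls : List (S.Loc × Table S)) : List (TB S) → Option (List (Table S))
  | [] => some []
  | tb :: tbs =>
    match tb.resolve ls, resolveAll ls tbs with
    | some t, some ts => some (t :: ts)
    | _, _ => none

/-- The product of the schemas, flattened. -/
def prodSk {S : Sig} (tbs : List (TB S)) (ls : List (S.Loc × Table S)) : Option Schema :=
  (resolveAll ls tbs).map fun ts => (ts.map fun t => t.I.sk).flatten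

/-- The flattened Cartesian product of data sets. -/
def prodRows {S : Sig} : List (Multiset (Row S)) → Multiset (Row S)
  | [] => {[]}
  | R :: Rs => R.bind fun r => (prodRows Rs).map fun r' => r ++ r'

/-- The product of the data sets, flattened. -/
def prodR {S : Sig} (tbs : List (TB S)) (ls : List (S.Loc × Table S)) :
    Option (Multiset (Row S)) :=
  (resolveAll ls tbs).map fun ts => prodRows (ts.map fun t => t.R)

/-! # Alpha-equivalence and structural congruence -/

/-- Permutations of the names of every kind. -/
structure Ren (S : Sig) where
  data : Equiv.Perm S.DVar
  locv : Equiv.Perm S.LVar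
  tabv : Equiv.Perm S.TVar
  site : Equiv.Perm S.Loc

def Ren.app {S : Sig} (π : Ren S) : Name S → Name S
  | .data x => .data (π.data x)
  | .locv u => .locv (π.locv u)
  | .tabv b => .tabv (π.tabv b)
  | .site l => .site (π.site l)

/-- The permutation leaves all names of the set unchanged. -/
def Ren.Fixes {S : Sig} (π : Ren S) (A : Set (Name S)) : Prop := ∀ n ∈ A, π.app n = n

def Lit.ren {S : Sig} (π : Ren S) : Lit S → Lit S
  | .loc l => .loc (π.site l)
  | c => c

def Val.ren {S : Sig} (π : Ren S) : Val S → Val S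
  | .lit c => .lit (c.ren π)
  | .mset s => .mset (s.map (Lit.ren π))

def Row.ren {S : Sig} (π : Ren S) (r : Row S) : Row S := r.map (Val.ren π)

mutual

def Expr.ren {S : Sig} (π : Ren S) : Expr S → Expr S
  | .lit c => .lit (c.ren π)
  | .dvar x => .dvar (π.data x)
  | .lvar u => .lvar (π.locv u)
  | .cat e₁ e₂ => .cat (e₁.ren π) (e₂.ren π)
  | .arith op e₁ e₂ => .arith op (e₁.ren π) (e₂.ren π)
  | .mset es => .mset (Expr.renList π es)

def Expr.renList {S : Sig} (π : Ren S) : List (Expr S) → List (Expr S)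
  | [] => []
  | e :: es => e.ren π :: Expr.renList π es

end

theorem Expr.renList_ne {S : Sig} (π : Ren S) {es : List (Expr S)} (h : es ≠ []) :
    Expr.renList π es ≠ [] := by
  cases es with
  | nil => exact absurd rfl h
  | cons e es => simp [Expr.renList]

def Pred.ren {S : Sig} (π : Ren S) : Pred S → Pred S
  | .tru => .tru
  | .cmp op e₁ e₂ => .cmp op (e₁.ren π) (e₂.ren π)
  | .mem e₁ e₂ => .mem (e₁.ren π) (e₂.ren π)
  | .neg ψ => .neg (ψ.ren π)
  | .conj ψ₁ ψ₂ => .conj (ψ₁.ren π) (ψ₂.ren π)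

def Tuple.ren {S : Sig} (π : Ren S) (t : Tuple S) : Tuple S :=
  ⟨Expr.renList π t.comps, Expr.renList_ne π t.ne⟩

def Field.ren {S : Sig} (π : Ren S) : Field S → Field S
  | .data x => .data (π.data x)
  | .loc u => .loc (π.locv u)

theorem Field.ren_injective {S : Sig} (π : Ren S) : Function.Injective (Field.ren π) := by
  intro a b h
  cases a <;> cases b <;> simp_all [Field.ren]

def Template.ren {S : Sig} (π : Ren S) (T : Template S) : Template S :=
  ⟨T.fields.map (Field.ren π), by simpa using T.ne, T.linear.map (Field.ren_injective π)⟩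

def LRef.ren {S : Sig} (π : Ren S) : LRef S → LRef S
  | .const l => .const (π.site l)
  | .var u => .var (π.locv u)

def Table.ren {S : Sig} (π : Ren S) (tb : Table S) : Table S :=
  ⟨tb.I, tb.R.map (Row.ren π)⟩

def TB.ren {S : Sig} (π : Ren S) : TB S → TB S
  | .ref i l => .ref i (l.ren π)
  | .var b => .var (π.tabv b)
  | .conc tb => .conc (tb.ren π)

mutual

def Act.ren {S : Sig} (π : Ren S) : Act S → Act S
  | .ins i t l => .ins i (t.ren π) (l.ren π)
  | .del i T ψ l => .del i (T.ren π) (ψ.ren π) (l.ren π)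
  | .sel tbs T ψ t b => .sel (tbs.map (TB.ren π)) (T.ren π) (ψ.ren π) (t.ren π) (π.tabv b)
  | .upd i T ψ t l => .upd i (T.ren π) (ψ.ren π) (t.ren π) (l.ren π)
  | .aggr i T ψ f T' l => .aggr i (T.ren π) (ψ.ren π) f (T'.ren π) (l.ren π)
  | .create i l sk => .create i (l.ren π) sk
  | .drop i l => .drop i (l.ren π)
  | .spawn P l => .spawn (P.ren π) (l.ren π)

def Proc.ren {S : Sig} (π : Ren S) : Proc S → Proc S
  | .nil => .nil
  | .pref a P => .pref (a.ren π) (P.ren π)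
  | .call A es => .call A (Expr.renList π es)
  | .foreach tb T ψ o P => .foreach (tb.ren π) (T.ren π) (ψ.ren π) o (P.ren π)
  | .seq P₁ P₂ => .seq (P₁.ren π) (P₂.ren π)

end

def Comp.ren {S : Sig} (π : Ren S) : Comp S → Comp S
  | .proc P => .proc (P.ren π)
  | .table tb => .table (tb.ren π)
  | .par C₁ C₂ => .par (C₁.ren π) (C₂.ren π)

def Net.ren {S : Sig} (π : Ren S) : Net S → Net S
  | .nil => .nil
  | .err => .err
  | .par N₁ N₂ => .par (N₁.ren π) (N₂.ren π)
  | .res l N => .res (π.site l) (N.ren π)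
  | .node l C => .node (π.site l) (C.ren π)

mutual

/-- Alpha-equivalence of actions: for every binder, the bound names may be permuted together with
names that do not occur free in the scope; closed under the constructors. -/
inductive Act.Alpha {S : Sig} : Act S → Act S → Prop
  | refl (a : Act S) : Act.Alpha a a
  | symm {a a' : Act S} : Act.Alpha a a' → Act.Alpha a' a
  | trans {a a' a'' : Act S} : Act.Alpha a a' → Act.Alpha a' a'' → Act.Alpha a a''
  | del (π : Ren S) (i : S.TId) (T : Template S) (ψ : Pred S) (l : LRef S) :
      π.Fixes (ψ.fn \ T.names) → Act.Alpha (.del i T ψ l) (.del i (T.ren π) (ψ.ren π) l)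
  | sel (π : Ren S) (tbs : List (TB S)) (T : Template S) (ψ : Pred S) (t : Tuple S) (b : S.TVar) :
      π.Fixes ((ψ.fn ∪ t.fn) \ T.names) →
      Act.Alpha (.sel tbs T ψ t b) (.sel tbs (T.ren π) (ψ.ren π) (t.ren π) b)
  | upd (π : Ren S) (i : S.TId) (T : Template S) (ψ : Pred S) (t : Tuple S) (l : LRef S) :
      π.Fixes ((ψ.fn ∪ t.fn) \ T.names) →
      Act.Alpha (.upd i T ψ t l) (.upd i (T.ren π) (ψ.ren π) (t.ren π) l)
  | aggr (π : Ren S) (i : S.TId) (T : Template S) (ψ : Pred S) (f : Aggr S) (T' : Template S)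
      (l : LRef S) :
      π.Fixes (ψ.fn \ T.names) →
      Act.Alpha (.aggr i T ψ f T' l) (.aggr i (T.ren π) (ψ.ren π) f T' l)
  | spawn {P P' : Proc S} (l : LRef S) :
      Proc.Alpha P P' → Act.Alpha (.spawn P l) (.spawn P' l)

/-- Alpha-equivalence of processes. -/
inductive Proc.Alpha {S : Sig} : Proc S → Proc S → Prop
  | refl (P : Proc S) : Proc.Alpha P P
  | symm {P P' : Proc S} : Proc.Alpha P P' → Proc.Alpha P' P
  | trans {P P' P'' : Proc S} : Proc.Alpha P P' → Proc.Alpha P' P'' → Proc.Alpha P P''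
  | sel (π : Ren S) (tbs : List (TB S)) (T : Template S) (ψ : Pred S) (t : Tuple S) (b : S.TVar)
      (P : Proc S) :
      π.Fixes (P.fn \ {.tabv b}) →
      Proc.Alpha (.pref (.sel tbs T ψ t b) P) (.pref (.sel tbs T ψ t (π.tabv b)) (P.ren π))
  | aggr (π : Ren S) (i : S.TId) (T : Template S) (ψ : Pred S) (f : Aggr S) (T' : Template S)
      (l : LRef S) (P : Proc S) :
      π.Fixes (P.fn \ T'.names) →
      Proc.Alpha (.pref (.aggr i T ψ f T' l) P) (.pref (.aggr i T ψ f (T'.ren π) l) (P.ren π))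
  | foreach (π : Ren S) (tb : TB S) (T : Template S) (ψ : Pred S) (o : PartialOrder (Row S))
      (P : Proc S) :
      π.Fixes ((ψ.fn ∪ P.fn) \ T.names) →
      Proc.Alpha (.foreach tb T ψ o P) (.foreach tb (T.ren π) (ψ.ren π) o (P.ren π))
  | pref_congr {a a' : Act S} {P P' : Proc S} :
      Act.Alpha a a' → Proc.Alpha P P' → Proc.Alpha (.pref a P) (.pref a' P')
  | foreach_congr (tb : TB S) (T : Template S) (ψ : Pred S) (o : PartialOrder (Row S))
      {P P' : Proc S} :
      Proc.Alpha P P' → Proc.Alpha (.foreach tb T ψ o P) (.foreach tb T ψ o P')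
  | seq_congr {P₁ P₁' P₂ P₂' : Proc S} :
      Proc.Alpha P₁ P₁' → Proc.Alpha P₂ P₂' → Proc.Alpha (.seq P₁ P₂) (.seq P₁' P₂')

end

/-- Alpha-equivalence of components. -/
inductive Comp.Alpha {S : Sig} : Comp S → Comp S → Prop
  | proc {P P' : Proc S} : Proc.Alpha P P' → Comp.Alpha (.proc P) (.proc P')
  | table (tb : Table S) : Comp.Alpha (.table tb) (.table tb)
  | par {C₁ C₁' C₂ C₂' : Comp S} :
      Comp.Alpha C₁ C₁' → Comp.Alpha C₂ C₂' → Comp.Alpha (.par C₁ C₂) (.par C₁' C₂')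

/-- Alpha-equivalence of nets. -/
inductive Net.Alpha {S : Sig} : Net S → Net S → Prop
  | refl (N : Net S) : Net.Alpha N N
  | symm {N N' : Net S} : Net.Alpha N N' → Net.Alpha N' N
  | trans {N N' N'' : Net S} : Net.Alpha N N' → Net.Alpha N' N'' → Net.Alpha N N''
  | res (π : Ren S) (l : S.Loc) (N : Net S) :
      π.Fixes (N.fn \ {.site l}) → Net.Alpha (.res l N) (.res (π.site l) (N.ren π))
  | res_congr (l : S.Loc) {N N' : Net S} : Net.Alpha N N' → Net.Alpha (.res l N) (.res l N')
  | par_congr {N₁ N₁' N₂ N₂' : Net S} :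
      Net.Alpha N₁ N₁' → Net.Alpha N₂ N₂' → Net.Alpha (.par N₁ N₂) (.par N₁' N₂')
  | node_congr (l : S.Loc) {C C' : Comp S} : Comp.Alpha C C' → Net.Alpha (.node l C) (.node l C')

/-- Structural congruence. -/
inductive Net.Congr {S : Sig} : Net S → Net S → Prop
  | refl (N : Net S) : Net.Congr N N
  | symm {N N' : Net S} : Net.Congr N N' → Net.Congr N' N
  | trans {N N' N'' : Net S} : Net.Congr N N' → Net.Congr N' N'' → Net.Congr N N''
  | par_congr {N₁ N₁' N₂ N₂' : Net S} :
      Net.Congr N₁ N₁' → Net.Congr N₂ N₂' → Net.Congr (.par N₁ N₂) (.par N₁' N₂')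
  | res_congr (l : S.Loc) {N N' : Net S} : Net.Congr N N' → Net.Congr (.res l N) (.res l N')
  | par_comm (N₁ N₂ : Net S) : Net.Congr (.par N₁ N₂) (.par N₂ N₁)
  | par_assoc (N₁ N₂ N₃ : Net S) :
      Net.Congr (.par (.par N₁ N₂) N₃) (.par N₁ (.par N₂ N₃))
  | alpha {N N' : Net S} : Net.Alpha N N' → Net.Congr N N'
  | par_nil (N : Net S) : Net.Congr (.par N .nil) N
  | res_comm (l₁ l₂ : S.Loc) (N : Net S) :
      Net.Congr (.res l₁ (.res l₂ N)) (.res l₂ (.res l₁ N))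
  | extrude (l : S.Loc) (N₁ N₂ : Net S) :
      .site l ∉ N₁.fn → Net.Congr (.par N₁ (.res l N₂)) (.res l (.par N₁ N₂))
  | split (l : S.Loc) (C₁ C₂ : Comp S) :
      Net.Congr (.node l (.par C₁ C₂)) (.par (.node l C₁) (.node l C₂))
  | proc_nil (l : S.Loc) (P : Proc S) :
      Net.Congr (.node l (.par (.proc P) (.proc .nil))) (.node l (.proc P))

/-! # Operational semantics -/

/-- The multiset of pairs of localities and table identifiers of a component located at `l`. -/
def Comp.lid {S : Sig} (l : S.Loc) : Comp S → Multiset (S.Loc × Option S.TId)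
  | .proc _ => 0
  | .table tb => {(l, tb.I.tid)}
  | .par C₁ C₂ => C₁.lid l + C₂.lid l

/-- The multiset of pairs of localities and table identifiers of a net. -/
def Net.lid {S : Sig} : Net S → Multiset (S.Loc × Option S.TId)
  | .nil => 0
  | .err => 0
  | .par N₁ N₂ => N₁.lid + N₂.lid
  | .res _ N => N.lid
  | .node l C => C.lid l

/-- The net `N || l₁::(I₁,R₁) || ... || lₖ::(Iₖ,Rₖ)`. -/
def Net.withTables {S : Sig} (N : Net S) (ls : List (S.Loc × Table S)) : Net S :=
  ls.foldl (fun N p => .par N (.node p.1 (.table p.2))) N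

/-- The substitution of an argument for a formal parameter. -/
def Param.bind {S : Sig} : Param S → Val S → Option (Assign S)
  | .data x _, v => some (.data x v)
  | .loc u, .lit (.loc l) => some (.loc u l)
  | .loc _, _ => none

def bindParams {S : Sig} : List (Param S) → Row S → Option (Subst S)
  | [], [] => some []
  | p :: ps, v :: r =>
    match p.bind v, bindParams ps r with
    | some s, some σ => some (s :: σ)
    | _, _ => none
  | _, _ => none

/-- `Step Δ Nenv N N'`: with the procedure definitions `Δ` and in the environment `Nenv`, the net
`N` makes a transition into `N'`. -/
inductive Step {S : Sig} (Δ : Defns S) : Net S → Net S → Net S → Prop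
  | ins_err (Nenv : Net S) (l₁ l₂ : S.Loc) (i : S.TId) (t : Tuple S) (P : Proc S) (tb : Table S) :
      tb.I.tid = some i →
      (¬ ∃ r, t.eval = some r ∧ Row.HasSchema r tb.I.sk) →
      Step Δ Nenv
        (.par (.node l₁ (.proc (.pref (.ins i t (.const l₂)) P))) (.node l₂ (.table tb)))
        .err
  | ins (Nenv : Net S) (l₁ l₂ : S.Loc) (i : S.TId) (t : Tuple S) (P : Proc S) (tb : Table S)
      (r : Row S) :
      tb.I.tid = some i →
      t.eval = some r → Row.HasSchema r tb.I.sk →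
      Step Δ Nenv
        (.par (.node l₁ (.proc (.pref (.ins i t (.const l₂)) P))) (.node l₂ (.table tb)))
        (.par (.node l₁ (.proc P)) (.node l₂ (.table ⟨tb.I, tb.R + {r}⟩)))
  | del_err (Nenv : Net S) (l₁ l₂ : S.Loc) (i : S.TId) (T : Template S) (ψ : Pred S) (P : Proc S)
      (tb : Table S) :
      tb.I.tid = some i →
      (¬ T.HasSchema tb.I.sk ∨ ∃ r ∈ tb.R, ψ.evalAt T r = none) →
      Step Δ Nenv
        (.par (.node l₁ (.proc (.pref (.del i T ψ (.const l₂)) P))) (.node l₂ (.table tb)))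
        .err
  | del (Nenv : Net S) (l₁ l₂ : S.Loc) (i : S.TId) (T : Template S) (ψ : Pred S) (P : Proc S)
      (tb : Table S) :
      tb.I.tid = some i →
      ¬ (¬ T.HasSchema tb.I.sk ∨ ∃ r ∈ tb.R, ψ.evalAt T r = none) →
      Step Δ Nenv
        (.par (.node l₁ (.proc (.pref (.del i T ψ (.const l₂)) P))) (.node l₂ (.table tb)))
        (.par (.node l₁ (.proc P))
          (.node l₂ (.table ⟨tb.I, tb.R.filter fun r => ψ.evalAt T r ≠ some true⟩)))
  | sel_err (Nenv : Net S) (l₀ : S.Loc) (tbs : List (TB S)) (T : Template S) (ψ : Pred S)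
      (t : Tuple S) (b : S.TVar) (P : Proc S) (ls : List (S.Loc × Table S)) (sk : Schema)
      (R : Multiset (Row S)) :
      (∀ i l, TB.ref i (.const l) ∈ tbs → ∃ p ∈ ls, p.2.I.tid = some i ∧ p.1 = l) →
      prodSk tbs ls = some sk → prodR tbs ls = some R →
      (¬ T.HasSchema sk ∨ ∃ r ∈ R, ψ.evalAt T r = none ∨ t.evalAt T r = none) →
      Step Δ Nenv
        ((Net.node l₀ (.proc (.pref (.sel tbs T ψ t b) P))).withTables ls)
        .err
  | sel (Nenv : Net S) (l₀ : S.Loc) (tbs : List (TB S)) (T : Template S) (ψ : Pred S)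
      (t : Tuple S) (b : S.TVar) (P : Proc S) (ls : List (S.Loc × Table S)) (sk sk' : Schema)
      (R : Multiset (Row S)) :
      (∀ i l, TB.ref i (.const l) ∈ tbs → ∃ p ∈ ls, p.2.I.tid = some i ∧ p.1 = l) →
      prodSk tbs ls = some sk → prodR tbs ls = some R →
      ¬ (¬ T.HasSchema sk ∨ ∃ r ∈ R, ψ.evalAt T r = none ∨ t.evalAt T r = none) →
      projSk sk T t = some sk' →
      Step Δ Nenv
        ((Net.node l₀ (.proc (.pref (.sel tbs T ψ t b) P))).withTables ls)
        ((Net.node l₀ (.proc (P.subst (.tab b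
          ⟨⟨none, sk'⟩,
            (R.filter fun r => ψ.evalAt T r = some true).filterMap (t.evalAt T)⟩)))).withTables ls)
  | upd_err (Nenv : Net S) (l₁ l₂ : S.Loc) (i : S.TId) (T : Template S) (ψ : Pred S)
      (t : Tuple S) (P : Proc S) (tb : Table S) :
      tb.I.tid = some i →
      (¬ T.HasSchema tb.I.sk ∨ ∃ r ∈ tb.R, ψ.evalAt T r = none ∨ t.evalAt T r = none ∨
        (ψ.evalAt T r = some true ∧ ∃ r', t.evalAt T r = some r' ∧ ¬ Row.HasSchema r' tb.I.sk)) →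
      Step Δ Nenv
        (.par (.node l₁ (.proc (.pref (.upd i T ψ t (.const l₂)) P))) (.node l₂ (.table tb)))
        .err
  | upd (Nenv : Net S) (l₁ l₂ : S.Loc) (i : S.TId) (T : Template S) (ψ : Pred S)
      (t : Tuple S) (P : Proc S) (tb : Table S) :
      tb.I.tid = some i →
      ¬ (¬ T.HasSchema tb.I.sk ∨ ∃ r ∈ tb.R, ψ.evalAt T r = none ∨ t.evalAt T r = none ∨
        (ψ.evalAt T r = some true ∧ ∃ r', t.evalAt T r = some r' ∧ ¬ Row.HasSchema r' tb.I.sk)) →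
      Step Δ Nenv
        (.par (.node l₁ (.proc (.pref (.upd i T ψ t (.const l₂)) P))) (.node l₂ (.table tb)))
        (.par (.node l₁ (.proc P))
          (.node l₂ (.table ⟨tb.I, (tb.R.filter fun r => ψ.evalAt T r ≠ some true) +
            (tb.R.filter fun r => ψ.evalAt T r = some true).filterMap (t.evalAt T)⟩)))
  | aggr_err (Nenv : Net S) (l₁ l₂ : S.Loc) (i : S.TId) (T : Template S) (ψ : Pred S) (f : Aggr S)
      (T' : Template S) (P : Proc S) (tb : Table S) :
      tb.I.tid = some i →
      (¬ T.HasSchema tb.I.sk ∨ ∃ r ∈ tb.R, ψ.evalAt T r = none ∨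
        ¬ Row.HasSchema r f.dom ∨ ¬ T'.HasSchema f.cod) →
      Step Δ Nenv
        (.par (.node l₁ (.proc (.pref (.aggr i T ψ f T' (.const l₂)) P))) (.node l₂ (.table tb)))
        .err
  | aggr (Nenv : Net S) (l₁ l₂ : S.Loc) (i : S.TId) (T : Template S) (ψ : Pred S) (f : Aggr S)
      (T' : Template S) (P : Proc S) (tb : Table S) (σ : Subst S) :
      tb.I.tid = some i →
      ¬ (¬ T.HasSchema tb.I.sk ∨ ∃ r ∈ tb.R, ψ.evalAt T r = none ∨
        ¬ Row.HasSchema r f.dom ∨ ¬ T'.HasSchema f.cod) →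
      T'.bind (f.fn (tb.R.filter fun r => ψ.evalAt T r = some true)) = some σ →
      Step Δ Nenv
        (.par (.node l₁ (.proc (.pref (.aggr i T ψ f T' (.const l₂)) P))) (.node l₂ (.table tb)))
        (.par (.node l₁ (.proc (P.substs σ))) (.node l₂ (.table tb)))
  | create (Nenv : Net S) (l₁ l₂ : S.Loc) (i : S.TId) (sk : Schema) (P : Proc S) :
      (l₂, some i) ∉ Nenv.lid →
      Step Δ Nenv
        (.par (.node l₁ (.proc (.pref (.create i (.const l₂) sk) P))) (.node l₂ (.proc .nil)))
        (.par (.node l₁ (.proc P)) (.node l₂ (.table ⟨⟨some i, sk⟩, 0⟩)))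
  | create_skip (Nenv : Net S) (l₁ l₂ : S.Loc) (i : S.TId) (sk : Schema) (P : Proc S) :
      (l₂, some i) ∈ Nenv.lid →
      Step Δ Nenv
        (.par (.node l₁ (.proc (.pref (.create i (.const l₂) sk) P))) (.node l₂ (.proc .nil)))
        (.par (.node l₁ (.proc P)) (.node l₂ (.proc .nil)))
  | drop (Nenv : Net S) (l₁ l₂ : S.Loc) (i : S.TId) (P : Proc S) (tb : Table S) :
      tb.I.tid = some i →
      Step Δ Nenv
        (.par (.node l₁ (.proc (.pref (.drop i (.const l₂)) P))) (.node l₂ (.table tb)))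
        (.par (.node l₁ (.proc P)) (.node l₂ (.proc .nil)))
  | spawn (Nenv : Net S) (l₁ l₂ : S.Loc) (P P' : Proc S) :
      P.Closed →
      Step Δ Nenv
        (.par (.node l₁ (.proc (.pref (.spawn P (.const l₂)) P'))) (.node l₂ (.proc .nil)))
        (.par (.node l₁ (.proc P')) (.node l₂ (.proc P)))
  | for_tt (Nenv : Net S) (l : S.Loc) (tb : Table S) (T : Template S) (ψ : Pred S)
      (o : PartialOrder (Row S)) (P : Proc S) (r₀ : Row S) (σ : Subst S) :
      r₀ ∈ tb.R → (∀ r ∈ tb.R, o.le r r₀ → r = r₀) →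
      T.bind r₀ = some σ → (ψ.substs σ).eval = some true →
      Step Δ Nenv
        (.node l (.proc (.foreach (.conc tb) T ψ o P)))
        (.node l (.proc (.seq (P.substs σ) (.foreach (.conc ⟨tb.I, tb.R - {r₀}⟩) T ψ o P))))
  | for_err (Nenv : Net S) (l : S.Loc) (tb : Table S) (T : Template S) (ψ : Pred S)
      (o : PartialOrder (Row S)) (P : Proc S) :
      (¬ ∃ r ∈ tb.R, ψ.evalAt T r = some true) →
      (∃ r ∈ tb.R, ψ.evalAt T r = none) →
      Step Δ Nenv (.node l (.proc (.foreach (.conc tb) T ψ o P))) .err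
  | for_ff (Nenv : Net S) (l : S.Loc) (tb : Table S) (T : Template S) (ψ : Pred S)
      (o : PartialOrder (Row S)) (P : Proc S) :
      (¬ ∃ r ∈ tb.R, ψ.evalAt T r = some true) →
      (¬ ∃ r ∈ tb.R, ψ.evalAt T r = none) →
      Step Δ Nenv (.node l (.proc (.foreach (.conc tb) T ψ o P))) (.node l (.proc .nil))
  | seq_tt {Nenv N N' : Net S} {l : S.Loc} {P₁ P₁' : Proc S} (P₂ : Proc S) :
      Step Δ Nenv (.par (.node l (.proc P₁)) N) (.par (.node l (.proc P₁')) N') →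
      P₁' ≠ .nil →
      Step Δ Nenv (.par (.node l (.proc (.seq P₁ P₂))) N) (.par (.node l (.proc (.seq P₁' P₂))) N')
  | seq_ff {Nenv N N' : Net S} {l : S.Loc} {P₁ : Proc S} (P₂ : Proc S) :
      Step Δ Nenv (.par (.node l (.proc P₁)) N) (.par (.node l (.proc .nil)) N') →
      Step Δ Nenv (.par (.node l (.proc (.seq P₁ P₂))) N) (.par (.node l (.proc P₂)) N')
  | call (Nenv : Net S) (l : S.Loc) (A : S.PName) (es : List (Expr S)) (D : ProcDef S) (r : Row S)
      (σ : Subst S) :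
      Δ A = some D → evalAll es = some r → bindParams D.params r = some σ →
      Step Δ Nenv (.node l (.proc (.call A es))) (.node l (.proc (D.body.substs σ)))
  | par {N₁ N₁' N₂ : Net S} :
      Step Δ N₂ N₁ N₁' → Step Δ .nil (.par N₁ N₂) (.par N₁' N₂)
  | res {Nenv N N' : Net S} (l : S.Loc) :
      Step Δ Nenv N N' → Step Δ Nenv (.res l N) (.res l N')
  | equiv {Nenv N₁ N₂ N₃ N₄ : Net S} :
      Net.Congr N₁ N₂ → Step Δ Nenv N₂ N₃ → Net.Congr N₃ N₄ → Step Δ Nenv N₁ N₄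

/-! # Type system -/

/-- Bindings of variables to types. The only type of a locality variable is `Loc`, and the type of
a table variable is a schema. -/
inductive Binding (S : Sig) where
  | data (x : S.DVar) (τ : MTy)
  | locv (u : S.LVar)
  | tabv (b : S.TVar) (sk : Schema)

def Binding.name {S : Sig} : Binding S → Name S
  | .data x _ => .data x
  | .locv u => .locv u
  | .tabv b _ => .tabv b

/-- Typing environments: finite sequences of bindings, the most recent binding first. Thus the
extension `Γ, Γ'` of `Γ` with `Γ'` is the list `Γ' ++ Γ`. -/
abbrev Env (S : Sig) := List (Binding S)

/-- The domain of a typing environment. -/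
def Env.dom {S : Sig} (Γ : Env S) : Set (Name S) := {n | ∃ b ∈ Γ, b.name = n}

/-- `Γ.Binds b`: the binding `b` is the (most recent) one in `Γ` for its variable. -/
def Env.Binds {S : Sig} (Γ : Env S) (b : Binding S) : Prop :=
  Γ.find? (fun b' => decide (b'.name = b.name)) = some b

/-- The partial function from table identifiers to schemas. -/
abbrev Schemas (S : Sig) := S.TId → Option Schema

/-- Typing of expressions. -/
inductive ExprTy {S : Sig} (Γ : Env S) : Expr S → MTy → Prop
  | dvar {x : S.DVar} {τ : MTy} :
      Γ.Binds (.data x τ) → τ ≠ .data .loc → ExprTy Γ (.dvar x) τ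
  | lvar {u : S.LVar} : Γ.Binds (.locv u) → ExprTy Γ (.lvar u) (.data .loc)
  | lit (c : Lit S) : ExprTy Γ (.lit c) (.data c.sort)
  | cat {e₁ e₂ : Expr S} :
      ExprTy Γ e₁ (.data .str) → ExprTy Γ e₂ (.data .str) → ExprTy Γ (.cat e₁ e₂) (.data .str)
  | arith (op : Aop) {e₁ e₂ : Expr S} :
      ExprTy Γ e₁ (.data .int) → ExprTy Γ e₂ (.data .int) →
      ExprTy Γ (.arith op e₁ e₂) (.data .int)
  | mset {es : List (Expr S)} {d : DTy} :
      (∀ e ∈ es, ExprTy Γ e (.data d)) → ExprTy Γ (.mset es) (.mset d)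

/-- Typing of predicates. -/
inductive PredTy {S : Sig} (Γ : Env S) : Pred S → Prop
  | tru : PredTy Γ .tru
  | cmp (op : Cop) {e₁ e₂ : Expr S} {d : DTy} :
      ExprTy Γ e₁ (.data d) → ExprTy Γ e₂ (.data d) → PredTy Γ (.cmp op e₁ e₂)
  | mem {e₁ e₂ : Expr S} {d : DTy} :
      ExprTy Γ e₁ (.data d) → ExprTy Γ e₂ (.mset d) → PredTy Γ (.mem e₁ e₂)
  | neg {ψ : Pred S} : PredTy Γ ψ → PredTy Γ (.neg ψ)
  | conj {ψ₁ ψ₂ : Pred S} : PredTy Γ ψ₁ → PredTy Γ ψ₂ → PredTy Γ (.conj ψ₁ ψ₂)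

/-- Typing of the list of components of a tuple. -/
def ExprsTy {S : Sig} (Γ : Env S) (es : List (Expr S)) (sk : Schema) : Prop :=
  List.Forall₂ (ExprTy Γ) es sk

/-- Typing of tuples. -/
def TupleTy {S : Sig} (Γ : Env S) (t : Tuple S) (sk : Schema) : Prop := ExprsTy Γ t.comps sk

/-- Typing of rows, as tuples of constant expressions. -/
def RowTy {S : Sig} (Γ : Env S) (r : Row S) (sk : Schema) : Prop :=
  ExprsTy Γ (r.map Val.toExpr) sk

/-- Typing of fields. -/
inductive FieldTy {S : Sig} : MTy → Field S → Binding S → Prop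
  | data (x : S.DVar) {τ : MTy} : τ ≠ .data .loc → FieldTy τ (.data x) (.data x τ)
  | loc (u : S.LVar) : FieldTy (.data .loc) (.loc u) (.locv u)

/-- Typing of lists of fields. As templates are linear, the order of the bindings does not
matter. -/
inductive FieldsTy {S : Sig} : Schema → List (Field S) → Env S → Prop
  | nil : FieldsTy [] [] []
  | cons {τ : MTy} {sk : Schema} {w : Field S} {ws : List (Field S)} {b : Binding S} {Γ : Env S} :
      FieldTy τ w b → FieldsTy sk ws Γ → FieldsTy (τ :: sk) (w :: ws) (b :: Γ)

/-- Typing of templates. -/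
def TemplateTy {S : Sig} (sk : Schema) (T : Template S) (Γ : Env S) : Prop :=
  FieldsTy sk T.fields Γ

/-- A locality reference as an expression. -/
def LRef.toExpr {S : Sig} : LRef S → Expr S
  | .const l => .lit (.loc l)
  | .var u => .lvar u

/-- Typing `Γ ⊢ ℓ : Loc`. -/
def LRefTy {S : Sig} (Γ : Env S) (l : LRef S) : Prop := ExprTy Γ l.toExpr (.data .loc)

/-- Typing of tables. -/
inductive TBTy {S : Sig} (Sch : Schemas S) (Γ : Env S) : TB S → Schema → Prop
  | ref {i : S.TId} {l : LRef S} {sk : Schema} :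
      LRefTy Γ l → Sch i = some sk → TBTy Sch Γ (.ref i l) sk
  | var {b : S.TVar} {sk : Schema} : Γ.Binds (.tabv b sk) → TBTy Sch Γ (.var b) sk
  | conc {tb : Table S} :
      (∀ r ∈ tb.R, RowTy Γ r tb.I.sk) → (∀ i, tb.I.tid = some i → Sch i = some tb.I.sk) →
      TBTy Sch Γ (.conc tb) tb.I.sk

/-- The binding given by a formal parameter. -/
def Param.binding {S : Sig} : Param S → Binding S
  | .data x τ => .data x τ
  | .loc u => .locv u

/-- The typing environment given by the formal parameters of a procedure. -/
def ProcDef.env {S : Sig} (D : ProcDef S) : Env S :=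
  D.params.map Param.binding

mutual

/-- Typing of actions, deriving the environment for the continuation. The parameter `H` is the set
of procedures whose bodies are assumed to be well typed already; see `ProcTy.call_rec`. -/
inductive ActTy {S : Sig} (Δ : Defns S) (Sch : Schemas S) (H : Set S.PName) :
    Env S → Act S → Env S → Prop
  | ins {Γ : Env S} {i : S.TId} {t : Tuple S} {l : LRef S} {sk : Schema} :
      Sch i = some sk → TupleTy Γ t sk → LRefTy Γ l → ActTy Δ Sch H Γ (.ins i t l) []
  | del {Γ Γ' : Env S} {i : S.TId} {T : Template S} {ψ : Pred S} {l : LRef S} {sk : Schema} :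
      Sch i = some sk → TemplateTy sk T Γ' → PredTy (Γ' ++ Γ) ψ → LRefTy Γ l →
      ActTy Δ Sch H Γ (.del i T ψ l) []
  | sel {Γ Γ' : Env S} {tbs : List (TB S)} {T : Template S} {ψ : Pred S} {t : Tuple S} {b : S.TVar}
      {sks : List Schema} {sk' : Schema} :
      List.Forall₂ (TBTy Sch Γ) tbs sks → TemplateTy sks.flatten T Γ' → PredTy (Γ' ++ Γ) ψ →
      TupleTy (Γ' ++ Γ) t sk' → ActTy Δ Sch H Γ (.sel tbs T ψ t b) [.tabv b sk']
  | upd {Γ Γ' : Env S} {i : S.TId} {T : Template S} {ψ : Pred S} {t : Tuple S} {l : LRef S}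
      {sk : Schema} :
      Sch i = some sk → TemplateTy sk T Γ' → PredTy (Γ' ++ Γ) ψ → TupleTy (Γ' ++ Γ) t sk →
      LRefTy Γ l → ActTy Δ Sch H Γ (.upd i T ψ t l) []
  | aggr {Γ Γ' Γ'' : Env S} {i : S.TId} {T : Template S} {ψ : Pred S} {f : Aggr S}
      {T' : Template S} {l : LRef S} :
      Sch i = some f.dom → TemplateTy f.dom T Γ' → PredTy (Γ' ++ Γ) ψ → TemplateTy f.cod T' Γ'' →
      LRefTy Γ l → ActTy Δ Sch H Γ (.aggr i T ψ f T' l) Γ''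
  | create {Γ : Env S} {i : S.TId} {l : LRef S} {sk : Schema} :
      Sch i = some sk → LRefTy Γ l → ActTy Δ Sch H Γ (.create i l sk) []
  | drop {Γ : Env S} {i : S.TId} {l : LRef S} : LRefTy Γ l → ActTy Δ Sch H Γ (.drop i l) []
  | spawn {Γ : Env S} {P : Proc S} {l : LRef S} :
      ProcTy Δ Sch H Γ P → LRefTy Γ l → ActTy Δ Sch H Γ (.spawn P l) []

/-- Typing of processes. The rule `call` is the typing rule for procedure calls. With `H = ∅`, this
is the system in which all derivations are finite. The rule `call_rec` omits the derivation for the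
body of a procedure from `H`; it serves to represent infinite derivations. -/
inductive ProcTy {S : Sig} (Δ : Defns S) (Sch : Schemas S) (H : Set S.PName) :
    Env S → Proc S → Prop
  | nil (Γ : Env S) : ProcTy Δ Sch H Γ .nil
  | pref {Γ Γ' : Env S} {a : Act S} {P : Proc S} :
      ActTy Δ Sch H Γ a Γ' → ProcTy Δ Sch H (Γ' ++ Γ) P → ProcTy Δ Sch H Γ (.pref a P)
  | seq {Γ : Env S} {P₁ P₂ : Proc S} :
      ProcTy Δ Sch H Γ P₁ → ProcTy Δ Sch H Γ P₂ → ProcTy Δ Sch H Γ (.seq P₁ P₂)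
  | call {Γ : Env S} {A : S.PName} {es : List (Expr S)} {D : ProcDef S} :
      Δ A = some D →
      List.Forall₂ (fun e p => ExprTy Γ e p.ty) es D.params →
      ProcTy Δ Sch H D.env D.body → ProcTy Δ Sch H Γ (.call A es)
  | call_rec {Γ : Env S} {A : S.PName} {es : List (Expr S)} {D : ProcDef S} :
      Δ A = some D →
      List.Forall₂ (fun e p => ExprTy Γ e p.ty) es D.params →
      A ∈ H → ProcTy Δ Sch H Γ (.call A es)
  | foreach {Γ Γ' : Env S} {tb : TB S} {T : Template S} {ψ : Pred S} {o : PartialOrder (Row S)}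
      {P : Proc S} {sk : Schema} :
      TBTy Sch Γ tb sk → TemplateTy sk T Γ' → PredTy (Γ' ++ Γ) ψ → ProcTy Δ Sch H (Γ' ++ Γ) P →
      ProcTy Δ Sch H Γ (.foreach tb T ψ o P)

end

/-- Typing of components. -/
inductive CompTy {S : Sig} (Δ : Defns S) (Sch : Schemas S) (H : Set S.PName) (Γ : Env S) :
    Comp S → Prop
  | proc {P : Proc S} : ProcTy Δ Sch H Γ P → CompTy Δ Sch H Γ (.proc P)
  | table {tb : Table S} {i : S.TId} :
      (∀ r ∈ tb.R, RowTy Γ r tb.I.sk) → tb.I.tid = some i → Sch i = some tb.I.sk →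
      CompTy Δ Sch H Γ (.table tb)
  | par {C₁ C₂ : Comp S} :
      CompTy Δ Sch H Γ C₁ → CompTy Δ Sch H Γ C₂ → CompTy Δ Sch H Γ (.par C₁ C₂)

/-- Typing of nets. There is no rule for the erroneous net. -/
inductive NetTy {S : Sig} (Δ : Defns S) (Sch : Schemas S) (H : Set S.PName) (Γ : Env S) :
    Net S → Prop
  | nil : NetTy Δ Sch H Γ .nil
  | node {l : S.Loc} {C : Comp S} :
      ExprTy Γ (.lit (.loc l)) (.data .loc) → CompTy Δ Sch H Γ C → NetTy Δ Sch H Γ (.node l C)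
  | res {l : S.Loc} {N : Net S} : NetTy Δ Sch H Γ N → NetTy Δ Sch H Γ (.res l N)
  | par {N₁ N₂ : Net S} :
      NetTy Δ Sch H Γ N₁ → NetTy Δ Sch H Γ N₂ → NetTy Δ Sch H Γ (.par N₁ N₂)

/-- The net is well typed, by a finite derivation. -/
def WellTyped {S : Sig} (Δ : Defns S) (Sch : Schemas S) (Γ : Env S) (N : Net S) : Prop :=
  NetTy Δ Sch ∅ Γ N

/-- The net is well typed by a derivation that may be infinite, as needed for recursive procedures:
there is a set of procedures whose bodies are all well typed relative to this set, and relative to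
which the net is well typed. -/
def WellTypedRec {S : Sig} (Δ : Defns S) (Sch : Schemas S) (Γ : Env S) (N : Net S) : Prop :=
  ∃ H : Set S.PName,
    (∀ A ∈ H, ∃ D, Δ A = some D ∧ ProcTy Δ Sch H D.env D.body) ∧ NetTy Δ Sch H Γ N

end

end KlaimDB

/-! # Subject reduction

For a closed net the typing environment is irrelevant: typing depends only on the bindings of the
free names (`netTy_congr`, a case of the equivariance `netTy_ren`), and conversely the free
variables of a well-typed net lie in the domain of the environment (`NetTy.fv`). Therefore a closed
net that is well typed in `Γ` is well typed in the empty environment, and a reduct that is well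
typed in the empty environment is closed and thus well typed in `Γ`. It remains to show that
transitions preserve typing in the empty environment (`Step.netTy`), where no term has a free
variable and hence the evaluation of well-typed terms succeeds. This is an induction on the
transition which uses three facts.

* Structural congruence preserves and reflects typing (`Net.Congr.netTy_iff`). The only rules that
  are not immediate are those for alpha-equivalence; they follow from equivariance of typing, where
  two environments need to correspond under the permutation only on the free names of the term
  (`Env.RenOn`). This is what the side conditions of alpha-equivalence guarantee.
* Substituting terms of the right type preserves typing (`procTy_subst`). The values that the match
  with a template, the parameters of a procedure, an aggregator or a selection provide are of the
  right type. For a selection, the schema of the new temporary table is the projection, and this is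
  the schema that the typing rule assigns to the table variable, as tuples for which the projection
  is defined have only one type (`projSk_eq`).
* Well-typed closed expressions, predicates and tuples evaluate to values of their types
  (`ExprTy.exists_eval`, `PredTy.exists_eval`), rows of the right schema match templates
  (`FieldsTy.exists_bind`), and products of tables have the product schema
  (`prodSk_eq`, `hasSchema_of_mem_prodR`). Hence no rule that leads to the erroneous net applies.

A set `H` of procedures whose bodies may be assumed to be well typed is a parameter throughout, so
that both readings of the typing rules are covered: in the inductive one `H` is empty. -/

namespace KlaimDB

open scoped Classical

variable {S : Sig}

/-! ### Lists of expressions -/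

/-- Induction on expressions, with the hypothesis for all elements of a multiset expression. -/
theorem Expr.induct {p : Expr S → Prop} (lit : ∀ c, p (.lit c)) (dvar : ∀ x, p (.dvar x))
    (lvar : ∀ u, p (.lvar u)) (cat : ∀ e₁ e₂, p e₁ → p e₂ → p (.cat e₁ e₂))
    (arith : ∀ op e₁ e₂, p e₁ → p e₂ → p (.arith op e₁ e₂))
    (mset : ∀ es : List (Expr S), (∀ e ∈ es, p e) → p (.mset es)) (e : Expr S) : p e :=
  Expr.rec (motive_1 := p) (motive_2 := fun es => ∀ e ∈ es, p e) lit dvar lvar cat arith mset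
    (by simp) (by simp +contextual) e

theorem Expr.mem_fnList {es : List (Expr S)} {n : Name S} :
    n ∈ Expr.fnList es ↔ ∃ e ∈ es, n ∈ e.fn := by
  induction es with
  | nil => simp [Expr.fnList]
  | cons e es ih => simp [Expr.fnList, ih]

theorem Expr.substList_eq_map (s : Assign S) (es : List (Expr S)) :
    Expr.substList s es = es.map (Expr.subst s) := by
  induction es with
  | nil => rfl
  | cons e es ih => simp [Expr.substList, ih]

theorem Expr.renList_eq_map (π : Ren S) (es : List (Expr S)) :
    Expr.renList π es = es.map (Expr.ren π) := by
  induction es with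
  | nil => rfl
  | cons e es ih => simp [Expr.renList, ih]

theorem forall₂_congr_map {α β γ : Type*} {R : α → γ → Prop} {R' : β → γ → Prop} {f : α → β}
    {l : List α} {l' : List γ} (h : ∀ a ∈ l, ∀ c, R a c ↔ R' (f a) c) :
    List.Forall₂ R l l' ↔ List.Forall₂ R' (l.map f) l' := by
  induction l generalizing l' with
  | nil => cases l' <;> simp
  | cons a l ih =>
    cases l' with
    | nil => simp
    | cons c l' =>
      simp only [List.map_cons, List.forall₂_cons]
      rw [h a (by simp), ih fun a ha => h a (by simp [ha])]

theorem exists_mem_right_of_forall₂ {α β : Type*} {R : α → β → Prop} {l : List α} {l' : List β}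
    (h : List.Forall₂ R l l') {a : α} (ha : a ∈ l) : ∃ b ∈ l', R a b := by
  induction h with
  | nil => simp at ha
  | cons h _ ih =>
    rcases List.mem_cons.1 ha with rfl | ha
    · exact ⟨_, by simp, h⟩
    · obtain ⟨b, hb, h⟩ := ih ha
      exact ⟨b, by simp [hb], h⟩

/-! ### Inversion of the typing rules -/

section Inversion

variable {Δ : Defns S} {Sch : Schemas S} {H : Set S.PName} {Γ Γ' : Env S}

theorem exprTy_dvar_iff {x : S.DVar} {τ : MTy} :
    ExprTy Γ (.dvar x) τ ↔ Γ.Binds (.data x τ) ∧ τ ≠ .data .loc :=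
  ⟨by rintro (⟨h₁, h₂⟩); exact ⟨h₁, h₂⟩, fun h => .dvar h.1 h.2⟩

theorem exprTy_lvar_iff {u : S.LVar} {τ : MTy} :
    ExprTy Γ (.lvar u) τ ↔ Γ.Binds (.locv u) ∧ τ = .data .loc :=
  ⟨by rintro (_ | h); exact ⟨h, rfl⟩, by rintro ⟨h, rfl⟩; exact .lvar h⟩

theorem exprTy_lit_iff {c : Lit S} {τ : MTy} : ExprTy Γ (.lit c) τ ↔ τ = .data c.sort :=
  ⟨by rintro ⟨⟩; rfl, by rintro rfl; exact .lit c⟩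

theorem exprTy_cat_iff {e₁ e₂ : Expr S} {τ : MTy} :
    ExprTy Γ (.cat e₁ e₂) τ ↔
      τ = .data .str ∧ ExprTy Γ e₁ (.data .str) ∧ ExprTy Γ e₂ (.data .str) :=
  ⟨by rintro (_ | _ | _ | ⟨h₁, h₂⟩); exact ⟨rfl, h₁, h₂⟩, by rintro ⟨rfl, h₁, h₂⟩; exact .cat h₁ h₂⟩

theorem exprTy_arith_iff {op : Aop} {e₁ e₂ : Expr S} {τ : MTy} :
    ExprTy Γ (.arith op e₁ e₂) τ ↔
      τ = .data .int ∧ ExprTy Γ e₁ (.data .int) ∧ ExprTy Γ e₂ (.data .int) :=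
  ⟨by intro h; cases h with | arith _ h₁ h₂ => exact ⟨rfl, h₁, h₂⟩,
    by rintro ⟨rfl, h₁, h₂⟩; exact .arith op h₁ h₂⟩

theorem exprTy_mset_iff {es : List (Expr S)} {τ : MTy} :
    ExprTy Γ (.mset es) τ ↔ ∃ d, τ = .mset d ∧ ∀ e ∈ es, ExprTy Γ e (.data d) :=
  ⟨by intro h; cases h with | mset h => exact ⟨_, rfl, h⟩,
    by rintro ⟨d, rfl, h⟩; exact .mset h⟩

theorem predTy_cmp_iff {op : Cop} {e₁ e₂ : Expr S} :
    PredTy Γ (.cmp op e₁ e₂) ↔ ∃ d, ExprTy Γ e₁ (.data d) ∧ ExprTy Γ e₂ (.data d) :=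
  ⟨by intro h; cases h with | cmp _ h₁ h₂ => exact ⟨_, h₁, h₂⟩,
    by rintro ⟨d, h₁, h₂⟩; exact .cmp op h₁ h₂⟩

theorem predTy_mem_iff {e₁ e₂ : Expr S} :
    PredTy Γ (.mem e₁ e₂) ↔ ∃ d, ExprTy Γ e₁ (.data d) ∧ ExprTy Γ e₂ (.mset d) :=
  ⟨by intro h; cases h with | mem h₁ h₂ => exact ⟨_, h₁, h₂⟩,
    by rintro ⟨d, h₁, h₂⟩; exact .mem h₁ h₂⟩

theorem predTy_neg_iff {ψ : Pred S} : PredTy Γ (.neg ψ) ↔ PredTy Γ ψ :=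
  ⟨by rintro ⟨⟩; assumption, .neg⟩

theorem predTy_conj_iff {ψ₁ ψ₂ : Pred S} :
    PredTy Γ (.conj ψ₁ ψ₂) ↔ PredTy Γ ψ₁ ∧ PredTy Γ ψ₂ :=
  ⟨by intro h; cases h with | conj h₁ h₂ => exact ⟨h₁, h₂⟩, fun h => .conj h.1 h.2⟩

theorem lrefTy_const (l : S.Loc) : LRefTy Γ (.const l) := .lit _

theorem lrefTy_var_iff {u : S.LVar} : LRefTy Γ (.var u) ↔ Γ.Binds (.locv u) := by
  simp [LRefTy, LRef.toExpr, exprTy_lvar_iff]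

/-- The typing rules assign to a value the types that it satisfies; the empty multiset has several. -/
theorem exprTy_toExpr_iff {v : Val S} {τ : MTy} : ExprTy Γ v.toExpr τ ↔ v.HasSort τ := by
  rcases v with c | s
  · rcases τ with d | d <;> simp [Val.toExpr, exprTy_lit_iff, Val.HasSort, eq_comm]
  · rcases τ with d | d
    · simp [Val.toExpr, exprTy_mset_iff, Val.HasSort]
    · simp only [Val.toExpr, exprTy_mset_iff, Val.HasSort, MTy.mset.injEq, exists_eq_left',
        List.forall_mem_map, Multiset.mem_toList, exprTy_lit_iff, MTy.data.injEq, eq_comm]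

theorem rowTy_iff {r : Row S} {sk : Schema} : RowTy Γ r sk ↔ Row.HasSchema r sk := by
  simp only [RowTy, ExprsTy, Row.HasSchema, List.forall₂_map_left_iff, exprTy_toExpr_iff]

theorem tbTy_ref_iff {i : S.TId} {l : LRef S} {sk : Schema} :
    TBTy Sch Γ (.ref i l) sk ↔ LRefTy Γ l ∧ Sch i = some sk :=
  ⟨by intro h; cases h with | ref h₁ h₂ => exact ⟨h₁, h₂⟩, fun h => .ref h.1 h.2⟩

theorem tbTy_var_iff {b : S.TVar} {sk : Schema} :
    TBTy Sch Γ (.var b) sk ↔ Γ.Binds (.tabv b sk) :=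
  ⟨by intro h; cases h with | var h => exact h, .var⟩

theorem tbTy_conc_iff {tb : Table S} {sk : Schema} :
    TBTy Sch Γ (.conc tb) sk ↔ tb.I.sk = sk ∧ (∀ r ∈ tb.R, Row.HasSchema r sk) ∧
      ∀ i, tb.I.tid = some i → Sch i = some sk := by
  constructor
  · intro h
    cases h with
    | conc h₁ h₂ => exact ⟨rfl, by simpa only [rowTy_iff] using h₁, h₂⟩
  · rintro ⟨rfl, h₁, h₂⟩
    exact .conc (by simpa only [rowTy_iff] using h₁) h₂

theorem actTy_ins_iff {i : S.TId} {t : Tuple S} {l : LRef S} :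
    ActTy Δ Sch H Γ (.ins i t l) Γ' ↔
      Γ' = [] ∧ LRefTy Γ l ∧ ∃ sk, Sch i = some sk ∧ TupleTy Γ t sk :=
  ⟨by intro h; cases h with | ins h₁ h₂ h₃ => exact ⟨rfl, h₃, _, h₁, h₂⟩,
    by rintro ⟨rfl, h₃, _, h₁, h₂⟩; exact .ins h₁ h₂ h₃⟩

theorem actTy_del_iff {i : S.TId} {T : Template S} {ψ : Pred S} {l : LRef S} :
    ActTy Δ Sch H Γ (.del i T ψ l) Γ' ↔
      Γ' = [] ∧ LRefTy Γ l ∧ ∃ sk, Sch i = some sk ∧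
        ∃ Γ₁, TemplateTy sk T Γ₁ ∧ PredTy (Γ₁ ++ Γ) ψ :=
  ⟨by intro h; cases h with | del h₁ h₂ h₃ h₄ => exact ⟨rfl, h₄, _, h₁, _, h₂, h₃⟩,
    by rintro ⟨rfl, h₄, _, h₁, _, h₂, h₃⟩; exact .del h₁ h₂ h₃ h₄⟩

theorem actTy_sel_iff {tbs : List (TB S)} {T : Template S} {ψ : Pred S} {t : Tuple S}
    {b : S.TVar} :
    ActTy Δ Sch H Γ (.sel tbs T ψ t b) Γ' ↔
      ∃ sk', Γ' = [.tabv b sk'] ∧ ∃ sks, List.Forall₂ (TBTy Sch Γ) tbs sks ∧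
        ∃ Γ₁, TemplateTy sks.flatten T Γ₁ ∧ PredTy (Γ₁ ++ Γ) ψ ∧ TupleTy (Γ₁ ++ Γ) t sk' :=
  ⟨by intro h; cases h with | sel h₁ h₂ h₃ h₄ => exact ⟨_, rfl, _, h₁, _, h₂, h₃, h₄⟩,
    by rintro ⟨_, rfl, _, h₁, _, h₂, h₃, h₄⟩; exact .sel h₁ h₂ h₃ h₄⟩

theorem actTy_upd_iff {i : S.TId} {T : Template S} {ψ : Pred S} {t : Tuple S} {l : LRef S} :
    ActTy Δ Sch H Γ (.upd i T ψ t l) Γ' ↔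
      Γ' = [] ∧ LRefTy Γ l ∧ ∃ sk, Sch i = some sk ∧
        ∃ Γ₁, TemplateTy sk T Γ₁ ∧ PredTy (Γ₁ ++ Γ) ψ ∧ TupleTy (Γ₁ ++ Γ) t sk :=
  ⟨by intro h; cases h with | upd h₁ h₂ h₃ h₄ h₅ => exact ⟨rfl, h₅, _, h₁, _, h₂, h₃, h₄⟩,
    by rintro ⟨rfl, h₅, _, h₁, _, h₂, h₃, h₄⟩; exact .upd h₁ h₂ h₃ h₄ h₅⟩

theorem actTy_aggr_iff {i : S.TId} {T : Template S} {ψ : Pred S} {f : Aggr S} {T' : Template S}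
    {l : LRef S} :
    ActTy Δ Sch H Γ (.aggr i T ψ f T' l) Γ' ↔
      TemplateTy f.cod T' Γ' ∧ LRefTy Γ l ∧ Sch i = some f.dom ∧
        ∃ Γ₁, TemplateTy f.dom T Γ₁ ∧ PredTy (Γ₁ ++ Γ) ψ :=
  ⟨by intro h; cases h with | aggr h₁ h₂ h₃ h₄ h₅ => exact ⟨h₄, h₅, h₁, _, h₂, h₃⟩,
    by rintro ⟨h₄, h₅, h₁, _, h₂, h₃⟩; exact .aggr h₁ h₂ h₃ h₄ h₅⟩

theorem actTy_create_iff {i : S.TId} {l : LRef S} {sk : Schema} :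
    ActTy Δ Sch H Γ (.create i l sk) Γ' ↔ Γ' = [] ∧ LRefTy Γ l ∧ Sch i = some sk :=
  ⟨by intro h; cases h with | create h₁ h₂ => exact ⟨rfl, h₂, h₁⟩,
    by rintro ⟨rfl, h₂, h₁⟩; exact .create h₁ h₂⟩

theorem actTy_drop_iff {i : S.TId} {l : LRef S} :
    ActTy Δ Sch H Γ (.drop i l) Γ' ↔ Γ' = [] ∧ LRefTy Γ l :=
  ⟨by intro h; cases h with | drop h => exact ⟨rfl, h⟩, by rintro ⟨rfl, h⟩; exact .drop h⟩

theorem actTy_spawn_iff {P : Proc S} {l : LRef S} :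
    ActTy Δ Sch H Γ (.spawn P l) Γ' ↔ Γ' = [] ∧ LRefTy Γ l ∧ ProcTy Δ Sch H Γ P :=
  ⟨by intro h; cases h with | spawn h₁ h₂ => exact ⟨rfl, h₂, h₁⟩,
    by rintro ⟨rfl, h₂, h₁⟩; exact .spawn h₁ h₂⟩

theorem procTy_pref_iff {a : Act S} {P : Proc S} :
    ProcTy Δ Sch H Γ (.pref a P) ↔ ∃ Γ', ActTy Δ Sch H Γ a Γ' ∧ ProcTy Δ Sch H (Γ' ++ Γ) P :=
  ⟨by intro h; cases h with | pref h₁ h₂ => exact ⟨_, h₁, h₂⟩,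
    by rintro ⟨_, h₁, h₂⟩; exact .pref h₁ h₂⟩

theorem procTy_seq_iff {P₁ P₂ : Proc S} :
    ProcTy Δ Sch H Γ (.seq P₁ P₂) ↔ ProcTy Δ Sch H Γ P₁ ∧ ProcTy Δ Sch H Γ P₂ :=
  ⟨by intro h; cases h with | seq h₁ h₂ => exact ⟨h₁, h₂⟩, fun h => .seq h.1 h.2⟩

/-- Both rules for calls at once: the body is well typed or assumed to be so. -/
theorem procTy_call_iff {A : S.PName} {es : List (Expr S)} :
    ProcTy Δ Sch H Γ (.call A es) ↔
      ∃ D, Δ A = some D ∧ (ProcTy Δ Sch H D.env D.body ∨ A ∈ H) ∧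
        List.Forall₂ (fun e p => ExprTy Γ e p.ty) es D.params := by
  constructor
  · intro h
    cases h with
    | call h₁ h₂ h₃ => exact ⟨_, h₁, .inl h₃, h₂⟩
    | call_rec h₁ h₂ h₃ => exact ⟨_, h₁, .inr h₃, h₂⟩
  · rintro ⟨_, h₁, h₃ | h₃, h₂⟩
    · exact .call h₁ h₂ h₃
    · exact .call_rec h₁ h₂ h₃

theorem procTy_foreach_iff {tb : TB S} {T : Template S} {ψ : Pred S}
    {o : PartialOrder (Row S)} {P : Proc S} :
    ProcTy Δ Sch H Γ (.foreach tb T ψ o P) ↔ ∃ sk, TBTy Sch Γ tb sk ∧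
      ∃ Γ₁, TemplateTy sk T Γ₁ ∧ PredTy (Γ₁ ++ Γ) ψ ∧ ProcTy Δ Sch H (Γ₁ ++ Γ) P :=
  ⟨by intro h; cases h with | foreach h₁ h₂ h₃ h₄ => exact ⟨_, h₁, _, h₂, h₃, h₄⟩,
    by rintro ⟨_, h₁, _, h₂, h₃, h₄⟩; exact .foreach h₁ h₂ h₃ h₄⟩

theorem compTy_proc_iff {P : Proc S} :
    CompTy Δ Sch H Γ (.proc P) ↔ ProcTy Δ Sch H Γ P :=
  ⟨by rintro ⟨⟩; assumption, .proc⟩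

theorem compTy_table_iff {tb : Table S} :
    CompTy Δ Sch H Γ (.table tb) ↔ (∀ r ∈ tb.R, Row.HasSchema r tb.I.sk) ∧
      ∃ i, tb.I.tid = some i ∧ Sch i = some tb.I.sk := by
  constructor
  · intro h
    cases h with
    | table h₁ h₂ h₃ => exact ⟨by simpa only [rowTy_iff] using h₁, _, h₂, h₃⟩
  · rintro ⟨h₁, _, h₂, h₃⟩
    exact .table (by simpa only [rowTy_iff] using h₁) h₂ h₃

theorem compTy_par_iff {C₁ C₂ : Comp S} :
    CompTy Δ Sch H Γ (.par C₁ C₂) ↔ CompTy Δ Sch H Γ C₁ ∧ CompTy Δ Sch H Γ C₂ :=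
  ⟨by intro h; cases h with | par h₁ h₂ => exact ⟨h₁, h₂⟩, fun h => .par h.1 h.2⟩

theorem not_netTy_err : ¬ NetTy Δ Sch H Γ .err := by rintro ⟨⟩

theorem netTy_node_iff {l : S.Loc} {C : Comp S} :
    NetTy Δ Sch H Γ (.node l C) ↔ CompTy Δ Sch H Γ C :=
  ⟨by rintro ⟨⟩; assumption, .node (.lit _)⟩

theorem netTy_res_iff {l : S.Loc} {N : Net S} :
    NetTy Δ Sch H Γ (.res l N) ↔ NetTy Δ Sch H Γ N :=
  ⟨by rintro ⟨⟩; assumption, .res⟩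

theorem netTy_par_iff {N₁ N₂ : Net S} :
    NetTy Δ Sch H Γ (.par N₁ N₂) ↔ NetTy Δ Sch H Γ N₁ ∧ NetTy Δ Sch H Γ N₂ :=
  ⟨by intro h; cases h with | par h₁ h₂ => exact ⟨h₁, h₂⟩, fun h => .par h.1 h.2⟩

end Inversion

/-! ### Lookup in environments -/

theorem binds_nil {b : Binding S} : ¬ Env.Binds [] b := by simp [Env.Binds]

theorem Env.Binds.name_mem_dom {Γ : Env S} {b : Binding S} (h : Γ.Binds b) : b.name ∈ Γ.dom :=
  ⟨b, List.mem_of_find?_eq_some h, rfl⟩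

theorem binds_cons {Γ : Env S} {b c : Binding S} :
    Env.Binds (c :: Γ) b ↔ c = b ∨ (c.name ≠ b.name ∧ Γ.Binds b) := by
  by_cases h : c.name = b.name
  · simp [Env.Binds, h]
  · have : c ≠ b := fun e => h (e ▸ rfl)
    simp [Env.Binds, h, this]

theorem dom_cons {Γ : Env S} {c : Binding S} {n : Name S} :
    n ∈ Env.dom (c :: Γ) ↔ c.name = n ∨ n ∈ Γ.dom := by
  simp [Env.dom]

theorem dom_append {Γ Γ' : Env S} {n : Name S} :
    n ∈ Env.dom (Γ' ++ Γ) ↔ n ∈ Γ'.dom ∨ n ∈ Γ.dom := by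
  simp [Env.dom, or_and_right, exists_or]

theorem binds_append {Γ Γ' : Env S} {b : Binding S} :
    Env.Binds (Γ' ++ Γ) b ↔ Γ'.Binds b ∨ (b.name ∉ Γ'.dom ∧ Γ.Binds b) := by
  induction Γ' with
  | nil => simp [binds_nil, Env.dom]
  | cons c Γ' ih =>
    rw [List.cons_append, binds_cons, binds_cons, ih, dom_cons]
    tauto

theorem Binding.isVar_name (b : Binding S) : b.name.IsVar := by
  cases b <;> trivial

theorem FieldTy.name_eq {τ : MTy} {w : Field S} {b : Binding S} (h : FieldTy τ w b) :
    b.name = w.name := by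
  cases h <;> rfl

theorem FieldsTy.dom_eq {sk : Schema} {ws : List (Field S)} {Γ : Env S} (h : FieldsTy sk ws Γ)
    (n : Name S) : n ∈ Γ.dom ↔ ∃ w ∈ ws, w.name = n := by
  induction h with
  | nil => simp [Env.dom]
  | cons h _ ih => simp [dom_cons, ih, h.name_eq]

theorem TemplateTy.dom_eq {sk : Schema} {T : Template S} {Γ : Env S} (h : TemplateTy sk T Γ) :
    Γ.dom = T.names :=
  Set.ext fun n => FieldsTy.dom_eq h n

theorem ActTy.dom_eq {Δ : Defns S} {Sch : Schemas S} {H : Set S.PName} {Γ Γ' : Env S}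
    {a : Act S} (h : ActTy Δ Sch H Γ a Γ') : Γ'.dom = a.binds := by
  cases h with
  | sel => ext n; simp [Act.binds, Binding.name, Env.dom, eq_comm]
  | aggr _ _ _ h => exact h.dom_eq
  | _ => simp [Env.dom, Act.binds]

/-! ### Renaming -/

/-- The action of a permutation of names on bindings. -/
def Binding.ren (π : Ren S) : Binding S → Binding S
  | .data x τ => .data (π.data x) τ
  | .locv u => .locv (π.locv u)
  | .tabv b sk => .tabv (π.tabv b) sk

/-- On the names in `A`, the environment `Γ₂` is the image of `Γ` under `π`. Names outside of `A`
may be bound arbitrarily in both environments. -/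
def Env.RenOn (π : Ren S) (A : Set (Name S)) (Γ Γ₂ : Env S) : Prop :=
  ∀ b : Binding S, b.name ∈ A → (Γ.Binds b ↔ Γ₂.Binds (b.ren π))

theorem Env.RenOn.mono {π : Ren S} {A B : Set (Name S)} {Γ Γ₂ : Env S}
    (h : Env.RenOn π B Γ Γ₂) (hAB : A ⊆ B) : Env.RenOn π A Γ Γ₂ :=
  fun b hb => h b (hAB hb)

theorem Ren.app_injective (π : Ren S) : Function.Injective π.app := by
  intro m n h
  cases m <;> cases n <;> simp_all [Ren.app]

theorem Binding.name_ren (π : Ren S) (b : Binding S) : (b.ren π).name = π.app b.name := by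
  cases b <;> rfl

theorem Binding.ren_injective (π : Ren S) : Function.Injective (Binding.ren π) := by
  intro a b h
  cases a <;> cases b <;> simp_all [Binding.ren]

theorem Binding.ren_of_fixed {π : Ren S} {b : Binding S} (h : π.app b.name = b.name) :
    b.ren π = b := by
  cases b <;> simp_all [Binding.ren, Ren.app, Binding.name]

/-- The side condition of alpha-conversion: a permutation that fixes the free names of a scope
relates every environment to itself. -/
theorem Ren.Fixes.renOn {π : Ren S} {A : Set (Name S)} (h : π.Fixes A) (Γ : Env S) :
    Env.RenOn π A Γ Γ := fun b hb => by rw [Binding.ren_of_fixed (h _ hb)]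

theorem binds_map_ren {π : Ren S} {Γ : Env S} {b : Binding S} :
    Env.Binds (Γ.map (Binding.ren π)) (b.ren π) ↔ Γ.Binds b := by
  induction Γ with
  | nil => simp [binds_nil]
  | cons c Γ ih =>
    rw [List.map_cons, binds_cons, binds_cons, ih, Binding.name_ren, Binding.name_ren,
      (Binding.ren_injective π).eq_iff, (Ren.app_injective π).ne_iff]

theorem mem_dom_map_ren {π : Ren S} {Γ : Env S} {n : Name S} :
    π.app n ∈ Env.dom (Γ.map (Binding.ren π)) ↔ n ∈ Γ.dom := by
  simp [Env.dom, Binding.name_ren, (Ren.app_injective π).eq_iff]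

theorem Env.RenOn.append {π : Ren S} {A : Set (Name S)} {Γ Γ₂ Γ' : Env S}
    (h : Env.RenOn π (A \ Γ'.dom) Γ Γ₂) :
    Env.RenOn π A (Γ' ++ Γ) (Γ'.map (Binding.ren π) ++ Γ₂) := by
  intro b hb
  rw [binds_append, binds_append, binds_map_ren, Binding.name_ren, mem_dom_map_ren]
  by_cases hd : b.name ∈ Γ'.dom
  · simp [hd]
  · simp [hd, h b ⟨hb, hd⟩]

theorem fieldTy_ren_iff {π : Ren S} {τ : MTy} {w : Field S} {c : Binding S} :
    FieldTy τ (w.ren π) c ↔ ∃ b, FieldTy τ w b ∧ c = b.ren π := by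
  constructor
  · intro h
    cases w <;> cases h
    · exact ⟨_, .data _ ‹_›, rfl⟩
    · exact ⟨_, .loc _, rfl⟩
  · rintro ⟨b, h, rfl⟩
    cases h
    · exact .data _ ‹_›
    · exact .loc _

theorem fieldsTy_ren_iff {π : Ren S} {sk : Schema} {ws : List (Field S)} {Γ' : Env S} :
    FieldsTy sk (ws.map (Field.ren π)) Γ' ↔
      ∃ Γ, FieldsTy sk ws Γ ∧ Γ' = Γ.map (Binding.ren π) := by
  constructor
  · intro h
    induction ws generalizing sk Γ' with
    | nil => cases h; exact ⟨[], .nil, rfl⟩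
    | cons w ws ih =>
      rw [List.map_cons] at h
      cases h with
      | cons hw hws =>
        obtain ⟨b, hb, rfl⟩ := fieldTy_ren_iff.1 hw
        obtain ⟨Γ, hΓ, rfl⟩ := ih hws
        exact ⟨b :: Γ, .cons hb hΓ, rfl⟩
  · rintro ⟨Γ, h, rfl⟩
    induction h with
    | nil => exact .nil
    | cons h _ ih => exact .cons (fieldTy_ren_iff.2 ⟨_, h, rfl⟩) ih

theorem templateTy_ren_iff {π : Ren S} {sk : Schema} {T : Template S} {Γ' : Env S} :
    TemplateTy sk (T.ren π) Γ' ↔ ∃ Γ, TemplateTy sk T Γ ∧ Γ' = Γ.map (Binding.ren π) :=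
  fieldsTy_ren_iff

/-- Renaming the scope of a template together with the template. -/
theorem template_scope_ren {π : Ren S} {A : Set (Name S)} {sk : Schema} {T : Template S}
    {Γ Γ₂ : Env S} {p q : Env S → Prop} (h : Env.RenOn π (A \ T.names) Γ Γ₂)
    (hpq : ∀ {Γ Γ₂ : Env S}, Env.RenOn π A Γ Γ₂ → (p Γ ↔ q Γ₂)) :
    (∃ Γ₁, TemplateTy sk T Γ₁ ∧ p (Γ₁ ++ Γ)) ↔
      ∃ Γ₁, TemplateTy sk (T.ren π) Γ₁ ∧ q (Γ₁ ++ Γ₂) := by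
  have key : ∀ Γ₁, TemplateTy sk T Γ₁ →
      (p (Γ₁ ++ Γ) ↔ q (Γ₁.map (Binding.ren π) ++ Γ₂)) :=
    fun Γ₁ h₁ => hpq (Env.RenOn.append (by rwa [h₁.dom_eq]))
  simp only [templateTy_ren_iff]
  constructor
  · rintro ⟨Γ₁, h₁, h₂⟩
    exact ⟨_, ⟨Γ₁, h₁, rfl⟩, (key Γ₁ h₁).1 h₂⟩
  · rintro ⟨_, ⟨Γ₁, h₁, rfl⟩, h₂⟩
    exact ⟨Γ₁, h₁, (key Γ₁ h₁).2 h₂⟩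

theorem Lit.sort_ren (π : Ren S) (c : Lit S) : (c.ren π).sort = c.sort := by cases c <;> rfl

theorem Val.hasSort_ren {π : Ren S} {v : Val S} {τ : MTy} :
    (v.ren π).HasSort τ ↔ v.HasSort τ := by
  cases v <;> cases τ <;> simp [Val.ren, Val.HasSort, Lit.sort_ren]

theorem Row.hasSchema_ren {π : Ren S} {r : Row S} {sk : Schema} :
    Row.HasSchema (r.ren π) sk ↔ r.HasSchema sk := by
  simp only [Row.HasSchema, Row.ren, List.forall₂_map_left_iff, Val.hasSort_ren]

theorem Table.rows_ren {π : Ren S} {tb : Table S} {sk : Schema} :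
    (∀ r ∈ (tb.ren π).R, Row.HasSchema r sk) ↔ ∀ r ∈ tb.R, Row.HasSchema r sk := by
  simp [Table.ren, Row.hasSchema_ren]

theorem exprTy_ren {π : Ren S} {Γ Γ₂ : Env S} {e : Expr S} (h : Env.RenOn π e.fn Γ Γ₂)
    (τ : MTy) : ExprTy Γ e τ ↔ ExprTy Γ₂ (e.ren π) τ := by
  induction e using Expr.induct generalizing τ with
  | lit c => simp [Expr.ren, exprTy_lit_iff, Lit.sort_ren]
  | dvar x =>
    simp only [Expr.ren, exprTy_dvar_iff]
    rw [h (.data x τ) rfl]; rfl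
  | lvar u =>
    simp only [Expr.ren, exprTy_lvar_iff]
    rw [h (.locv u) rfl]; rfl
  | cat e₁ e₂ ih₁ ih₂ =>
    simp only [Expr.ren, exprTy_cat_iff, ih₁ (h.mono Set.subset_union_left),
      ih₂ (h.mono Set.subset_union_right)]
  | arith op e₁ e₂ ih₁ ih₂ =>
    simp only [Expr.ren, exprTy_arith_iff, ih₁ (h.mono Set.subset_union_left),
      ih₂ (h.mono Set.subset_union_right)]
  | mset es ih =>
    have h' : ∀ e ∈ es, ∀ τ, ExprTy Γ e τ ↔ ExprTy Γ₂ (e.ren π) τ := fun e he τ =>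
      ih e he (h.mono fun n hn => Expr.mem_fnList.2 ⟨e, he, hn⟩) τ
    simp only [Expr.ren, exprTy_mset_iff, Expr.renList_eq_map, List.forall_mem_map]
    exact exists_congr fun d => and_congr_right fun _ => forall₂_congr fun e he => h' e he _

theorem forall₂_exprTy_ren {α : Type*} {π : Ren S} {Γ Γ₂ : Env S} {es : List (Expr S)}
    (h : Env.RenOn π (Expr.fnList es) Γ Γ₂) (ty : α → MTy) (l : List α) :
    List.Forall₂ (fun e a => ExprTy Γ e (ty a)) es l ↔
      List.Forall₂ (fun e a => ExprTy Γ₂ e (ty a)) (Expr.renList π es) l := by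
  rw [Expr.renList_eq_map]
  exact forall₂_congr_map fun e he a =>
    exprTy_ren (h.mono fun n hn => Expr.mem_fnList.2 ⟨e, he, hn⟩) _

theorem tupleTy_ren {π : Ren S} {Γ Γ₂ : Env S} {t : Tuple S} (h : Env.RenOn π t.fn Γ Γ₂)
    (sk : Schema) : TupleTy Γ t sk ↔ TupleTy Γ₂ (t.ren π) sk :=
  forall₂_exprTy_ren h id sk

theorem predTy_ren {π : Ren S} {Γ Γ₂ : Env S} {ψ : Pred S} (h : Env.RenOn π ψ.fn Γ Γ₂) :
    PredTy Γ ψ ↔ PredTy Γ₂ (ψ.ren π) := by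
  induction ψ with
  | tru => simp [Pred.ren, PredTy.tru]
  | cmp op e₁ e₂ =>
    simp only [Pred.ren, predTy_cmp_iff, exprTy_ren (h.mono Set.subset_union_left),
      exprTy_ren (h.mono Set.subset_union_right)]
  | mem e₁ e₂ =>
    simp only [Pred.ren, predTy_mem_iff, exprTy_ren (h.mono Set.subset_union_left),
      exprTy_ren (h.mono Set.subset_union_right)]
  | neg ψ ih => simp only [Pred.ren, predTy_neg_iff, ih h]
  | conj ψ₁ ψ₂ ih₁ ih₂ =>
    simp only [Pred.ren, predTy_conj_iff, ih₁ (h.mono Set.subset_union_left),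
      ih₂ (h.mono Set.subset_union_right)]

theorem lrefTy_ren {π : Ren S} {Γ Γ₂ : Env S} {l : LRef S} (h : Env.RenOn π l.fn Γ Γ₂) :
    LRefTy Γ l ↔ LRefTy Γ₂ (l.ren π) := by
  cases l with
  | const l => simp [LRef.ren, lrefTy_const]
  | var u =>
    rw [LRef.ren, lrefTy_var_iff, lrefTy_var_iff]
    exact h (.locv u) rfl

theorem tbTy_ren {π : Ren S} {Sch : Schemas S} {Γ Γ₂ : Env S} {tb : TB S}
    (h : Env.RenOn π tb.fn Γ Γ₂) (sk : Schema) :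
    TBTy Sch Γ tb sk ↔ TBTy Sch Γ₂ (tb.ren π) sk := by
  cases tb with
  | ref i l => rw [TB.ren, tbTy_ref_iff, tbTy_ref_iff, lrefTy_ren h]
  | var b =>
    rw [TB.ren, tbTy_var_iff, tbTy_var_iff]
    exact h (.tabv b sk) rfl
  | conc tb => rw [TB.ren, tbTy_conc_iff, tbTy_conc_iff, Table.rows_ren]; rfl

theorem scope_pred_ren {π : Ren S} {Γ Γ₂ : Env S} {T : Template S} {ψ : Pred S}
    (h : Env.RenOn π (ψ.fn \ T.names) Γ Γ₂) (sk : Schema) :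
    (∃ Γ₁, TemplateTy sk T Γ₁ ∧ PredTy (Γ₁ ++ Γ) ψ) ↔
      ∃ Γ₁, TemplateTy sk (T.ren π) Γ₁ ∧ PredTy (Γ₁ ++ Γ₂) (ψ.ren π) :=
  template_scope_ren (q := fun Γ => PredTy Γ (ψ.ren π)) h predTy_ren

theorem scope_pred_tuple_ren {π : Ren S} {Γ Γ₂ : Env S} {T : Template S} {ψ : Pred S}
    {t : Tuple S} (h : Env.RenOn π ((ψ.fn ∪ t.fn) \ T.names) Γ Γ₂) (sk sk' : Schema) :
    (∃ Γ₁, TemplateTy sk T Γ₁ ∧ PredTy (Γ₁ ++ Γ) ψ ∧ TupleTy (Γ₁ ++ Γ) t sk') ↔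
      ∃ Γ₁, TemplateTy sk (T.ren π) Γ₁ ∧ PredTy (Γ₁ ++ Γ₂) (ψ.ren π) ∧
        TupleTy (Γ₁ ++ Γ₂) (t.ren π) sk' :=
  template_scope_ren (p := fun Γ => PredTy Γ ψ ∧ TupleTy Γ t sk')
    (q := fun Γ => PredTy Γ (ψ.ren π) ∧ TupleTy Γ (t.ren π) sk') h fun h =>
    and_congr (predTy_ren (h.mono Set.subset_union_left))
      (tupleTy_ren (h.mono Set.subset_union_right) sk')

section

variable (Δ : Defns S) (Sch : Schemas S) (H : Set S.PName)

mutual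

theorem actTy_ren (π : Ren S) (a : Act S) {Γ Γ₂ : Env S} (h : Env.RenOn π a.fn Γ Γ₂)
    (Γ' : Env S) :
    ActTy Δ Sch H Γ₂ (a.ren π) Γ' ↔
      ∃ Γ₀, ActTy Δ Sch H Γ a Γ₀ ∧ Γ' = Γ₀.map (Binding.ren π) := by
  cases a with
  | ins i t l =>
    simp only [Act.ren, actTy_ins_iff, lrefTy_ren (h.mono Set.subset_union_right),
      tupleTy_ren (h.mono Set.subset_union_left)]
    aesop
  | del i T ψ l =>
    simp only [Act.ren, actTy_del_iff, lrefTy_ren (h.mono Set.subset_union_right),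
      scope_pred_ren (h.mono Set.subset_union_left)]
    aesop
  | sel tbs T ψ t b =>
    have htbs : ∀ sks, List.Forall₂ (TBTy Sch Γ) tbs sks ↔
        List.Forall₂ (TBTy Sch Γ₂) (tbs.map (TB.ren π)) sks := fun sks =>
      forall₂_congr_map fun tb htb sk => tbTy_ren (h.mono fun n hn => .inl ⟨tb, htb, hn⟩) sk
    simp only [Act.ren, actTy_sel_iff, htbs, scope_pred_tuple_ren (h.mono Set.subset_union_right)]
    constructor
    · rintro ⟨sk', rfl, h⟩
      exact ⟨_, ⟨sk', rfl, h⟩, rfl⟩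
    · rintro ⟨_, ⟨sk', rfl, h⟩, rfl⟩
      exact ⟨sk', rfl, h⟩
  | upd i T ψ t l =>
    simp only [Act.ren, actTy_upd_iff, lrefTy_ren (h.mono Set.subset_union_right),
      scope_pred_tuple_ren (h.mono Set.subset_union_left)]
    aesop
  | aggr i T ψ f T' l =>
    simp only [Act.ren, actTy_aggr_iff, lrefTy_ren (h.mono Set.subset_union_right),
      scope_pred_ren (h.mono Set.subset_union_left), templateTy_ren_iff (T := T')]
    aesop
  | create i l sk =>
    simp only [Act.ren, actTy_create_iff, lrefTy_ren h]
    aesop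
  | drop i l =>
    simp only [Act.ren, actTy_drop_iff, lrefTy_ren h]
    aesop
  | spawn P l =>
    simp only [Act.ren, actTy_spawn_iff, lrefTy_ren (h.mono Set.subset_union_right),
      procTy_ren π P (h.mono Set.subset_union_left)]
    aesop

/-- Equivariance of typing, for environments that correspond to each other on the free names. For
the identity permutation, this says that typing depends only on the bindings of the free names. -/
theorem procTy_ren (π : Ren S) (P : Proc S) {Γ Γ₂ : Env S} (h : Env.RenOn π P.fn Γ Γ₂) :
    ProcTy Δ Sch H Γ P ↔ ProcTy Δ Sch H Γ₂ (P.ren π) := by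
  cases P with
  | nil => simp [Proc.ren, ProcTy.nil]
  | pref a P =>
    have key : ∀ Γ', ActTy Δ Sch H Γ a Γ' → (ProcTy Δ Sch H (Γ' ++ Γ) P ↔
        ProcTy Δ Sch H (Γ'.map (Binding.ren π) ++ Γ₂) (P.ren π)) := fun Γ' ha =>
      procTy_ren π P (Env.RenOn.append (by
        rw [ha.dom_eq]; exact h.mono Set.subset_union_right))
    simp only [Proc.ren, procTy_pref_iff, actTy_ren π a (h.mono Set.subset_union_left)]
    constructor
    · rintro ⟨Γ', ha, hP⟩
      exact ⟨_, ⟨Γ', ha, rfl⟩, (key Γ' ha).1 hP⟩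
    · rintro ⟨_, ⟨Γ', ha, rfl⟩, hP⟩
      exact ⟨Γ', ha, (key Γ' ha).2 hP⟩
  | call A es =>
    simp only [Proc.ren, procTy_call_iff, forall₂_exprTy_ren h Param.ty]
  | foreach tb T ψ o P =>
    simp only [Proc.ren, procTy_foreach_iff, tbTy_ren (h.mono Set.subset_union_left)]
    refine exists_congr fun sk => and_congr_right fun _ => ?_
    exact template_scope_ren (p := fun Γ => PredTy Γ ψ ∧ ProcTy Δ Sch H Γ P)
      (q := fun Γ => PredTy Γ (ψ.ren π) ∧ ProcTy Δ Sch H Γ (P.ren π))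
      (h.mono Set.subset_union_right) fun h =>
      and_congr (predTy_ren (h.mono Set.subset_union_left))
        (procTy_ren π P (h.mono Set.subset_union_right))
  | seq P₁ P₂ =>
    simp only [Proc.ren, procTy_seq_iff, procTy_ren π P₁ (h.mono Set.subset_union_left),
      procTy_ren π P₂ (h.mono Set.subset_union_right)]

end

theorem compTy_ren (π : Ren S) (C : Comp S) {Γ Γ₂ : Env S} (h : Env.RenOn π C.fn Γ Γ₂) :
    CompTy Δ Sch H Γ C ↔ CompTy Δ Sch H Γ₂ (C.ren π) := by
  induction C with
  | proc P => simp only [Comp.ren, compTy_proc_iff, procTy_ren Δ Sch H π P h]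
  | table tb => rw [Comp.ren, compTy_table_iff, compTy_table_iff, Table.rows_ren]; rfl
  | par C₁ C₂ ih₁ ih₂ =>
    simp only [Comp.ren, compTy_par_iff, ih₁ (h.mono Set.subset_union_left),
      ih₂ (h.mono Set.subset_union_right)]

theorem netTy_ren (π : Ren S) (N : Net S) {Γ Γ₂ : Env S} (h : Env.RenOn π N.fn Γ Γ₂) :
    NetTy Δ Sch H Γ N ↔ NetTy Δ Sch H Γ₂ (N.ren π) := by
  induction N with
  | nil => simp [Net.ren, NetTy.nil]
  | err => simp [Net.ren, not_netTy_err]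
  | par N₁ N₂ ih₁ ih₂ =>
    simp only [Net.ren, netTy_par_iff, ih₁ (h.mono Set.subset_union_left),
      ih₂ (h.mono Set.subset_union_right)]
  | res l N ih =>
    rw [Net.ren, netTy_res_iff, netTy_res_iff]
    refine ih fun b hb => h b ⟨hb, ?_⟩
    intro (e : b.name = .site l)
    exact (e ▸ b.isVar_name : (Name.site l).IsVar)
  | node l C =>
    rw [Net.ren, netTy_node_iff, netTy_node_iff,
      compTy_ren Δ Sch H π C (h.mono Set.subset_union_right)]

end

/-! ### Dependence on the environment -/

/-- The identity permutation. -/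
def Ren.id (S : Sig) : Ren S := ⟨1, 1, 1, 1⟩

theorem Binding.ren_id (b : Binding S) : b.ren (Ren.id S) = b := by cases b <;> rfl

theorem map_eq_self {α : Type*} {f : α → α} {l : List α} (h : ∀ a ∈ l, f a = a) :
    l.map f = l := by
  rw [List.map_congr_left (g := _root_.id) h, List.map_id]

theorem Lit.ren_id : Lit.ren (Ren.id S) = _root_.id := by
  funext c
  cases c <;> rfl

theorem Val.ren_id : Val.ren (Ren.id S) = _root_.id := by
  funext v
  cases v <;> simp [Val.ren, Lit.ren_id]

theorem Row.ren_id : Row.ren (Ren.id S) = _root_.id := by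
  funext r
  simp [Row.ren, Val.ren_id]

theorem Table.ren_id (tb : Table S) : tb.ren (Ren.id S) = tb := by
  simp [Table.ren, Row.ren_id]

theorem Expr.ren_id (e : Expr S) : e.ren (Ren.id S) = e := by
  induction e using Expr.induct with
  | lit c => simp [Expr.ren, Lit.ren_id]
  | dvar x => rfl
  | lvar u => rfl
  | cat e₁ e₂ ih₁ ih₂ => simp [Expr.ren, ih₁, ih₂]
  | arith op e₁ e₂ ih₁ ih₂ => simp [Expr.ren, ih₁, ih₂]
  | mset es ih => simp [Expr.ren, Expr.renList_eq_map, map_eq_self ih]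

theorem Expr.renList_id (es : List (Expr S)) : Expr.renList (Ren.id S) es = es := by
  rw [Expr.renList_eq_map, map_eq_self fun e _ => e.ren_id]

theorem Pred.ren_id (ψ : Pred S) : ψ.ren (Ren.id S) = ψ := by
  induction ψ <;> simp_all [Pred.ren, Expr.ren_id]

theorem Tuple.ren_id (t : Tuple S) : t.ren (Ren.id S) = t := by
  simp [Tuple.ren, Expr.renList_id]

theorem Template.ren_id (T : Template S) : T.ren (Ren.id S) = T := by
  have : T.fields.map (Field.ren (Ren.id S)) = T.fields :=
    map_eq_self fun w _ => by cases w <;> rfl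
  simp [Template.ren, this]

theorem LRef.ren_id (l : LRef S) : l.ren (Ren.id S) = l := by cases l <;> rfl

theorem TB.ren_id (tb : TB S) : tb.ren (Ren.id S) = tb := by
  cases tb with
  | ref i l => simp [TB.ren, LRef.ren_id]
  | var b => rfl
  | conc tb => simp [TB.ren, Table.ren_id]

mutual

theorem Act.ren_id (a : Act S) : a.ren (Ren.id S) = a := by
  cases a with
  | sel tbs T ψ t b =>
    simp only [Act.ren, Template.ren_id, Pred.ren_id, Tuple.ren_id,
      map_eq_self fun (tb : TB S) _ => tb.ren_id]
    rfl
  | spawn P l => simp [Act.ren, Proc.ren_id P, LRef.ren_id]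
  | _ => simp [Act.ren, LRef.ren_id, Template.ren_id, Pred.ren_id, Tuple.ren_id]

theorem Proc.ren_id (P : Proc S) : P.ren (Ren.id S) = P := by
  cases P with
  | nil => rfl
  | pref a P => simp [Proc.ren, Act.ren_id a, Proc.ren_id P]
  | call A es => simp [Proc.ren, Expr.renList_id]
  | foreach tb T ψ o P =>
    simp [Proc.ren, TB.ren_id, Template.ren_id, Pred.ren_id, Proc.ren_id P]
  | seq P₁ P₂ => simp [Proc.ren, Proc.ren_id P₁, Proc.ren_id P₂]

end

theorem Comp.ren_id (C : Comp S) : C.ren (Ren.id S) = C := by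
  induction C <;> simp_all [Comp.ren, Proc.ren_id, Table.ren_id]

theorem Net.ren_id (N : Net S) : N.ren (Ren.id S) = N := by
  induction N with
  | node l C => rw [Net.ren, Comp.ren_id]; rfl
  | res l N ih => rw [Net.ren, ih]; rfl
  | _ => simp_all [Net.ren]

theorem renOn_id {A : Set (Name S)} {Γ Γ₂ : Env S}
    (h : ∀ b : Binding S, b.name ∈ A → (Γ.Binds b ↔ Γ₂.Binds b)) :
    Env.RenOn (Ren.id S) A Γ Γ₂ := fun b hb => by rw [Binding.ren_id]; exact h b hb

section

variable {Δ : Defns S} {Sch : Schemas S} {H : Set S.PName}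

theorem procTy_congr {P : Proc S} {Γ Γ₂ : Env S}
    (h : ∀ b : Binding S, b.name ∈ P.fn → (Γ.Binds b ↔ Γ₂.Binds b)) :
    ProcTy Δ Sch H Γ P ↔ ProcTy Δ Sch H Γ₂ P := by
  simpa only [Proc.ren_id] using procTy_ren Δ Sch H (Ren.id S) P (renOn_id h)

theorem predTy_congr {ψ : Pred S} {Γ Γ₂ : Env S}
    (h : ∀ b : Binding S, b.name ∈ ψ.fn → (Γ.Binds b ↔ Γ₂.Binds b)) :
    PredTy Γ ψ ↔ PredTy Γ₂ ψ := by
  simpa only [Pred.ren_id] using predTy_ren (renOn_id h)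

theorem tupleTy_congr {t : Tuple S} {Γ Γ₂ : Env S} {sk : Schema}
    (h : ∀ b : Binding S, b.name ∈ t.fn → (Γ.Binds b ↔ Γ₂.Binds b)) :
    TupleTy Γ t sk ↔ TupleTy Γ₂ t sk := by
  simpa only [Tuple.ren_id] using tupleTy_ren (renOn_id h) sk

theorem netTy_congr {N : Net S} {Γ Γ₂ : Env S}
    (h : ∀ b : Binding S, b.name ∈ N.fn → (Γ.Binds b ↔ Γ₂.Binds b)) :
    NetTy Δ Sch H Γ N ↔ NetTy Δ Sch H Γ₂ N := by
  simpa only [Net.ren_id] using netTy_ren Δ Sch H (Ren.id S) N (renOn_id h)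

/-! ### Free variables of well-typed terms -/

theorem Lit.not_isVar {c : Lit S} {n : Name S} (h : n ∈ c.fn) : ¬ n.IsVar := by
  cases c <;> simp_all [Lit.fn, Name.IsVar]

theorem Table.not_isVar {tb : Table S} {n : Name S} (h : n ∈ tb.fn) : ¬ n.IsVar := by
  obtain ⟨r, _, v, _, hv⟩ := h
  cases v with
  | lit c => exact Lit.not_isVar hv
  | mset s => obtain ⟨c, _, hc⟩ := hv; exact Lit.not_isVar hc

theorem ExprTy.fv {Γ : Env S} {e : Expr S} {τ : MTy} (h : ExprTy Γ e τ) {n : Name S}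
    (hn : n ∈ e.fn) (hv : n.IsVar) : n ∈ Γ.dom := by
  induction h with
  | dvar h => obtain rfl : n = _ := hn; exact h.name_mem_dom
  | lvar h => obtain rfl : n = _ := hn; exact h.name_mem_dom
  | lit c => exact absurd hv (Lit.not_isVar hn)
  | cat _ _ ih₁ ih₂ => exact hn.elim ih₁ ih₂
  | arith _ _ _ ih₁ ih₂ => exact hn.elim ih₁ ih₂
  | mset _ ih =>
    obtain ⟨e, he, hn⟩ := Expr.mem_fnList.1 hn
    exact ih e he hn

theorem fv_of_forall₂_exprTy {α : Type*} {Γ : Env S} {es : List (Expr S)} {l : List α}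
    {ty : α → MTy} (h : List.Forall₂ (fun e a => ExprTy Γ e (ty a)) es l) {n : Name S}
    (hn : n ∈ Expr.fnList es) (hv : n.IsVar) : n ∈ Γ.dom := by
  induction h with
  | nil => exact hn.elim
  | cons h _ ih => exact hn.elim (fun hn => h.fv hn hv) ih

theorem TupleTy.fv {Γ : Env S} {t : Tuple S} {sk : Schema} (h : TupleTy Γ t sk) {n : Name S}
    (hn : n ∈ t.fn) (hv : n.IsVar) : n ∈ Γ.dom :=
  fv_of_forall₂_exprTy (ty := _root_.id) h hn hv

theorem PredTy.fv {Γ : Env S} {ψ : Pred S} (h : PredTy Γ ψ) {n : Name S}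
    (hn : n ∈ ψ.fn) (hv : n.IsVar) : n ∈ Γ.dom := by
  induction h with
  | tru => exact hn.elim
  | cmp _ h₁ h₂ => exact hn.elim (fun hn => h₁.fv hn hv) fun hn => h₂.fv hn hv
  | mem h₁ h₂ => exact hn.elim (fun hn => h₁.fv hn hv) fun hn => h₂.fv hn hv
  | neg _ ih => exact ih hn
  | conj _ _ ih₁ ih₂ => exact hn.elim ih₁ ih₂

theorem LRefTy.fv {Γ : Env S} {l : LRef S} (h : LRefTy Γ l) {n : Name S}
    (hn : n ∈ l.fn) (hv : n.IsVar) : n ∈ Γ.dom := by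
  cases l with
  | const l => exact ExprTy.fv h (e := .lit (.loc l)) hn hv
  | var u => exact ExprTy.fv h (e := .lvar u) hn hv

theorem TBTy.fv {Γ : Env S} {tb : TB S} {sk : Schema} (h : TBTy Sch Γ tb sk) {n : Name S}
    (hn : n ∈ tb.fn) (hv : n.IsVar) : n ∈ Γ.dom := by
  cases h with
  | ref h _ => exact LRefTy.fv h hn hv
  | var h => obtain rfl : n = _ := hn; exact h.name_mem_dom
  | conc => exact absurd hv (Table.not_isVar hn)

/-- A name that is free outside of the scope of a template cannot be bound by the template. -/
theorem TemplateTy.fv_scope {Γ Γ₁ : Env S} {sk : Schema} {T : Template S} {A : Set (Name S)}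
    (hT : TemplateTy sk T Γ₁) {n : Name S} (hn : n ∈ A \ T.names)
    (h : n ∈ A → n ∈ Env.dom (Γ₁ ++ Γ)) : n ∈ Γ.dom :=
  (dom_append.1 (h hn.1)).resolve_left (by rw [hT.dom_eq]; exact hn.2)

variable (Δ Sch H)

mutual

theorem actTy_fv (a : Act S) {Γ Γ' : Env S} (h : ActTy Δ Sch H Γ a Γ') {n : Name S}
    (hn : n ∈ a.fn) (hv : n.IsVar) : n ∈ Γ.dom := by
  cases a with
  | ins i t l =>
    obtain ⟨_, hl, _, _, ht⟩ := actTy_ins_iff.1 h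
    exact hn.elim (fun hn => ht.fv hn hv) fun hn => hl.fv hn hv
  | del i T ψ l =>
    obtain ⟨_, hl, _, _, _, hT, hψ⟩ := actTy_del_iff.1 h
    exact hn.elim (fun hn => hT.fv_scope hn fun hn => hψ.fv hn hv) fun hn => hl.fv hn hv
  | sel tbs T ψ t b =>
    obtain ⟨_, _, sks, htbs, _, hT, hψ, ht⟩ := actTy_sel_iff.1 h
    refine hn.elim ?_ fun hn => hT.fv_scope hn fun hn =>
      hn.elim (fun hn => hψ.fv hn hv) fun hn => ht.fv hn hv
    rintro ⟨tb, htb, hn⟩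
    obtain ⟨sk, _, htb⟩ := exists_mem_right_of_forall₂ htbs htb
    exact htb.fv hn hv
  | upd i T ψ t l =>
    obtain ⟨_, hl, _, _, _, hT, hψ, ht⟩ := actTy_upd_iff.1 h
    exact hn.elim (fun hn => hT.fv_scope hn fun hn =>
      hn.elim (fun hn => hψ.fv hn hv) fun hn => ht.fv hn hv) fun hn => hl.fv hn hv
  | aggr i T ψ f T' l =>
    obtain ⟨_, hl, _, _, hT, hψ⟩ := actTy_aggr_iff.1 h
    exact hn.elim (fun hn => hT.fv_scope hn fun hn => hψ.fv hn hv) fun hn => hl.fv hn hv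
  | create i l sk => exact (actTy_create_iff.1 h).2.1.fv hn hv
  | drop i l => exact (actTy_drop_iff.1 h).2.fv hn hv
  | spawn P l =>
    obtain ⟨_, hl, hP⟩ := actTy_spawn_iff.1 h
    exact hn.elim (fun hn => procTy_fv P hP hn hv) fun hn => hl.fv hn hv

theorem procTy_fv (P : Proc S) {Γ : Env S} (h : ProcTy Δ Sch H Γ P) {n : Name S}
    (hn : n ∈ P.fn) (hv : n.IsVar) : n ∈ Γ.dom := by
  cases P with
  | nil => exact hn.elim
  | pref a P =>
    obtain ⟨Γ', ha, hP⟩ := procTy_pref_iff.1 h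
    refine hn.elim (fun hn => actTy_fv a ha hn hv) fun hn => ?_
    exact (dom_append.1 (procTy_fv P hP hn.1 hv)).resolve_left (by rw [ha.dom_eq]; exact hn.2)
  | call A es =>
    obtain ⟨_, _, _, hes⟩ := procTy_call_iff.1 h
    exact fv_of_forall₂_exprTy hes hn hv
  | foreach tb T ψ o P =>
    obtain ⟨_, htb, _, hT, hψ, hP⟩ := procTy_foreach_iff.1 h
    exact hn.elim (fun hn => htb.fv hn hv) fun hn => hT.fv_scope hn fun hn =>
      hn.elim (fun hn => hψ.fv hn hv) fun hn => procTy_fv P hP hn hv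
  | seq P₁ P₂ =>
    obtain ⟨h₁, h₂⟩ := procTy_seq_iff.1 h
    exact hn.elim (fun hn => procTy_fv P₁ h₁ hn hv) fun hn => procTy_fv P₂ h₂ hn hv

end

variable {Δ Sch H}

theorem CompTy.fv {C : Comp S} {Γ : Env S} (h : CompTy Δ Sch H Γ C) {n : Name S}
    (hn : n ∈ C.fn) (hv : n.IsVar) : n ∈ Γ.dom := by
  induction h with
  | proc h => exact procTy_fv Δ Sch H _ h hn hv
  | table => exact absurd hv (Table.not_isVar hn)
  | par _ _ ih₁ ih₂ => exact hn.elim ih₁ ih₂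

theorem NetTy.fv {N : Net S} {Γ : Env S} (h : NetTy Δ Sch H Γ N) {n : Name S}
    (hn : n ∈ N.fn) (hv : n.IsVar) : n ∈ Γ.dom := by
  induction h with
  | nil => exact hn.elim
  | node _ h =>
    rcases hn with rfl | hn
    · exact hv.elim
    · exact h.fv hn hv
  | res _ ih => exact ih hn.1
  | par _ _ ih₁ ih₂ => exact hn.elim ih₁ ih₂

theorem not_mem_dom_nil {n : Name S} : n ∉ Env.dom ([] : Env S) := by simp [Env.dom]

/-- Closed nets are typed in the same way in all environments. -/
theorem netTy_iff_of_closed {N : Net S} (h : N.Closed) (Γ Γ₂ : Env S) :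
    NetTy Δ Sch H Γ N ↔ NetTy Δ Sch H Γ₂ N :=
  netTy_congr fun b hb => absurd b.isVar_name (h _ hb)

theorem NetTy.closed {N : Net S} (h : NetTy Δ Sch H [] N) : N.Closed :=
  fun _ hn hv => not_mem_dom_nil (h.fv hn hv)

/-! ### Alpha-equivalence and structural congruence -/

theorem Proc.Alpha.procTy_iff {P P' : Proc S} (h : Proc.Alpha P P') (Γ : Env S) :
    ProcTy Δ Sch H Γ P ↔ ProcTy Δ Sch H Γ P' := by
  refine Proc.Alpha.rec
    (motive_1 := fun a a' _ => ∀ Γ Γ', ActTy Δ Sch H Γ a Γ' ↔ ActTy Δ Sch H Γ a' Γ')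
    (motive_2 := fun P P' _ => ∀ Γ, ProcTy Δ Sch H Γ P ↔ ProcTy Δ Sch H Γ P')
    ?_ ?_ ?_ ?_ ?_ ?_ ?_ ?_ ?_ ?_ ?_ ?_ ?_ ?_ ?_ ?_ ?_ h Γ
  · intros; rfl
  · intro _ _ _ ih Γ Γ'
    exact (ih Γ Γ').symm
  · intro _ _ _ _ _ ih₁ ih₂ Γ Γ'
    exact (ih₁ Γ Γ').trans (ih₂ Γ Γ')
  · intro π i T ψ l h Γ Γ'
    simp only [actTy_del_iff, scope_pred_ren (h.renOn Γ)]
  · intro π tbs T ψ t b h Γ Γ'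
    simp only [actTy_sel_iff, scope_pred_tuple_ren (h.renOn Γ)]
  · intro π i T ψ t l h Γ Γ'
    simp only [actTy_upd_iff, scope_pred_tuple_ren (h.renOn Γ)]
  · intro π i T ψ f T' l h Γ Γ'
    simp only [actTy_aggr_iff, scope_pred_ren (h.renOn Γ)]
  · intro _ _ l _ ih Γ Γ'
    simp only [actTy_spawn_iff, ih Γ]
  · intros; rfl
  · intro _ _ _ ih Γ
    exact (ih Γ).symm
  · intro _ _ _ _ _ ih₁ ih₂ Γ
    exact (ih₁ Γ).trans (ih₂ Γ)
  · intro π tbs T ψ t b P h Γ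
    have key : ∀ sk', ProcTy Δ Sch H ([.tabv b sk'] ++ Γ) P ↔
        ProcTy Δ Sch H ([.tabv (π.tabv b) sk'] ++ Γ) (P.ren π) := fun sk' =>
      procTy_ren Δ Sch H π P (Env.RenOn.append (Γ' := [.tabv b sk']) ((h.renOn Γ).mono
        (Set.sdiff_subset_sdiff_right (by
          rintro n rfl
          exact ⟨_, List.mem_singleton_self _, rfl⟩))))
    simp only [procTy_pref_iff, actTy_sel_iff]
    constructor
    · rintro ⟨_, ⟨sk', rfl, h⟩, hP⟩
      exact ⟨_, ⟨sk', rfl, h⟩, (key sk').1 hP⟩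
    · rintro ⟨_, ⟨sk', rfl, h⟩, hP⟩
      exact ⟨_, ⟨sk', rfl, h⟩, (key sk').2 hP⟩
  · intro π i T ψ f T' l P h Γ
    have := template_scope_ren (sk := f.cod) (h.renOn Γ) (procTy_ren Δ Sch H π P)
    simp only [procTy_pref_iff, actTy_aggr_iff]
    constructor
    · rintro ⟨Γ', ⟨hT, h⟩, hP⟩
      obtain ⟨Γ₂, hT, hP⟩ := this.1 ⟨Γ', hT, hP⟩
      exact ⟨Γ₂, ⟨hT, h⟩, hP⟩
    · rintro ⟨Γ', ⟨hT, h⟩, hP⟩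
      obtain ⟨Γ₂, hT, hP⟩ := this.2 ⟨Γ', hT, hP⟩
      exact ⟨Γ₂, ⟨hT, h⟩, hP⟩
  · intro π tb T ψ o P h Γ
    simp only [procTy_foreach_iff]
    refine exists_congr fun sk => and_congr_right fun _ => ?_
    exact template_scope_ren (p := fun Γ => PredTy Γ ψ ∧ ProcTy Δ Sch H Γ P)
      (q := fun Γ => PredTy Γ (ψ.ren π) ∧ ProcTy Δ Sch H Γ (P.ren π)) (h.renOn Γ) fun h =>
      and_congr (predTy_ren (h.mono Set.subset_union_left))
        (procTy_ren Δ Sch H π P (h.mono Set.subset_union_right))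
  · intro _ _ _ _ _ _ iha ihP Γ
    simp only [procTy_pref_iff, iha, ihP]
  · intro tb T ψ o _ _ _ ih Γ
    simp only [procTy_foreach_iff, ih]
  · intro _ _ _ _ _ _ ih₁ ih₂ Γ
    simp only [procTy_seq_iff, ih₁, ih₂]

theorem Comp.Alpha.compTy_iff {C C' : Comp S} (h : Comp.Alpha C C') (Γ : Env S) :
    CompTy Δ Sch H Γ C ↔ CompTy Δ Sch H Γ C' := by
  induction h with
  | proc h => rw [compTy_proc_iff, compTy_proc_iff, h.procTy_iff]
  | table => rfl
  | par _ _ ih₁ ih₂ => rw [compTy_par_iff, compTy_par_iff, ih₁, ih₂]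

/-- In the empty environment, the renaming of a restricted net needs no condition on its free
names. -/
theorem Net.Alpha.netTy_iff {N N' : Net S} (h : Net.Alpha N N') :
    NetTy Δ Sch H [] N ↔ NetTy Δ Sch H [] N' := by
  induction h with
  | refl => rfl
  | symm _ ih => exact ih.symm
  | trans _ _ ih₁ ih₂ => exact ih₁.trans ih₂
  | res π l N _ =>
    rw [netTy_res_iff, netTy_res_iff]
    exact netTy_ren Δ Sch H π N fun b _ => iff_of_false binds_nil binds_nil
  | res_congr l _ ih => rw [netTy_res_iff, netTy_res_iff, ih]
  | par_congr _ _ ih₁ ih₂ => rw [netTy_par_iff, netTy_par_iff, ih₁, ih₂]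
  | node_congr l h => rw [netTy_node_iff, netTy_node_iff, h.compTy_iff]

theorem Net.Congr.netTy_iff {N N' : Net S} (h : Net.Congr N N') :
    NetTy Δ Sch H [] N ↔ NetTy Δ Sch H [] N' := by
  induction h with
  | refl => rfl
  | symm _ ih => exact ih.symm
  | trans _ _ ih₁ ih₂ => exact ih₁.trans ih₂
  | par_congr _ _ ih₁ ih₂ => rw [netTy_par_iff, netTy_par_iff, ih₁, ih₂]
  | res_congr l _ ih => rw [netTy_res_iff, netTy_res_iff, ih]
  | par_comm => simp only [netTy_par_iff, and_comm]
  | par_assoc => simp only [netTy_par_iff, and_assoc]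
  | alpha h => exact h.netTy_iff
  | par_nil N => simp [netTy_par_iff, NetTy.nil]
  | res_comm => simp only [netTy_res_iff]
  | extrude => simp only [netTy_par_iff, netTy_res_iff]
  | split => simp only [netTy_par_iff, netTy_node_iff, compTy_par_iff]
  | proc_nil => simp [netTy_node_iff, compTy_par_iff, compTy_proc_iff, ProcTy.nil]

end

/-! ### Substitution -/

/-- The substitution `s` replaces the variable bound by a binding with a term of its type. -/
inductive AssignTy (Sch : Schemas S) : Assign S → Binding S → Prop
  | data (x : S.DVar) {v : Val S} {τ : MTy} : v.HasSort τ → AssignTy Sch (.data x v) (.data x τ)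
  | loc (u : S.LVar) (l : S.Loc) : AssignTy Sch (.loc u l) (.locv u)
  | tab (b : S.TVar) {tb : Table S} {sk : Schema} :
      TBTy Sch [] (.conc tb) sk → AssignTy Sch (.tab b tb) (.tabv b sk)

theorem AssignTy.name_eq {Sch : Schemas S} {s : Assign S} {b : Binding S}
    (h : AssignTy Sch s b) : b.name = s.name := by
  cases h <;> rfl

/-- The substitution `s` leads from terms over `Γ` to terms over `Γ₂`: it is well typed for the
variable it replaces, and the environments agree on all other variables. -/
structure Env.SubstTo (Sch : Schemas S) (s : Assign S) (Γ Γ₂ : Env S) : Prop where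
  agree : ∀ b : Binding S, b.name ≠ s.name → (Γ.Binds b ↔ Γ₂.Binds b)
  assign : ∀ b : Binding S, b.name = s.name → Γ.Binds b → AssignTy Sch s b

section

variable {Sch : Schemas S} {s : Assign S} {Γ Γ₁ Γ₂ : Env S}

/-- Substitution for the most recent binding; it may override another one for the same variable. -/
theorem AssignTy.substTo {b : Binding S} (h : AssignTy Sch s b) (Γ : Env S) :
    Env.SubstTo Sch s (b :: Γ) Γ where
  agree c hc := by
    have hne : b.name ≠ c.name := h.name_eq ▸ hc.symm
    rw [binds_cons]
    refine ⟨fun h => h.elim (fun e => absurd (congrArg _ e) hne) And.right, fun h => .inr ⟨hne, h⟩⟩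
  assign c hc hb := by
    rcases binds_cons.1 hb with rfl | ⟨hne, _⟩
    · exact h
    · exact absurd (h.name_eq.trans hc.symm) hne

theorem Env.SubstTo.append_of_mem (h : Env.SubstTo Sch s Γ Γ₂) (hs : s.name ∈ Γ₁.dom)
    (b : Binding S) : Env.Binds (Γ₁ ++ Γ) b ↔ Env.Binds (Γ₁ ++ Γ₂) b := by
  rw [binds_append, binds_append]
  refine or_congr_right (and_congr_right fun hb => h.agree b fun e => hb (e ▸ hs))

theorem Env.SubstTo.append_of_notMem (h : Env.SubstTo Sch s Γ Γ₂) (hs : s.name ∉ Γ₁.dom) :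
    Env.SubstTo Sch s (Γ₁ ++ Γ) (Γ₁ ++ Γ₂) where
  agree b hb := by
    rw [binds_append, binds_append, h.agree b hb]
  assign b hb hB := by
    rcases binds_append.1 hB with hB | ⟨_, hB⟩
    · exact absurd (hb ▸ hB.name_mem_dom) hs
    · exact h.assign b hb hB

theorem ExprTy.subst (h : Env.SubstTo Sch s Γ Γ₂) {e : Expr S} {τ : MTy} (he : ExprTy Γ e τ) :
    ExprTy Γ₂ (e.subst s) τ := by
  induction he with
  | @dvar x τ hb hτ =>
    by_cases hs : (Binding.data x τ).name = s.name
    · cases h.assign _ hs hb with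
      | data _ hv => simpa [Expr.subst] using exprTy_toExpr_iff.2 hv
    · have : ExprTy Γ₂ (.dvar x) τ := .dvar ((h.agree _ hs).1 hb) hτ
      cases s with
      | data y v =>
        have hne : y ≠ x := by rintro rfl; exact hs rfl
        simpa [Expr.subst, hne] using this
      | _ => exact this
  | @lvar u hb =>
    by_cases hs : (Binding.locv u).name = s.name
    · cases h.assign _ hs hb with
      | loc _ l => simp [Expr.subst, exprTy_lit_iff, Lit.sort]
    · have : ExprTy Γ₂ (.lvar u) (.data .loc) := .lvar ((h.agree _ hs).1 hb)
      cases s with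
      | loc y l =>
        have hne : y ≠ u := by rintro rfl; exact hs rfl
        simpa [Expr.subst, hne] using this
      | _ => exact this
  | lit c => exact .lit c
  | cat _ _ ih₁ ih₂ => exact .cat ih₁ ih₂
  | arith op _ _ ih₁ ih₂ => exact .arith op ih₁ ih₂
  | mset _ ih =>
    rw [Expr.subst, Expr.substList_eq_map]
    exact .mset (List.forall_mem_map.2 ih)

theorem forall₂_exprTy_subst {α : Type*} (h : Env.SubstTo Sch s Γ Γ₂) {es : List (Expr S)}
    {l : List α} {ty : α → MTy} (hes : List.Forall₂ (fun e a => ExprTy Γ e (ty a)) es l) :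
    List.Forall₂ (fun e a => ExprTy Γ₂ e (ty a)) (Expr.substList s es) l := by
  rw [Expr.substList_eq_map, List.forall₂_map_left_iff]
  exact hes.imp fun _ _ he => he.subst h

theorem TupleTy.subst (h : Env.SubstTo Sch s Γ Γ₂) {t : Tuple S} {sk : Schema}
    (ht : TupleTy Γ t sk) : TupleTy Γ₂ (t.subst s) sk :=
  forall₂_exprTy_subst (ty := id) h ht

theorem PredTy.subst (h : Env.SubstTo Sch s Γ Γ₂) {ψ : Pred S} (hψ : PredTy Γ ψ) :
    PredTy Γ₂ (ψ.subst s) := by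
  induction hψ with
  | tru => exact .tru
  | cmp op h₁ h₂ => exact .cmp op (h₁.subst h) (h₂.subst h)
  | mem h₁ h₂ => exact .mem (h₁.subst h) (h₂.subst h)
  | neg _ ih => exact .neg ih
  | conj _ _ ih₁ ih₂ => exact .conj ih₁ ih₂

theorem LRefTy.subst (h : Env.SubstTo Sch s Γ Γ₂) {l : LRef S} (hl : LRefTy Γ l) :
    LRefTy Γ₂ (l.subst s) := by
  have key : (l.subst s).toExpr = l.toExpr.subst s := by
    cases l with
    | const l => rfl
    | var u =>
      cases s with
      | loc u' l => by_cases hu : u' = u <;> simp [LRef.subst, LRef.toExpr, Expr.subst, hu]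
      | _ => rfl
  rw [LRefTy, key]
  exact ExprTy.subst h hl

theorem TBTy.subst (h : Env.SubstTo Sch s Γ Γ₂) {tb : TB S} {sk : Schema}
    (htb : TBTy Sch Γ tb sk) : TBTy Sch Γ₂ (tb.subst s) sk := by
  cases htb with
  | ref hl hi => exact .ref (hl.subst h) hi
  | @var b sk hb =>
    by_cases hs : (Binding.tabv b sk).name = s.name
    · cases h.assign _ hs hb with
      | tab _ ht => simpa [TB.subst, tbTy_conc_iff] using ht
    · have : TBTy Sch Γ₂ (.var b) sk := .var ((h.agree _ hs).1 hb)
      cases s with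
      | tab y tb =>
        have hne : y ≠ b := by rintro rfl; exact hs rfl
        simpa [TB.subst, hne] using this
      | _ => exact this
  | conc h₁ h₂ => exact .conc (by simpa only [rowTy_iff] using h₁) h₂

/-- Substitution in the scope of a binder, which blocks it if it binds the same variable. -/
theorem PredTy.subst_scope (h : Env.SubstTo Sch s Γ Γ₂) {A : Set (Name S)} (hA : Γ₁.dom = A)
    {ψ : Pred S} (hψ : PredTy (Γ₁ ++ Γ) ψ) :
    PredTy (Γ₁ ++ Γ₂) (if s.name ∈ A then ψ else ψ.subst s) := by
  subst hA
  split_ifs with hs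
  · exact (predTy_congr fun b _ => h.append_of_mem hs b).1 hψ
  · exact hψ.subst (h.append_of_notMem hs)

theorem TupleTy.subst_scope (h : Env.SubstTo Sch s Γ Γ₂) {A : Set (Name S)} (hA : Γ₁.dom = A)
    {t : Tuple S} {sk : Schema} (ht : TupleTy (Γ₁ ++ Γ) t sk) :
    TupleTy (Γ₁ ++ Γ₂) (if s.name ∈ A then t else t.subst s) sk := by
  subst hA
  split_ifs with hs
  · exact (tupleTy_congr fun b _ => h.append_of_mem hs b).1 ht
  · exact ht.subst (h.append_of_notMem hs)

variable (Δ : Defns S) (H : Set S.PName)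

mutual

theorem actTy_subst (a : Act S) {Γ Γ₂ Γ' : Env S} (h : Env.SubstTo Sch s Γ Γ₂)
    (ha : ActTy Δ Sch H Γ a Γ') : ActTy Δ Sch H Γ₂ (a.subst s) Γ' := by
  cases a with
  | ins i t l =>
    obtain ⟨rfl, hl, _, hi, ht⟩ := actTy_ins_iff.1 ha
    exact .ins hi (ht.subst h) (hl.subst h)
  | del i T ψ l =>
    obtain ⟨rfl, hl, _, hi, _, hT, hψ⟩ := actTy_del_iff.1 ha
    exact .del hi hT (hψ.subst_scope h hT.dom_eq) (hl.subst h)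
  | sel tbs T ψ t b =>
    obtain ⟨_, rfl, sks, htbs, _, hT, hψ, ht⟩ := actTy_sel_iff.1 ha
    exact .sel (List.forall₂_map_left_iff.2 (htbs.imp fun _ _ h' => h'.subst h)) hT
      (hψ.subst_scope h hT.dom_eq) (ht.subst_scope h hT.dom_eq)
  | upd i T ψ t l =>
    obtain ⟨rfl, hl, _, hi, _, hT, hψ, ht⟩ := actTy_upd_iff.1 ha
    exact .upd hi hT (hψ.subst_scope h hT.dom_eq) (ht.subst_scope h hT.dom_eq) (hl.subst h)
  | aggr i T ψ f T' l =>
    obtain ⟨hT', hl, hi, _, hT, hψ⟩ := actTy_aggr_iff.1 ha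
    exact .aggr hi hT (hψ.subst_scope h hT.dom_eq) hT' (hl.subst h)
  | create i l sk =>
    obtain ⟨rfl, hl, hi⟩ := actTy_create_iff.1 ha
    exact .create hi (hl.subst h)
  | drop i l =>
    obtain ⟨rfl, hl⟩ := actTy_drop_iff.1 ha
    exact .drop (hl.subst h)
  | spawn P l =>
    obtain ⟨rfl, hl, hP⟩ := actTy_spawn_iff.1 ha
    exact .spawn (procTy_subst P h hP) (hl.subst h)

/-- The substitution lemma for processes. -/
theorem procTy_subst (P : Proc S) {Γ Γ₂ : Env S} (h : Env.SubstTo Sch s Γ Γ₂)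
    (hP : ProcTy Δ Sch H Γ P) : ProcTy Δ Sch H Γ₂ (P.subst s) := by
  cases P with
  | nil => exact .nil _
  | pref a P =>
    obtain ⟨Γ', ha, hP⟩ := procTy_pref_iff.1 hP
    refine .pref (actTy_subst a h ha) ?_
    rw [← ha.dom_eq]
    split_ifs with hs
    · exact (procTy_congr fun b _ => h.append_of_mem hs b).1 hP
    · exact procTy_subst P (h.append_of_notMem hs) hP
  | call A es =>
    obtain ⟨D, hD, hb, hes⟩ := procTy_call_iff.1 hP
    exact procTy_call_iff.2 ⟨D, hD, hb, forall₂_exprTy_subst h hes⟩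
  | foreach tb T ψ o P =>
    obtain ⟨sk, htb, Γ₁, hT, hψ, hP⟩ := procTy_foreach_iff.1 hP
    refine .foreach (htb.subst h) hT (hψ.subst_scope h hT.dom_eq) ?_
    rw [← hT.dom_eq]
    split_ifs with hs
    · exact (procTy_congr fun b _ => h.append_of_mem hs b).1 hP
    · exact procTy_subst P (h.append_of_notMem hs) hP
  | seq P₁ P₂ =>
    obtain ⟨h₁, h₂⟩ := procTy_seq_iff.1 hP
    exact .seq (procTy_subst P₁ h h₁) (procTy_subst P₂ h h₂)

end

variable {Δ H}

/-- Composite substitutions are typed by environments. The head of the list is both the first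
substitution and the most recent binding, so linearity of the environment is not needed. -/
theorem ProcTy.substs {σ : Subst S} (h : List.Forall₂ (AssignTy Sch) σ Γ₁) {P : Proc S}
    (hP : ProcTy Δ Sch H (Γ₁ ++ Γ) P) : ProcTy Δ Sch H Γ (P.substs σ) := by
  induction h generalizing P with
  | nil => exact hP
  | cons hs _ ih => exact ih (procTy_subst Δ H P (hs.substTo _) hP)

theorem PredTy.substs {σ : Subst S} (h : List.Forall₂ (AssignTy Sch) σ Γ₁) {ψ : Pred S}
    (hψ : PredTy (Γ₁ ++ Γ) ψ) : PredTy Γ (ψ.substs σ) := by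
  induction h generalizing ψ with
  | nil => exact hψ
  | cons hs _ ih => exact ih (hψ.subst (hs.substTo _))

theorem TupleTy.substs {σ : Subst S} (h : List.Forall₂ (AssignTy Sch) σ Γ₁) {t : Tuple S}
    {sk : Schema} (ht : TupleTy (Γ₁ ++ Γ) t sk) : TupleTy Γ (t.substs σ) sk := by
  induction h generalizing t with
  | nil => exact ht
  | cons hs _ ih => exact ih (ht.subst (hs.substTo _))

end

/-! ### Evaluation of well-typed closed terms -/

theorem Val.HasSort.exists_lit {v : Val S} {d : DTy} (h : v.HasSort (.data d)) :
    ∃ c : Lit S, v = .lit c ∧ c.sort = d := by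
  cases v with
  | lit c => exact ⟨c, rfl, h⟩
  | mset s => exact h.elim

theorem Val.HasSort.exists_mset {v : Val S} {d : DTy} (h : v.HasSort (.mset d)) :
    ∃ s : Multiset (Lit S), v = .mset s ∧ ∀ c ∈ s, c.sort = d := by
  cases v with
  | lit c => exact h.elim
  | mset s => exact ⟨s, rfl, h⟩

theorem Lit.exists_num {c : Lit S} (h : c.sort = .int) : ∃ n, c = .num n := by
  cases c <;> simp_all [Lit.sort]

theorem Lit.exists_str {c : Lit S} (h : c.sort = .str) : ∃ s, c = .str s := by
  cases c <;> simp_all [Lit.sort]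

theorem Expr.evalLits_of_forall {es : List (Expr S)} {d : DTy}
    (h : ∀ e ∈ es, ∃ v, e.eval = some v ∧ v.HasSort (.data d)) :
    ∃ cs, Expr.evalLits es = some cs ∧ ∀ c ∈ cs, c.sort = d := by
  induction es with
  | nil => exact ⟨[], by simp [Expr.evalLits]⟩
  | cons e es ih =>
    obtain ⟨v, hv, hs⟩ := h e (by simp)
    obtain ⟨c, rfl, hc⟩ := hs.exists_lit
    obtain ⟨cs, hcs, hs⟩ := ih fun e he => h e (by simp [he])
    exact ⟨c :: cs, by simp [Expr.evalLits, hv, hcs], by simpa [hc] using hs⟩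

/-- Well-typed expressions without variables evaluate to values of their type. -/
theorem ExprTy.exists_eval {e : Expr S} {τ : MTy} (h : ExprTy [] e τ) :
    ∃ v, e.eval = some v ∧ v.HasSort τ := by
  induction h with
  | dvar h => exact (binds_nil h).elim
  | lvar h => exact (binds_nil h).elim
  | lit c => exact ⟨.lit c, by simp [Expr.eval], rfl⟩
  | cat _ _ ih₁ ih₂ =>
    obtain ⟨v₁, h₁, hs₁⟩ := ih₁
    obtain ⟨v₂, h₂, hs₂⟩ := ih₂
    obtain ⟨c₁, rfl, hc₁⟩ := hs₁.exists_lit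
    obtain ⟨c₂, rfl, hc₂⟩ := hs₂.exists_lit
    obtain ⟨s₁, rfl⟩ := Lit.exists_str hc₁
    obtain ⟨s₂, rfl⟩ := Lit.exists_str hc₂
    exact ⟨.lit (.str (s₁ ++ s₂)), by simp [Expr.eval, h₁, h₂], rfl⟩
  | arith op _ _ ih₁ ih₂ =>
    obtain ⟨v₁, h₁, hs₁⟩ := ih₁
    obtain ⟨v₂, h₂, hs₂⟩ := ih₂
    obtain ⟨c₁, rfl, hc₁⟩ := hs₁.exists_lit
    obtain ⟨c₂, rfl, hc₂⟩ := hs₂.exists_lit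
    obtain ⟨n₁, rfl⟩ := Lit.exists_num hc₁
    obtain ⟨n₂, rfl⟩ := Lit.exists_num hc₂
    exact ⟨.lit (.num (op.eval n₁ n₂)), by simp [Expr.eval, h₁, h₂], rfl⟩
  | @mset es d _ ih =>
    obtain ⟨cs, hcs, hs⟩ := Expr.evalLits_of_forall ih
    have hex : ∃ d : DTy, ∀ c ∈ cs, c.sort = d := ⟨d, hs⟩
    refine ⟨.mset cs, ?_, fun c hc => hs c hc⟩
    simp only [Expr.eval, hcs, if_pos hex]

theorem forall₂_exists_evalAll {α : Type*} {es : List (Expr S)} {l : List α} {ty : α → MTy}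
    (h : List.Forall₂ (fun e a => ExprTy [] e (ty a)) es l) :
    ∃ r, evalAll es = some r ∧ List.Forall₂ (fun v a => v.HasSort (ty a)) r l := by
  induction h with
  | nil => exact ⟨[], rfl, .nil⟩
  | cons h _ ih =>
    obtain ⟨v, hv, hs⟩ := h.exists_eval
    obtain ⟨r, hr, hsr⟩ := ih
    exact ⟨v :: r, by simp [evalAll, hv, hr], .cons hs hsr⟩

theorem TupleTy.exists_eval {t : Tuple S} {sk : Schema} (h : TupleTy [] t sk) :
    ∃ r, t.eval = some r ∧ Row.HasSchema r sk :=
  forall₂_exists_evalAll (ty := id) h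

theorem PredTy.exists_eval {ψ : Pred S} (h : PredTy [] ψ) : ∃ b, ψ.eval = some b := by
  induction h with
  | tru => exact ⟨true, rfl⟩
  | cmp op h₁ h₂ =>
    obtain ⟨v₁, h₁, hs₁⟩ := h₁.exists_eval
    obtain ⟨v₂, h₂, hs₂⟩ := h₂.exists_eval
    obtain ⟨c₁, rfl, hc₁⟩ := hs₁.exists_lit
    obtain ⟨c₂, rfl, hc₂⟩ := hs₂.exists_lit
    exact ⟨op.eval c₁ c₂, by simp only [Pred.eval, h₁, h₂, if_pos (hc₁.trans hc₂.symm)]⟩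
  | mem h₁ h₂ =>
    obtain ⟨v₁, h₁, hs₁⟩ := h₁.exists_eval
    obtain ⟨v₂, h₂, hs₂⟩ := h₂.exists_eval
    obtain ⟨c, rfl, hc⟩ := hs₁.exists_lit
    obtain ⟨s, rfl, hs⟩ := hs₂.exists_mset
    have : ∀ c' ∈ s, c'.sort = c.sort := fun c' h' => (hs c' h').trans hc.symm
    exact ⟨decide (c ∈ s), by simp only [Pred.eval, h₁, h₂, if_pos this]⟩
  | neg _ ih =>
    obtain ⟨b, hb⟩ := ih
    exact ⟨!b, by simp [Pred.eval, hb]⟩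
  | conj _ _ ih₁ ih₂ =>
    obtain ⟨b₁, h₁⟩ := ih₁
    obtain ⟨b₂, h₂⟩ := ih₂
    exact ⟨b₁ && b₂, by simp [Pred.eval, h₁, h₂]⟩

/-! ### Matching and parameter passing -/

theorem FieldTy.exists_bind {Sch : Schemas S} {τ : MTy} {w : Field S} {b : Binding S}
    (h : FieldTy τ w b) {v : Val S} (hv : v.HasSort τ) :
    ∃ s, w.bind v = some s ∧ AssignTy Sch s b := by
  cases h with
  | @data x _ hτ =>
    cases v with
    | lit c =>
      have : Field.bind (.data x) (.lit c) = some (.data x (.lit c)) := by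
        cases c with
        | loc l =>
          -- A data field does not match a locality, but its type is not `Loc`.
          cases τ with
          | data d => exact absurd (congrArg MTy.data (Eq.symm hv)) hτ
          | mset d => exact hv.elim
        | _ => rfl
      exact ⟨_, this, .data x hv⟩
    | mset s =>
      cases τ with
      | data d => exact hv.elim
      | mset d =>
        have hex : ∃ d : DTy, ∀ c ∈ s, c.sort = d := ⟨d, hv⟩
        exact ⟨_, by simp only [Field.bind, if_pos hex], .data x hv⟩
  | loc u =>
    obtain ⟨c, rfl, hc⟩ := hv.exists_lit
    cases c with
    | loc l => exact ⟨_, rfl, .loc u l⟩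
    | _ => cases hc

theorem FieldsTy.exists_bind {Sch : Schemas S} {sk : Schema} {ws : List (Field S)} {Γ : Env S}
    (h : FieldsTy sk ws Γ) {r : Row S} (hr : r.HasSchema sk) :
    ∃ σ, bindFields ws r = some σ ∧ List.Forall₂ (AssignTy Sch) σ Γ := by
  induction h generalizing r with
  | nil => cases hr; exact ⟨[], rfl, .nil⟩
  | cons hw _ ih =>
    cases hr with
    | cons hv hr =>
      obtain ⟨s, hs, hsb⟩ := hw.exists_bind hv
      obtain ⟨σ, hσ, hσΓ⟩ := ih hr
      exact ⟨s :: σ, by simp [bindFields, hs, hσ], .cons hsb hσΓ⟩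

theorem FieldsTy.hasSort {sk : Schema} {ws : List (Field S)} {Γ : Env S}
    (h : FieldsTy sk ws Γ) : List.Forall₂ Field.HasSort ws sk := by
  induction h with
  | nil => exact .nil
  | cons hw _ ih => exact .cons (by cases hw <;> first | assumption | rfl) ih

section Template

variable {sk sk' : Schema} {T : Template S} {Γ : Env S} {r : Row S} {ψ : Pred S} {t : Tuple S}

theorem TemplateTy.hasSchema (h : TemplateTy sk T Γ) : T.HasSchema sk := FieldsTy.hasSort h

theorem TemplateTy.exists_bind {Sch : Schemas S} (h : TemplateTy sk T Γ) (hr : r.HasSchema sk) :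
    ∃ σ, T.bind r = some σ ∧ List.Forall₂ (AssignTy Sch) σ Γ := FieldsTy.exists_bind h hr

/-- The match of a well-typed row is a well-typed substitution. -/
theorem TemplateTy.assignTy_of_bind {Sch : Schemas S} {σ : Subst S} (h : TemplateTy sk T Γ)
    (hr : r.HasSchema sk) (hσ : T.bind r = some σ) : List.Forall₂ (AssignTy Sch) σ Γ := by
  obtain ⟨σ', hσ', h'⟩ := h.exists_bind (Sch := Sch) hr
  obtain rfl := Option.some.inj (hσ.symm.trans hσ')
  exact h'

theorem TemplateTy.evalAt_pred_ne_none (h : TemplateTy sk T Γ) (hψ : PredTy (Γ ++ []) ψ)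
    (hr : r.HasSchema sk) : ψ.evalAt T r ≠ none := by
  -- Rows contain no tables, so any assignment of schemas will do.
  obtain ⟨σ, hσ, hσΓ⟩ := h.exists_bind (Sch := fun _ => none) hr
  obtain ⟨b, hb⟩ := (hψ.substs hσΓ).exists_eval
  simp [Pred.evalAt, hσ, hb]

theorem TemplateTy.exists_evalAt_tuple (h : TemplateTy sk T Γ) (ht : TupleTy (Γ ++ []) t sk')
    (hr : r.HasSchema sk) : ∃ r', t.evalAt T r = some r' ∧ Row.HasSchema r' sk' := by
  obtain ⟨σ, hσ, hσΓ⟩ := h.exists_bind (Sch := fun _ => none) hr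
  obtain ⟨r', hr', hs⟩ := (ht.substs hσΓ).exists_eval
  exact ⟨r', by simp [Tuple.evalAt, hσ, hr'], hs⟩

theorem TemplateTy.evalAt_tuple_ne_none (h : TemplateTy sk T Γ) (ht : TupleTy (Γ ++ []) t sk')
    (hr : r.HasSchema sk) : t.evalAt T r ≠ none := by
  obtain ⟨r', hr', _⟩ := h.exists_evalAt_tuple ht hr
  simp [hr']

theorem TemplateTy.hasSchema_of_evalAt {r' : Row S} (h : TemplateTy sk T Γ)
    (ht : TupleTy (Γ ++ []) t sk') (hr : r.HasSchema sk) (hr' : t.evalAt T r = some r') :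
    Row.HasSchema r' sk' := by
  obtain ⟨r'', h'', hs⟩ := h.exists_evalAt_tuple ht hr
  obtain rfl := Option.some.inj (hr'.symm.trans h'')
  exact hs

end Template

theorem bindParams_assignTy {Sch : Schemas S} {ps : List (Param S)} {r : Row S} {σ : Subst S}
    (h : bindParams ps r = some σ) (hr : List.Forall₂ (fun v p => v.HasSort (Param.ty p)) r ps) :
    List.Forall₂ (AssignTy Sch) σ (ps.map Param.binding) := by
  induction hr generalizing σ with
  | nil => cases h; exact .nil
  | @cons v p r ps hv _ ih =>
    rw [bindParams] at h
    split at h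
    next s σ' hs hσ' =>
      cases h
      refine .cons ?_ (ih hσ')
      cases p with
      | data x τ => cases hs; exact .data x hv
      | loc u =>
        obtain ⟨c, rfl, hc⟩ := hv.exists_lit
        cases c with
        | loc l => cases hs; exact .loc u l
        | _ => cases hc
    next => cases h

/-! ### Projection and products -/

/-- Both lookups take the first field for the variable, so linearity of the template is not
needed. -/
theorem fieldTy_eq_of_binds {sk : Schema} {ws : List (Field S)} {Γ₁ Γ : Env S}
    (h : FieldsTy sk ws Γ₁) {x : S.DVar} {τ τ' : MTy} (hb : Env.Binds (Γ₁ ++ Γ) (.data x τ))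
    (hτ' : fieldTy (.data x) ws sk = some τ') : τ' = τ := by
  induction h with
  | nil => cases hτ'
  | @cons τ₀ sk w ws b Γ₁ hw _ ih =>
    rw [fieldTy] at hτ'
    rw [List.cons_append, binds_cons, hw.name_eq] at hb
    split_ifs at hτ' with hn
    · rcases hb with rfl | ⟨hne, _⟩
      · cases hw; exact (Option.some.inj hτ').symm
      · exact absurd hn hne
    · refine ih (hb.resolve_left ?_).2 hτ'
      rintro rfl
      exact hn hw.name_eq.symm

theorem fieldTy_locv {sk : Schema} {ws : List (Field S)} {Γ₁ : Env S}
    (h : FieldsTy sk ws Γ₁) {u : S.LVar} {τ : MTy} (hτ : fieldTy (.locv u) ws sk = some τ) :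
    τ = .data .loc := by
  induction h with
  | nil => cases hτ
  | @cons τ₀ sk w ws b Γ₁ hw _ ih =>
    rw [fieldTy] at hτ
    split_ifs at hτ with hn
    · cases hw with
      | data => cases hn
      | loc => exact (Option.some.inj hτ).symm
    · exact ih hτ

theorem constTy_eq {Γ : Env S} {e : Expr S} {τ τ' : MTy} (h : ExprTy Γ e τ)
    (h' : e.constTy = some τ') : τ' = τ := by
  cases h with
  | lit c => cases h'; rfl
  | @mset es d h =>
    rcases es with _ | ⟨e, es⟩
    · cases h'
    · cases e with
      | lit c =>
        rw [Expr.constTy] at h'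
        split_ifs at h'
        have := exprTy_lit_iff.1 (h (.lit c) (by simp))
        cases this
        exact (Option.some.inj h').symm
      | _ => cases h'
  | _ => cases h'

theorem projComp_eq {sk : Schema} {T : Template S} {Γ₁ Γ : Env S} (hT : TemplateTy sk T Γ₁)
    {e : Expr S} {τ τ' : MTy} (h : ExprTy (Γ₁ ++ Γ) e τ) (h' : projComp sk T e = some τ') :
    τ' = τ := by
  cases e with
  | dvar x => exact fieldTy_eq_of_binds hT (exprTy_dvar_iff.1 h).1 h'
  | lvar u => rw [(exprTy_lvar_iff.1 h).2]; exact fieldTy_locv hT h'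
  | _ => exact constTy_eq h h'

/-- Where the projection is defined, it is the only type of the tuple. -/
theorem projSk_eq {sk : Schema} {T : Template S} {Γ₁ Γ : Env S} (hT : TemplateTy sk T Γ₁)
    {t : Tuple S} {sk' sk'' : Schema} (h : TupleTy (Γ₁ ++ Γ) t sk')
    (h' : projSk sk T t = some sk'') : sk'' = sk' := by
  rw [projSk] at h'
  split_ifs at h'
  rw [TupleTy, ExprsTy] at h
  generalize t.comps = es at h h'
  induction h generalizing sk'' with
  | nil => cases h'; rfl
  | cons he _ ih =>
    rw [projComps] at h'
    split at h'
    next τ sk₀ hτ hsk =>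
      cases h'
      rw [projComp_eq hT he hτ, ih hsk]
    next => cases h'

theorem hasSchema_of_mem_prodRows {Rs : List (Multiset (Row S))} {sks : List Schema}
    (h : List.Forall₂ (fun R sk => ∀ r ∈ R, Row.HasSchema r sk) Rs sks) {r : Row S}
    (hr : r ∈ prodRows Rs) : r.HasSchema sks.flatten := by
  induction h generalizing r with
  | nil =>
    obtain rfl : r = [] := by simpa [prodRows] using hr
    exact .nil
  | cons hR _ ih =>
    simp only [prodRows, Multiset.mem_bind, Multiset.mem_map] at hr
    obtain ⟨r₁, h₁, r₂, h₂, rfl⟩ := hr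
    exact List.rel_append (hR r₁ h₁) (ih h₂)

section

variable {Sch : Schemas S} {ls : List (S.Loc × Table S)}

/-- The rows of a concrete table have its schema, which is the declared one for its identifier. -/
def Table.Ok (Sch : Schemas S) (tb : Table S) : Prop :=
  (∀ r ∈ tb.R, Row.HasSchema r tb.I.sk) ∧ ∃ i, tb.I.tid = some i ∧ Sch i = some tb.I.sk

theorem TBTy.of_resolve (hls : ∀ p ∈ ls, Table.Ok Sch p.2) {tb : TB S} {sk : Schema}
    (h : TBTy Sch [] tb sk) {tb' : Table S} (h' : tb.resolve ls = some tb') :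
    tb'.I.sk = sk ∧ ∀ r ∈ tb'.R, Row.HasSchema r sk := by
  cases tb with
  | ref i l =>
    cases l with
    | const l =>
      simp only [TB.resolve, Option.map_eq_some_iff] at h'
      obtain ⟨p, hp, rfl⟩ := h'
      obtain ⟨hR, j, hj, hsk⟩ := hls p (List.mem_of_find?_eq_some hp)
      have hi : p.2.I.tid = some i := by
        have := List.find?_some hp
        simp only [decide_eq_true_eq] at this
        exact this.2
      obtain rfl := Option.some.inj (hj.symm.trans hi)
      obtain rfl := Option.some.inj (hsk.symm.trans (tbTy_ref_iff.1 h).2)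
      exact ⟨rfl, hR⟩
    | var u => cases h'
  | var b => cases h'
  | conc tb =>
    cases h'
    obtain ⟨rfl, hR, _⟩ := tbTy_conc_iff.1 h
    exact ⟨rfl, hR⟩

theorem forall₂_of_resolveAll (hls : ∀ p ∈ ls, Table.Ok Sch p.2) {tbs : List (TB S)}
    {sks : List Schema} (h : List.Forall₂ (TBTy Sch []) tbs sks) {ts : List (Table S)}
    (h' : resolveAll ls tbs = some ts) :
    List.Forall₂ (fun (tb : Table S) sk => tb.I.sk = sk ∧ ∀ r ∈ tb.R, Row.HasSchema r sk)
      ts sks := by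
  induction h generalizing ts with
  | nil => cases h'; exact .nil
  | cons ht _ ih =>
    rw [resolveAll] at h'
    split at h'
    next t ts' htb hts =>
      cases h'
      exact .cons (ht.of_resolve hls htb) (ih hts)
    next => cases h'

theorem prodSk_eq (hls : ∀ p ∈ ls, Table.Ok Sch p.2) {tbs : List (TB S)}
    {sks : List Schema} (h : List.Forall₂ (TBTy Sch []) tbs sks) {sk : Schema}
    (h' : prodSk tbs ls = some sk) : sk = sks.flatten := by
  simp only [prodSk, Option.map_eq_some_iff] at h'
  obtain ⟨ts, hts, rfl⟩ := h'
  congr 1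
  have := (forall₂_of_resolveAll hls h hts).imp fun _ _ h => h.1
  rwa [← List.forall₂_eq_eq_eq, List.forall₂_map_left_iff]

theorem hasSchema_of_mem_prodR (hls : ∀ p ∈ ls, Table.Ok Sch p.2) {tbs : List (TB S)}
    {sks : List Schema} (h : List.Forall₂ (TBTy Sch []) tbs sks) {R : Multiset (Row S)}
    (h' : prodR tbs ls = some R) {r : Row S} (hr : r ∈ R) : r.HasSchema sks.flatten := by
  simp only [prodR, Option.map_eq_some_iff] at h'
  obtain ⟨ts, hts, rfl⟩ := h'
  refine hasSchema_of_mem_prodRows ?_ hr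
  rw [List.forall₂_map_left_iff]
  exact (forall₂_of_resolveAll hls h hts).imp fun _ _ h => h.2

end

/-! ### Subject reduction -/

section

variable {Δ : Defns S} {Sch : Schemas S} {H : Set S.PName} {Γ : Env S}

theorem netTy_proc_iff {l : S.Loc} {P : Proc S} :
    NetTy Δ Sch H Γ (.node l (.proc P)) ↔ ProcTy Δ Sch H Γ P :=
  netTy_node_iff.trans compTy_proc_iff

theorem netTy_table_iff {l : S.Loc} {tb : Table S} :
    NetTy Δ Sch H Γ (.node l (.table tb)) ↔ tb.Ok Sch :=
  netTy_node_iff.trans compTy_table_iff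

theorem netTy_withTables_iff {N : Net S} {ls : List (S.Loc × Table S)} :
    NetTy Δ Sch H Γ (N.withTables ls) ↔ NetTy Δ Sch H Γ N ∧ ∀ p ∈ ls, Table.Ok Sch p.2 := by
  induction ls generalizing N with
  | nil => simp [Net.withTables]
  | cons p ls ih =>
    rw [Net.withTables, List.foldl_cons, ← Net.withTables, ih, netTy_par_iff, netTy_table_iff,
      List.forall_mem_cons, and_assoc]

theorem Table.Ok.schema_eq {tb : Table S} {i : S.TId} {sk : Schema} (h : tb.Ok Sch)
    (hi : tb.I.tid = some i) (hsk : Sch i = some sk) : tb.I.sk = sk := by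
  obtain ⟨_, j, hj, h⟩ := h
  obtain rfl := Option.some.inj (hj.symm.trans hi)
  exact Option.some.inj (h.symm.trans hsk)

/-- Subject reduction in the empty environment. The error transitions are included: no net that is
well typed in the empty environment has one, since rows match the templates for their schema and
well-typed terms without variables evaluate. -/
theorem Step.netTy (hH : ∀ A ∈ H, ∃ D, Δ A = some D ∧ ProcTy Δ Sch H D.env D.body)
    {Nenv N N' : Net S} (h : Step Δ Nenv N N') (hN : NetTy Δ Sch H [] N) :
    NetTy Δ Sch H [] N' := by
  induction h with
  | ins_err _ l₁ l₂ i t P tb hi hbad =>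
    simp only [netTy_par_iff, netTy_proc_iff, netTy_table_iff, procTy_pref_iff] at hN
    obtain ⟨⟨_, ha, _⟩, htb⟩ := hN
    obtain ⟨_, _, sk, hsk, ht⟩ := actTy_ins_iff.1 ha
    obtain rfl := htb.schema_eq hi hsk
    exact absurd ht.exists_eval hbad
  | ins _ l₁ l₂ i t P tb r hi hr hrs =>
    simp only [netTy_par_iff, netTy_proc_iff, netTy_table_iff, procTy_pref_iff] at hN ⊢
    obtain ⟨⟨_, ha, hP⟩, htb⟩ := hN
    obtain ⟨rfl, _⟩ := actTy_ins_iff.1 ha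
    refine ⟨hP, fun r' hr' => ?_, htb.2⟩
    rcases Multiset.mem_add.1 hr' with h | h
    · exact htb.1 r' h
    · obtain rfl := Multiset.mem_singleton.1 h
      exact hrs
  | del_err _ l₁ l₂ i T ψ P tb hi hbad =>
    simp only [netTy_par_iff, netTy_proc_iff, netTy_table_iff, procTy_pref_iff] at hN
    obtain ⟨⟨_, ha, _⟩, htb⟩ := hN
    obtain ⟨_, _, sk, hsk, Γ₁, hT, hψ⟩ := actTy_del_iff.1 ha
    obtain rfl := htb.schema_eq hi hsk
    rcases hbad with hbad | ⟨r, hr, hbad⟩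
    · exact absurd hT.hasSchema hbad
    · exact absurd hbad (hT.evalAt_pred_ne_none hψ (htb.1 r hr))
  | del _ l₁ l₂ i T ψ P tb hi _ =>
    simp only [netTy_par_iff, netTy_proc_iff, netTy_table_iff, procTy_pref_iff] at hN ⊢
    obtain ⟨⟨_, ha, hP⟩, htb⟩ := hN
    obtain ⟨rfl, _⟩ := actTy_del_iff.1 ha
    exact ⟨hP, fun r hr => htb.1 r (Multiset.mem_filter.1 hr).1, htb.2⟩
  | sel_err _ l₀ tbs T ψ t b P ls sk R _ hsk hR hbad =>
    simp only [netTy_withTables_iff, netTy_proc_iff, procTy_pref_iff] at hN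
    obtain ⟨⟨_, ha, _⟩, hls⟩ := hN
    obtain ⟨sk', rfl, sks, htbs, Γ₁, hT, hψ, ht⟩ := actTy_sel_iff.1 ha
    obtain rfl := prodSk_eq hls htbs hsk
    rcases hbad with hbad | ⟨r, hr, hbad⟩
    · exact absurd hT.hasSchema hbad
    · have hr := hasSchema_of_mem_prodR hls htbs hR hr
      exact hbad.elim (fun h => absurd h (hT.evalAt_pred_ne_none hψ hr))
        fun h => absurd h (hT.evalAt_tuple_ne_none ht hr)
  | sel _ l₀ tbs T ψ t b P ls sk sk₀ R _ hsk hR _ hproj =>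
    simp only [netTy_withTables_iff, netTy_proc_iff, procTy_pref_iff] at hN ⊢
    obtain ⟨⟨_, ha, hP⟩, hls⟩ := hN
    obtain ⟨sk', rfl, sks, htbs, Γ₁, hT, hψ, ht⟩ := actTy_sel_iff.1 ha
    obtain rfl := prodSk_eq hls htbs hsk
    obtain rfl := projSk_eq hT ht hproj
    refine ⟨procTy_subst Δ H P (AssignTy.substTo (.tab b ?_) []) hP, hls⟩
    refine tbTy_conc_iff.2 ⟨rfl, fun r' hr' => ?_, fun i hi => nomatch hi⟩
    obtain ⟨r, hr, hr'⟩ := (Multiset.mem_filterMap _ _).1 hr'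
    exact hT.hasSchema_of_evalAt ht
      (hasSchema_of_mem_prodR hls htbs hR (Multiset.mem_filter.1 hr).1) hr'
  | upd_err _ l₁ l₂ i T ψ t P tb hi hbad =>
    simp only [netTy_par_iff, netTy_proc_iff, netTy_table_iff, procTy_pref_iff] at hN
    obtain ⟨⟨_, ha, _⟩, htb⟩ := hN
    obtain ⟨_, _, sk, hsk, Γ₁, hT, hψ, ht⟩ := actTy_upd_iff.1 ha
    obtain rfl := htb.schema_eq hi hsk
    rcases hbad with hbad | ⟨r, hr, hbad | hbad | ⟨_, r', hr', hbad⟩⟩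
    · exact absurd hT.hasSchema hbad
    · exact absurd hbad (hT.evalAt_pred_ne_none hψ (htb.1 r hr))
    · exact absurd hbad (hT.evalAt_tuple_ne_none ht (htb.1 r hr))
    · exact absurd (hT.hasSchema_of_evalAt ht (htb.1 r hr) hr') hbad
  | upd _ l₁ l₂ i T ψ t P tb hi _ =>
    simp only [netTy_par_iff, netTy_proc_iff, netTy_table_iff, procTy_pref_iff] at hN ⊢
    obtain ⟨⟨_, ha, hP⟩, htb⟩ := hN
    obtain ⟨rfl, _, sk, hsk, Γ₁, hT, hψ, ht⟩ := actTy_upd_iff.1 ha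
    obtain rfl := htb.schema_eq hi hsk
    refine ⟨hP, fun r' hr' => ?_, htb.2⟩
    rcases Multiset.mem_add.1 hr' with h | h
    · exact htb.1 r' (Multiset.mem_filter.1 h).1
    · obtain ⟨r, hr, hr'⟩ := (Multiset.mem_filterMap _ _).1 h
      exact hT.hasSchema_of_evalAt ht (htb.1 r (Multiset.mem_filter.1 hr).1) hr'
  | aggr_err _ l₁ l₂ i T ψ f T' P tb hi hbad =>
    simp only [netTy_par_iff, netTy_proc_iff, netTy_table_iff, procTy_pref_iff] at hN
    obtain ⟨⟨_, ha, _⟩, htb⟩ := hN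
    obtain ⟨hT', _, hsk, Γ₁, hT, hψ⟩ := actTy_aggr_iff.1 ha
    have hdom := htb.schema_eq hi hsk
    have hR : ∀ r ∈ tb.R, Row.HasSchema r f.dom := hdom ▸ htb.1
    rcases hbad with hbad | ⟨r, hr, hbad | hbad | hbad⟩
    · exact absurd (hdom ▸ hT.hasSchema) hbad
    · exact absurd hbad (hT.evalAt_pred_ne_none hψ (hR r hr))
    · exact absurd (hR r hr) hbad
    · exact absurd hT'.hasSchema hbad
  | aggr _ l₁ l₂ i T ψ f T' P tb σ hi _ hσ =>
    simp only [netTy_par_iff, netTy_proc_iff, netTy_table_iff, procTy_pref_iff] at hN ⊢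
    obtain ⟨⟨_, ha, hP⟩, htb⟩ := hN
    obtain ⟨hT', _, hsk, _⟩ := actTy_aggr_iff.1 ha
    have hR : ∀ r ∈ tb.R, Row.HasSchema r f.dom := htb.schema_eq hi hsk ▸ htb.1
    have hcod := f.maps (tb.R.filter fun r => ψ.evalAt T r = some true)
      fun r hr => hR r (Multiset.mem_filter.1 hr).1
    exact ⟨hP.substs (hT'.assignTy_of_bind hcod hσ), htb⟩
  | create _ l₁ l₂ i sk P _ =>
    simp only [netTy_par_iff, netTy_proc_iff, netTy_table_iff, procTy_pref_iff] at hN ⊢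
    obtain ⟨⟨_, ha, hP⟩, _⟩ := hN
    obtain ⟨rfl, _, hsk⟩ := actTy_create_iff.1 ha
    exact ⟨hP, fun r hr => absurd hr (Multiset.notMem_zero r), i, rfl, hsk⟩
  | create_skip _ l₁ l₂ i sk P _ =>
    simp only [netTy_par_iff, netTy_proc_iff, procTy_pref_iff] at hN ⊢
    obtain ⟨⟨_, ha, hP⟩, hnil⟩ := hN
    obtain ⟨rfl, _⟩ := actTy_create_iff.1 ha
    exact ⟨hP, hnil⟩
  | drop _ l₁ l₂ i P tb _ =>
    simp only [netTy_par_iff, netTy_proc_iff, procTy_pref_iff] at hN ⊢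
    obtain ⟨⟨_, ha, hP⟩, _⟩ := hN
    obtain ⟨rfl, _⟩ := actTy_drop_iff.1 ha
    exact ⟨hP, .nil _⟩
  | spawn _ l₁ l₂ P P' _ =>
    simp only [netTy_par_iff, netTy_proc_iff, procTy_pref_iff] at hN ⊢
    obtain ⟨⟨_, ha, hP'⟩, _⟩ := hN
    obtain ⟨rfl, _, hP⟩ := actTy_spawn_iff.1 ha
    exact ⟨hP', hP⟩
  | for_tt _ l tb T ψ o P r₀ σ hr₀ _ hσ _ =>
    simp only [netTy_proc_iff, procTy_seq_iff, procTy_foreach_iff] at hN ⊢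
    obtain ⟨sk, htb, Γ₁, hT, hψ, hP⟩ := hN
    obtain ⟨hsk, hR, hi⟩ := tbTy_conc_iff.1 htb
    refine ⟨hP.substs (hT.assignTy_of_bind (hR r₀ hr₀) hσ), sk, ?_, Γ₁, hT, hψ, hP⟩
    exact tbTy_conc_iff.2
      ⟨hsk, fun r hr => hR r (Multiset.mem_of_le (Multiset.sub_le_self _ _) hr), hi⟩
  | for_err _ l tb T ψ o P _ hbad =>
    simp only [netTy_proc_iff, procTy_foreach_iff] at hN
    obtain ⟨sk, htb, Γ₁, hT, hψ, hP⟩ := hN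
    obtain ⟨_, hR, _⟩ := tbTy_conc_iff.1 htb
    obtain ⟨r, hr, hbad⟩ := hbad
    exact absurd hbad (hT.evalAt_pred_ne_none hψ (hR r hr))
  | for_ff => exact netTy_proc_iff.2 (.nil _)
  | seq_tt P₂ _ _ ih =>
    simp only [netTy_par_iff, netTy_proc_iff, procTy_seq_iff] at hN ih ⊢
    obtain ⟨h₁, hN'⟩ := ih ⟨hN.1.1, hN.2⟩
    exact ⟨⟨h₁, hN.1.2⟩, hN'⟩
  | seq_ff P₂ _ ih =>
    simp only [netTy_par_iff, netTy_proc_iff, procTy_seq_iff] at hN ih ⊢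
    exact ⟨hN.1.2, (ih ⟨hN.1.1, hN.2⟩).2⟩
  | call _ l A es D r σ hA hr hσ =>
    simp only [netTy_proc_iff, procTy_call_iff] at hN ⊢
    obtain ⟨D', hD', hbody, hes⟩ := hN
    obtain rfl := Option.some.inj (hA.symm.trans hD')
    have hbody : ProcTy Δ Sch H D.env D.body := by
      refine hbody.elim id fun hAH => ?_
      obtain ⟨D', hD', hbody⟩ := hH A hAH
      obtain rfl := Option.some.inj (hA.symm.trans hD')
      exact hbody
    obtain ⟨r', hr', hs⟩ := forall₂_exists_evalAll hes
    obtain rfl := Option.some.inj (hr.symm.trans hr')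
    exact ProcTy.substs (Γ := []) (bindParams_assignTy hσ hs) ((List.append_nil _).symm ▸ hbody)
  | par _ ih =>
    rw [netTy_par_iff] at hN ⊢
    exact ⟨ih hN.1, hN.2⟩
  | res l _ ih => exact netTy_res_iff.2 (ih (netTy_res_iff.1 hN))
  | equiv h₁ _ h₂ ih => exact h₂.netTy_iff.1 (ih (h₁.netTy_iff.1 hN))

/-- Well-typedness of `N'` in the empty environment entails that `N'` is closed, hence well typed in
`Γ`, even if `N'` contains new copies of procedure bodies whose bound variables occur in `Γ`. -/
theorem Step.netTy_of_closed (hH : ∀ A ∈ H, ∃ D, Δ A = some D ∧ ProcTy Δ Sch H D.env D.body)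
    {Nenv N N' : Net S} (h : Step Δ Nenv N N') (hclosed : N.Closed) (hN : NetTy Δ Sch H Γ N) :
    NetTy Δ Sch H Γ N' := by
  have hN' := h.netTy hH ((netTy_iff_of_closed hclosed Γ []).1 hN)
  exact (netTy_iff_of_closed hN'.closed [] Γ).1 hN'

end

end KlaimDB

theorem theorem1 (S : KlaimDB.Sig) (Δ : KlaimDB.Defns S) (Sch : KlaimDB.Schemas S)
    (Γ : KlaimDB.Env S) (N N' : KlaimDB.Net S)
    (hclosed : N.Closed)
    (hdisj : N.bv ∩ Γ.dom = ∅)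
    (hstep : KlaimDB.Step Δ KlaimDB.Net.nil N N') :
    (KlaimDB.WellTyped Δ Sch Γ N → KlaimDB.WellTyped Δ Sch Γ N') ∧
      (KlaimDB.WellTypedRec Δ Sch Γ N → KlaimDB.WellTypedRec Δ Sch Γ N') :=
  ⟨fun h => hstep.netTy_of_closed (fun _ hA => hA.elim) hclosed h,
    fun ⟨H, hH, h⟩ => ⟨H, hH, hstep.netTy_of_closed hH hclosed h⟩⟩
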